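/- **Setting.** Let $(\overline M,\overline J,\overline g)$ be a Kähler–Norden manifold of dimension $2n\ge 4$: $\overline g$ is a smooth semi-Riemannian metric, $\overline J$ a smooth almost complex structure with $\overline J^2=-\mathrm{id}$ and $\overline g(\overline JX,\overline JY)=-\overline g(X,Y)$, and $\overline J$ is parallel for the Levi-Civita connection $\overline\nabla$ of $\overline g$. Let $\overline{\widetilde g}(X,Y)=\overline g(\overline JX,Y)$ be the associated metric. Write $\overline R(X,Y)Z=\overline\nabla_X\overline\nabla_YZ-\overline\nabla_Y\overline\nabla_XZ-\overline\nabla_{[X,Y]}Z$, $\overline R(x,y,z,w)=\overline g(\overline R(x,y)z,w)$ and $\overline\pi_1(x,y,y,x)=\overline g(y,y)\overline g(x,x)-\overline g(x,y)^2$. Assume that $\overline M$ is of constant totally real sectional curvatures with respect to $\overline g$: there are functions $\overline\nu,\overline{\widetilde\nu}:\overline M\to\mathbb R$ such that, for every $p$ and every plane $\alpha=\mathrm{span}\{x,y\}\subset T_p\overline M$ with $\overline\pi_1(x,y,y,x)\ne0$ and $\overline J\alpha\perp\alpha$ (with respect to $\overline g$), $$\frac{\overline R(x,y,y,x)}{\overline\pi_1(x,y,y,x)}=\overline\nu(p),\qquad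 \frac{\overline R(x,y,y,\overline Jx)}{\overline\pi_1(x,y,y,x)}=\overline{\widetilde\nu}(p).$$ **Hypersurfaces.** Let $G$ be one of the metrics $\overline g$, $\overline{\widetilde g}$, and let $M$ be an immersed hypersurface of $\overline M$ that is lightlike for $G$, i.e. $\mathrm{Rad}\,T_pM=T_pM\cap T_pM^{\perp_G}\neq 0$ for all $p\in M$. Let $S(TM)$ be a screen distribution, i.e. a smooth distribution with $TM=S(TM)\oplus \mathrm{Rad}\,TM$. A pair $\{\xi,N\}$ over an open set $U\subset M$ consists of a smooth section $\xi$ of $\mathrm{Rad}\,TM$ and the vector field $N$ along $U$ with $G(N,\xi)=1$, $G(N,N)=0$ and $G(N,W)=0$ for all $W\in S(TM)$; the lines spanned by such $N$ form the transversal bundle $\mathrm{tr}(TM)$, and $T\overline M|_M=TM\oplus\mathrm{tr}(TM)$. The induced connection $\nabla$ on $M$ and the local second fundamental form $B$ relative to $\{\xi,N\}$ are defined by $\nabla^G_XY=\nabla_XY+B(X,Y)N$, where $\nabla^G$ is the Levi-Civita connection of $G$. The hypersurface is *radical transversal* if $\overline J(\mathrm{Rad}\,TM)=\mathrm{tr}(TM)$,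 and *totally umbilical* if locally $B=\rho\,G|_M$ for a smooth function $\rho$. For a radical transversal hypersurface, let $b$ be the function with $\overline J\xi=bN$. Let $R$ be the curvature tensor of $\nabla$ and let $\mathrm{Ric}(X,Y)=\mathrm{trace}\{Z\mapsto R(X,Z)Y\}$. Then $M$ is *locally symmetric* if $\nabla R=0$, *semi-symmetric* if $\mathcal R(X,Y)\cdot R=0$ for all $X,Y$, *Ricci semi-symmetric* if $\mathcal R(X,Y)\cdot\mathrm{Ric}=0$ for all $X,Y$ (where $\mathcal R(X,Y)$ acts on tensors as the derivation induced by $R(X,Y)$), and *almost Einstein* if $\mathrm{Ric}=kg+c\widetilde g$ for real constants $k,c$, where $g,\widetilde g$ are the metrics induced on $M$ by $\overline g,\overline{\widetilde g}$. **Proposition 5.1.** (1) Let $(M,g)$ be a totally umbilical radical transversal lightlike hypersurface of $\overline M$ (for $G=\overline g$). If the functions $b$ and $\rho$ are constant, i.e. there are real numbers $b,\rho$ and an open cover of $M$ such that over each member of the cover there is a pair $\{\xi,N\}$ with $\overline J\xi=bN$ and $B=\rho g$, then $(M,g)$, with its induced connection, is locally symmetric, semi-symmetric, Ricci semi-symmetric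 and almost Einstein. (2) Let $(M,\widetilde g)$ be a totally umbilical radical transversal lightlike hypersurface of $\overline M$ (for $G=\overline{\widetilde g}$). If the corresponding functions $\widetilde b$ and $\widetilde\rho$ are constant in the same sense, then $(M,\widetilde g)$, with its induced connection, is locally symmetric, semi-symmetric, Ricci semi-symmetric and almost Einstein. -/

import Mathlib

open Bundle Manifold Set Module
open scoped Manifold ContDiff Topology

noncomputable section

namespace KahlerNorden

variable {E : Type*} [NormedAddCommGroup E] [NormedSpace ℝ E]
  {N : Type*} [TopologicalSpace N] [ChartedSpace E N]

section Ambient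

variable (E N) in
/-- A smooth semi-Riemannian metric on a manifold `N` modelled on `E`. -/
structure SemiRiemannianMetric [IsManifold 𝓘(ℝ, E) ∞ N] where
  /-- The bilinear form on each tangent space. -/
  inner (x : N) : TangentSpace 𝓘(ℝ, E) x →L[ℝ] TangentSpace 𝓘(ℝ, E) x →L[ℝ] ℝ
  symm (x : N) (v w : TangentSpace 𝓘(ℝ, E) x) : inner x v w = inner x w v
  nondegenerate (x : N) (v : TangentSpace 𝓘(ℝ, E) x) (h : ∀ w, inner x v w = 0) : v = 0
  contMDiff : ContMDiff 𝓘(ℝ, E) (𝓘(ℝ, E).prod 𝓘(ℝ, E →L[ℝ] E →L[ℝ] ℝ)) ∞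
    (fun x ↦ TotalSpace.mk' (E →L[ℝ] E →L[ℝ] ℝ)
      (E := fun x : N ↦ TangentSpace 𝓘(ℝ, E) x →L[ℝ] TangentSpace 𝓘(ℝ, E) x →L[ℝ] ℝ)
      x (inner x))

variable [IsManifold 𝓘(ℝ, E) ∞ N]

/-- An almost complex structure `J` for which `g` is a Norden metric. -/
structure NordenStructure (g : SemiRiemannianMetric E N) where
  /-- The almost complex structure on each tangent space. -/
  J (x : N) : TangentSpace 𝓘(ℝ, E) x →L[ℝ] TangentSpace 𝓘(ℝ, E) x
  sq (x : N) (v : TangentSpace 𝓘(ℝ, E) x) : J x (J x v) = -v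
  anti_isometry (x : N) (v w : TangentSpace 𝓘(ℝ, E) x) :
    g.inner x (J x v) (J x w) = - g.inner x v w
  contMDiff : ContMDiff 𝓘(ℝ, E) (𝓘(ℝ, E).prod 𝓘(ℝ, E →L[ℝ] E)) ∞
    (fun x ↦ TotalSpace.mk' (E →L[ℝ] E)
      (E := fun x : N ↦ TangentSpace 𝓘(ℝ, E) x →L[ℝ] TangentSpace 𝓘(ℝ, E) x) x (J x))

/-- The associated metric `g̃(X, Y) = g(J X, Y)`. -/
def NordenStructure.associated {g : SemiRiemannianMetric E N} (j : NordenStructure g) :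
    SemiRiemannianMetric E N where
  inner x := (g.inner x).comp (j.J x)
  symm x v w := by
    have h := j.anti_isometry x v (j.J x w)
    rw [j.sq, map_neg] at h
    simp only [ContinuousLinearMap.comp_apply]
    linarith [g.symm x v (j.J x w)]
  nondegenerate x v h := by
    have := g.nondegenerate x (j.J x v) h
    have h2 := j.sq x v
    rw [this, map_zero] at h2
    exact (neg_eq_zero.mp h2.symm)
  contMDiff := by
    intro x₀
    have h1 := (g.contMDiff x₀)
    have h2 := (j.contMDiff x₀)
    rw [contMDiffAt_hom_bundle] at h1 h2 ⊢
    refine ⟨h1.1, ?_⟩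
    refine (h1.2.clm_comp h2.2).congr_of_eventuallyEq ?_
    filter_upwards [(trivializationAt E (TangentSpace 𝓘(ℝ, E)) x₀).open_baseSet.mem_nhds
      (FiberBundle.mem_baseSet_trivializationAt' x₀)] with x hx
    ext v w
    have := (trivializationAt E (TangentSpace 𝓘(ℝ, E)) x₀).symmL_continuousLinearMapAt (R := ℝ) hx
      (j.J x ((trivializationAt E (TangentSpace 𝓘(ℝ, E)) x₀).symmL ℝ x v))
    simp only [Trivialization.continuousLinearMapAt_apply] at this
    simp [ContinuousLinearMap.inCoordinates, this]


/-- `cov` is the Levi-Civita connection of `g`: it is torsion-free and parallelizes `g`. -/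
structure IsLeviCivita [FiniteDimensional ℝ E] (g : SemiRiemannianMetric E N)
    (cov : CovariantDerivative 𝓘(ℝ, E) E (TangentSpace 𝓘(ℝ, E) : N → Type _)) : Prop where
  torsion_free {x : N} {X Y : Π x : N, TangentSpace 𝓘(ℝ, E) x}
    (hX : MDiffAt (T% X) x) (hY : MDiffAt (T% Y) x) :
    cov Y x (X x) - cov X x (Y x) = VectorField.mlieBracket 𝓘(ℝ, E) X Y x
  metric {x : N} {Y Z : Π x : N, TangentSpace 𝓘(ℝ, E) x}
    (hY : MDiffAt (T% Y) x) (hZ : MDiffAt (T% Z) x) (v : TangentSpace 𝓘(ℝ, E) x) :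
    d% (fun y ↦ g.inner y (Y y) (Z y)) x v =
      g.inner x (cov Y x v) (Z x) + g.inner x (Y x) (cov Z x v)

lemma SemiRiemannianMetric.ext_inner {g : SemiRiemannianMetric E N} {x : N} {u v : TangentSpace 𝓘(ℝ, E) x}
    (h : ∀ Z : Π x : N, TangentSpace 𝓘(ℝ, E) x, MDiffAt (T% Z) x →
      g.inner x u (Z x) = g.inner x v (Z x)) : u = v := by
  rw [← sub_eq_zero]
  refine g.nondegenerate x _ fun w ↦ ?_
  have := h (FiberBundle.extend E w) (FiberBundle.mdifferentiableAt_extend ..)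
  simp only [FiberBundle.extend_apply_self] at this
  simp [this]

section Existence

variable (g : SemiRiemannianMetric E N)

lemma SemiRiemannianMetric.mdifferentiableAt_inner {x : N} {Y Z : Π x : N, TangentSpace 𝓘(ℝ, E) x}
    (hY : MDiffAt (T% Y) x) (hZ : MDiffAt (T% Z) x) :
    MDiffAt (fun y ↦ g.inner y (Y y) (Z y)) x := by
  have hg := (g.contMDiff x).mdifferentiableAt (by simp)
  have : MDifferentiableAt 𝓘(ℝ, E) (𝓘(ℝ, E).prod 𝓘(ℝ))
      (fun m ↦ TotalSpace.mk' ℝ (E := Bundle.Trivial N ℝ) m (g.inner m (Y m) (Z m))) x :=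
    MDifferentiableAt.clm_bundle_apply₂ (F₁ := E) (F₂ := E) hg hY hZ
  simp only [mdifferentiableAt_totalSpace] at this
  exact this.2

/-- The right-hand side of the Koszul formula. -/
def koszul (X Y Z : Π x : N, TangentSpace 𝓘(ℝ, E) x) (x : N) : ℝ :=
  d% (fun y ↦ g.inner y (Y y) (Z y)) x (X x) + d% (fun y ↦ g.inner y (X y) (Z y)) x (Y x)
    - d% (fun y ↦ g.inner y (X y) (Y y)) x (Z x)
    + g.inner x (VectorField.mlieBracket 𝓘(ℝ, E) X Y x) (Z x)
    - g.inner x (VectorField.mlieBracket 𝓘(ℝ, E) X Z x) (Y x)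
    - g.inner x (VectorField.mlieBracket 𝓘(ℝ, E) Y Z x) (X x)

variable [FiniteDimensional ℝ E]
variable {g} {x : N} {X X' Y Y' Z Z' : Π x : N, TangentSpace 𝓘(ℝ, E) x}

lemma koszul_smul_left {f : N → ℝ} (hf : MDiffAt f x) (hX : MDiffAt (T% X) x)
    (hY : MDiffAt (T% Y) x) (hZ : MDiffAt (T% Z) x) :
    koszul g (f • X) Y Z x = f x * koszul g X Y Z x := by
  have e1 : (fun y ↦ g.inner y ((f • X) y) (Z y)) = fun y ↦ f y * g.inner y (X y) (Z y) := by
    ext; simp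
  have e2 : (fun y ↦ g.inner y ((f • X) y) (Y y)) = fun y ↦ f y * g.inner y (X y) (Y y) := by
    ext; simp
  have h1 := mvfderiv_fun_mul hf (g.mdifferentiableAt_inner hX hZ)
  have h2 := mvfderiv_fun_mul hf (g.mdifferentiableAt_inner hX hY)
  simp only [koszul, e1, e2, h1, h2, VectorField.mlieBracket_smul_left hf hX]
  simp
  rw [g.symm x (X x) (Z x), g.symm x (X x) (Y x)]
  ring

lemma koszul_add_left (hX : MDiffAt (T% X) x) (hX' : MDiffAt (T% X') x)
    (hY : MDiffAt (T% Y) x) (hZ : MDiffAt (T% Z) x) :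
    koszul g (X + X') Y Z x = koszul g X Y Z x + koszul g X' Y Z x := by
  have e (W : Π x : N, TangentSpace 𝓘(ℝ, E) x) : (fun y ↦ g.inner y ((X + X') y) (W y)) =
      fun y ↦ g.inner y (X y) (W y) + g.inner y (X' y) (W y) := by
    ext; simp
  have h1 := mvfderiv_fun_add (g.mdifferentiableAt_inner hX hZ) (g.mdifferentiableAt_inner hX' hZ)
  have h2 := mvfderiv_fun_add (g.mdifferentiableAt_inner hX hY) (g.mdifferentiableAt_inner hX' hY)
  simp only [koszul, e, h1, h2, VectorField.mlieBracket_add_left hX hX']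
  simp
  ring

lemma koszul_smul_middle {f : N → ℝ} (hf : MDiffAt f x) (hX : MDiffAt (T% X) x)
    (hY : MDiffAt (T% Y) x) (hZ : MDiffAt (T% Z) x) :
    koszul g X (f • Y) Z x =
      f x * koszul g X Y Z x + 2 * (d% f x (X x) * g.inner x (Y x) (Z x)) := by
  have e1 : (fun y ↦ g.inner y ((f • Y) y) (Z y)) = fun y ↦ f y * g.inner y (Y y) (Z y) := by
    ext; simp
  have e2 : (fun y ↦ g.inner y (X y) ((f • Y) y)) = fun y ↦ f y * g.inner y (X y) (Y y) := by
    ext; simp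
  have h1 := mvfderiv_fun_mul hf (g.mdifferentiableAt_inner hY hZ)
  have h2 := mvfderiv_fun_mul hf (g.mdifferentiableAt_inner hX hY)
  simp only [koszul, e1, e2, h1, h2, VectorField.mlieBracket_smul_left hf hY,
    VectorField.mlieBracket_smul_right hf hY]
  simp
  rw [g.symm x (Y x) (X x)]
  ring

lemma koszul_add_middle (hX : MDiffAt (T% X) x) (hY : MDiffAt (T% Y) x)
    (hY' : MDiffAt (T% Y') x) (hZ : MDiffAt (T% Z) x) :
    koszul g X (Y + Y') Z x = koszul g X Y Z x + koszul g X Y' Z x := by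
  have e1 : (fun y ↦ g.inner y ((Y + Y') y) (Z y)) =
      fun y ↦ g.inner y (Y y) (Z y) + g.inner y (Y' y) (Z y) := by
    ext; simp
  have e2 : (fun y ↦ g.inner y (X y) ((Y + Y') y)) =
      fun y ↦ g.inner y (X y) (Y y) + g.inner y (X y) (Y' y) := by
    ext; simp
  have h1 := mvfderiv_fun_add (g.mdifferentiableAt_inner hY hZ) (g.mdifferentiableAt_inner hY' hZ)
  have h2 := mvfderiv_fun_add (g.mdifferentiableAt_inner hX hY) (g.mdifferentiableAt_inner hX hY')
  simp only [koszul, e1, e2, h1, h2, VectorField.mlieBracket_add_left hY hY',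
    VectorField.mlieBracket_add_right hY hY']
  simp
  ring

lemma koszul_smul_right {f : N → ℝ} (hf : MDiffAt f x) (hX : MDiffAt (T% X) x)
    (hY : MDiffAt (T% Y) x) (hZ : MDiffAt (T% Z) x) :
    koszul g X Y (f • Z) x = f x * koszul g X Y Z x := by
  have e (W : Π x : N, TangentSpace 𝓘(ℝ, E) x) : (fun y ↦ g.inner y (W y) ((f • Z) y)) =
      fun y ↦ f y * g.inner y (W y) (Z y) := by
    ext; simp
  have h1 := mvfderiv_fun_mul hf (g.mdifferentiableAt_inner hX hZ)
  have h2 := mvfderiv_fun_mul hf (g.mdifferentiableAt_inner hY hZ)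
  simp only [koszul, e, h1, h2, VectorField.mlieBracket_smul_right hf hZ]
  simp
  rw [g.symm x (Z x) (Y x), g.symm x (Z x) (X x)]
  ring

lemma koszul_add_right (hX : MDiffAt (T% X) x) (hY : MDiffAt (T% Y) x)
    (hZ : MDiffAt (T% Z) x) (hZ' : MDiffAt (T% Z') x) :
    koszul g X Y (Z + Z') x = koszul g X Y Z x + koszul g X Y Z' x := by
  have e (W : Π x : N, TangentSpace 𝓘(ℝ, E) x) : (fun y ↦ g.inner y (W y) ((Z + Z') y)) =
      fun y ↦ g.inner y (W y) (Z y) + g.inner y (W y) (Z' y) := by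
    ext; simp
  have h1 := mvfderiv_fun_add (g.mdifferentiableAt_inner hX hZ) (g.mdifferentiableAt_inner hX hZ')
  have h2 := mvfderiv_fun_add (g.mdifferentiableAt_inner hY hZ) (g.mdifferentiableAt_inner hY hZ')
  simp only [koszul, e, h1, h2, VectorField.mlieBracket_add_right hZ hZ']
  simp
  ring

lemma exists_koszulForm (hY : MDiffAt (T% Y) x) :
    ∃ A : TangentSpace 𝓘(ℝ, E) x →L[ℝ] TangentSpace 𝓘(ℝ, E) x,
      ∀ X Z : Π x : N, TangentSpace 𝓘(ℝ, E) x, MDiffAt (T% X) x → MDiffAt (T% Z) x →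
        2 * g.inner x (A (X x)) (Z x) = koszul g X Y Z x := by
  have t1 (Z : Π x : N, TangentSpace 𝓘(ℝ, E) x) (hZ : MDiffAt (T% Z) x) :
      TensorialAt 𝓘(ℝ, E) E (koszul g · Y Z x) x :=
    ⟨fun hf hX ↦ koszul_smul_left hf hX hY hZ, fun hX hX' ↦ koszul_add_left hX hX' hY hZ⟩
  have t2 (X : Π x : N, TangentSpace 𝓘(ℝ, E) x) (hX : MDiffAt (T% X) x) :
      TensorialAt 𝓘(ℝ, E) E (koszul g X Y · x) x :=
    ⟨fun hf hZ ↦ koszul_smul_right hf hX hY hZ, fun hZ hZ' ↦ koszul_add_right hX hY hZ hZ'⟩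
  let K := TensorialAt.mkHom₂ (fun X Z ↦ koszul g X Y Z x) x t1 t2
  have : FiniteDimensional ℝ (TangentSpace 𝓘(ℝ, E) x) := inferInstanceAs (FiniteDimensional ℝ E)
  have : T2Space (TangentSpace 𝓘(ℝ, E) x) := inferInstanceAs (T2Space E)
  let G : TangentSpace 𝓘(ℝ, E) x →ₗ[ℝ] Dual ℝ (TangentSpace 𝓘(ℝ, E) x) :=
    ContinuousLinearMap.coeLM ℝ ∘ₗ (g.inner x).toLinearMap
  have hG : Function.Injective G := by
    rw [← LinearMap.ker_eq_bot, LinearMap.ker_eq_bot']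
    exact fun v hv ↦ g.nondegenerate x v fun w ↦ LinearMap.congr_fun hv w
  let G' := LinearEquiv.ofInjectiveOfFinrankEq G hG (Subspace.dual_finrank_eq).symm
  let A : TangentSpace 𝓘(ℝ, E) x →ₗ[ℝ] TangentSpace 𝓘(ℝ, E) x :=
    (2⁻¹ : ℝ) • (G'.symm.toLinearMap ∘ₗ (ContinuousLinearMap.coeLM ℝ ∘ₗ K.toLinearMap))
  refine ⟨LinearMap.toContinuousLinearMap A, fun X Z hX hZ ↦ ?_⟩
  have h2 : G (A (X x)) (Z x) = 2⁻¹ * K (X x) (Z x) := by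
    have : G' (G'.symm ((ContinuousLinearMap.coeLM ℝ ∘ₗ K.toLinearMap) (X x))) = _ :=
      G'.apply_symm_apply _
    simp only [A, LinearMap.smul_apply, map_smul, smul_eq_mul]
    congr 1
    exact LinearMap.congr_fun this (Z x)
  have h3 : K (X x) (Z x) = koszul g X Y Z x := TensorialAt.mkHom₂_apply t1 t2 hX hZ
  rw [← h3]
  have h4 : g.inner x (A (X x)) (Z x) = 2⁻¹ * K (X x) (Z x) := h2
  change 2 * g.inner x (A (X x)) (Z x) = _
  rw [h4]
  ring

open scoped Classical in
/-- The Koszul formula as an operator on vector fields. -/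
def koszulOp (g : SemiRiemannianMetric E N) (Y : Π x : N, TangentSpace 𝓘(ℝ, E) x) (x : N) :
    TangentSpace 𝓘(ℝ, E) x →L[ℝ] TangentSpace 𝓘(ℝ, E) x :=
  if hY : MDiffAt (T% Y) x then (exists_koszulForm (g := g) hY).choose else 0

lemma koszulOp_spec (hX : MDiffAt (T% X) x) (hY : MDiffAt (T% Y) x) (hZ : MDiffAt (T% Z) x) :
    2 * g.inner x (koszulOp g Y x (X x)) (Z x) = koszul g X Y Z x := by
  rw [koszulOp, dif_pos hY]
  exact (exists_koszulForm (g := g) hY).choose_spec X Z hX hZ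

lemma exists_isLeviCivita (g : SemiRiemannianMetric E N) : ∃ cov, IsLeviCivita g cov := by
  refine ⟨⟨koszulOp g, ⟨?_, ?_⟩⟩, ⟨?_, ?_⟩⟩
  · intro Y Y' x hY hY' _
    ext v
    obtain ⟨X, hX, rfl⟩ : ∃ X : Π x : N, TangentSpace 𝓘(ℝ, E) x, MDiffAt (T% X) x ∧ X x = v :=
      ⟨FiberBundle.extend E v, FiberBundle.mdifferentiableAt_extend .., by simp⟩
    refine SemiRiemannianMetric.ext_inner (g := g) fun Z hZ ↦ ?_
    have h1 := koszulOp_spec (g := g) hX hY hZ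
    have h2 := koszulOp_spec (g := g) hX hY' hZ
    have h3 := koszulOp_spec (g := g) hX (mdifferentiableAt_add_section hY hY') hZ
    have h4 := koszul_add_middle (g := g) hX hY hY' hZ
    simp only [add_apply, map_add]
    linarith
  · intro Y f x hY hf _
    ext v
    obtain ⟨X, hX, rfl⟩ : ∃ X : Π x : N, TangentSpace 𝓘(ℝ, E) x, MDiffAt (T% X) x ∧ X x = v :=
      ⟨FiberBundle.extend E v, FiberBundle.mdifferentiableAt_extend .., by simp⟩
    refine SemiRiemannianMetric.ext_inner (g := g) fun Z hZ ↦ ?_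
    have h1 := koszulOp_spec (g := g) hX hY hZ
    have h3 := koszulOp_spec (g := g) hX (hf.smul_section hY) hZ
    have h4 := koszul_smul_middle (g := g) hf hX hY hZ
    simp only [add_apply, map_add, smul_apply, map_smul,
      ContinuousLinearMap.smulRight_apply, smul_eq_mul]
    change 2 * g.inner x (koszulOp g (f • Y) x (X x)) (Z x) = _ at h3
    rw [h4, ← h1] at h3
    linarith
  · intro x X Y hX hY
    refine SemiRiemannianMetric.ext_inner (g := g) fun Z hZ ↦ ?_
    have h1 := koszulOp_spec (g := g) hX hY hZ
    have h2 := koszulOp_spec (g := g) hY hX hZ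
    simp only [map_sub, sub_apply]
    have e : (fun y ↦ g.inner y (Y y) (X y)) = fun y ↦ g.inner y (X y) (Y y) := by
      ext y; exact g.symm ..
    rw [koszul] at h1 h2
    rw [e, VectorField.mlieBracket_swap_apply] at h2
    simp only [map_neg, neg_apply] at h2
    linarith
  · intro x Y Z hY hZ v
    obtain ⟨X, hX, rfl⟩ : ∃ X : Π x : N, TangentSpace 𝓘(ℝ, E) x, MDiffAt (T% X) x ∧ X x = v :=
      ⟨FiberBundle.extend E v, FiberBundle.mdifferentiableAt_extend .., by simp⟩
    have h1 := koszulOp_spec (g := g) hX hY hZ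
    have h2 := koszulOp_spec (g := g) hX hZ hY
    have e : (fun y ↦ g.inner y (Z y) (Y y)) = fun y ↦ g.inner y (Y y) (Z y) := by
      ext y; exact g.symm ..
    rw [koszul] at h1 h2
    rw [e, VectorField.mlieBracket_swap_apply (V := Z)] at h2
    simp only [map_neg, neg_apply] at h2
    rw [g.symm x (Y x)]
    linarith

/-- The Levi-Civita connection of `g`. -/
def leviCivita (g : SemiRiemannianMetric E N) :
    CovariantDerivative 𝓘(ℝ, E) E (TangentSpace 𝓘(ℝ, E) : N → Type _) :=
  (exists_isLeviCivita g).choose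

lemma isLeviCivita_leviCivita (g : SemiRiemannianMetric E N) : IsLeviCivita g (leviCivita g) :=
  (exists_isLeviCivita g).choose_spec

end Existence

section Curvature

/-- `R(X, Y, Z) = ∇_X ∇_Y Z - ∇_Y ∇_X Z - ∇_[X, Y] Z`, where `cov Z x v` is `∇_v Z` at `x`. -/
def curvatureOp
    (cov : (Π x : N, TangentSpace 𝓘(ℝ, E) x) → Π x : N,
      TangentSpace 𝓘(ℝ, E) x → TangentSpace 𝓘(ℝ, E) x)
    (X Y Z : Π x : N, TangentSpace 𝓘(ℝ, E) x) (x : N) : TangentSpace 𝓘(ℝ, E) x :=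
  cov (fun y ↦ cov Z y (Y y)) x (X x) - cov (fun y ↦ cov Z y (X y)) x (Y x)
    - cov Z x (VectorField.mlieBracket 𝓘(ℝ, E) X Y x)

/-- The curvature tensor at `x`: the tangent vectors are extended to vector fields that are
smooth near `x` (the value does not depend on the extensions). -/
def curvature
    (cov : (Π x : N, TangentSpace 𝓘(ℝ, E) x) → Π x : N,
      TangentSpace 𝓘(ℝ, E) x → TangentSpace 𝓘(ℝ, E) x)
    (x : N) (u v w : TangentSpace 𝓘(ℝ, E) x) : TangentSpace 𝓘(ℝ, E) x :=
  curvatureOp cov (FiberBundle.extend E u) (FiberBundle.extend E v) (FiberBundle.extend E w) x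

/-- The Ricci type tensor `R⁽⁰'²⁾(u, v) = trace (z ↦ R(u, z, v))`, the trace being computed in a
basis of the tangent space. -/
def ricci [FiniteDimensional ℝ E]
    (cov : (Π x : N, TangentSpace 𝓘(ℝ, E) x) → Π x : N,
      TangentSpace 𝓘(ℝ, E) x → TangentSpace 𝓘(ℝ, E) x)
    (x : N) (u v : TangentSpace 𝓘(ℝ, E) x) : ℝ :=
  let e : Basis (Fin (finrank ℝ E)) ℝ (TangentSpace 𝓘(ℝ, E) x) := finBasis ℝ E
  ∑ i, e.repr (curvature cov x u (e i) v) i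

/-- Locally symmetric: `∇R = 0`. -/
def IsLocallySymmetric
    (cov : (Π x : N, TangentSpace 𝓘(ℝ, E) x) → Π x : N,
      TangentSpace 𝓘(ℝ, E) x → TangentSpace 𝓘(ℝ, E) x) : Prop :=
  ∀ (x : N) (X Y Z : Π x : N, TangentSpace 𝓘(ℝ, E) x) (u : TangentSpace 𝓘(ℝ, E) x),
    CMDiffAt ∞ (T% X) x → CMDiffAt ∞ (T% Y) x → CMDiffAt ∞ (T% Z) x →
    cov (fun y ↦ curvature cov y (X y) (Y y) (Z y)) x u
      - curvature cov x (cov X x u) (Y x) (Z x) - curvature cov x (X x) (cov Y x u) (Z x)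
      - curvature cov x (X x) (Y x) (cov Z x u) = 0

/-- Semi-symmetric: `R · R = 0`. -/
def IsSemiSymmetric
    (cov : (Π x : N, TangentSpace 𝓘(ℝ, E) x) → Π x : N,
      TangentSpace 𝓘(ℝ, E) x → TangentSpace 𝓘(ℝ, E) x) : Prop :=
  ∀ (p : N) (x y u v w : TangentSpace 𝓘(ℝ, E) p),
    curvature cov p x y (curvature cov p u v w) - curvature cov p u v (curvature cov p x y w)
      - curvature cov p (curvature cov p x y u) v w
      - curvature cov p u (curvature cov p x y v) w = 0

/-- Ricci semi-symmetric: `R · Ric = 0`. -/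
def IsRicciSemiSymmetric [FiniteDimensional ℝ E]
    (cov : (Π x : N, TangentSpace 𝓘(ℝ, E) x) → Π x : N,
      TangentSpace 𝓘(ℝ, E) x → TangentSpace 𝓘(ℝ, E) x) : Prop :=
  ∀ (p : N) (x y u v : TangentSpace 𝓘(ℝ, E) p),
    - ricci cov p (curvature cov p x y u) v - ricci cov p u (curvature cov p x y v) = 0

end Curvature

section KahlerNorden

variable [FiniteDimensional ℝ E] {g : SemiRiemannianMetric E N}

/-- The Kähler-Norden condition: `J` is parallel for the Levi-Civita connection of `g`. -/
def NordenStructure.IsKahler (j : NordenStructure g) : Prop :=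
  ∀ (x : N) (Y : Π x : N, TangentSpace 𝓘(ℝ, E) x) (v : TangentSpace 𝓘(ℝ, E) x),
    MDiffAt (T% Y) x → leviCivita g (fun y ↦ j.J y (Y y)) x v = j.J x (leviCivita g Y x v)

/-- The `(0,4)` curvature tensor of `g`. -/
def riemann (g : SemiRiemannianMetric E N) (p : N) (x y z w : TangentSpace 𝓘(ℝ, E) p) : ℝ :=
  g.inner p (curvature (fun Y q v ↦ leviCivita g Y q v) p x y z) w

/-- `π₁(x, y, z, w) = g(y, z) g(x, w) - g(x, z) g(y, w)`. -/
def piOne (g : SemiRiemannianMetric E N) (p : N) (x y z w : TangentSpace 𝓘(ℝ, E) p) : ℝ :=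
  g.inner p y z * g.inner p x w - g.inner p x z * g.inner p y w

/-- Constant totally real sectional curvatures `ν`, `ν'` with respect to `g`: for every section
`α = span {x, y}` at `p` that is non-degenerate (`π₁(x, y, y, x) ≠ 0`) and totally real
(`J α` is orthogonal to `α`), the two sectional curvatures of `α` are `ν p` and `ν' p`. -/
def NordenStructure.HasConstantTotallyRealCurvatures (j : NordenStructure g) (ν ν' : N → ℝ) :
    Prop :=
  ∀ (p : N) (x y : TangentSpace 𝓘(ℝ, E) p), piOne g p x y y x ≠ 0 →
    (∀ u ∈ Submodule.span ℝ {x, y}, ∀ v ∈ Submodule.span ℝ {x, y}, g.inner p (j.J p u) v = 0) →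
    riemann g p x y y x / piOne g p x y y x = ν p ∧
      riemann g p x y y (j.J p x) / piOne g p x y y x = ν' p

end KahlerNorden

end Ambient

section Hypersurface

variable [IsManifold 𝓘(ℝ, E) ∞ N] [FiniteDimensional ℝ E]
  {F : Type*} [NormedAddCommGroup F] [NormedSpace ℝ F]
  {M : Type*} [TopologicalSpace M] [ChartedSpace F M] [IsManifold 𝓘(ℝ, F) ∞ M]

variable (E F) in
/-- An immersed hypersurface of `N`. -/
structure IsHypersurface (ι : M → N) : Prop where
  contMDiff : ContMDiff 𝓘(ℝ, F) 𝓘(ℝ, E) ∞ ι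
  injective (p : M) : Function.Injective (mfderiv 𝓘(ℝ, F) 𝓘(ℝ, E) ι p)
  codim : finrank ℝ F + 1 = finrank ℝ E

/-- The covariant derivative `∇_v W` at `p` of a vector field `W` along `ι : M → N`, i.e. the
pull-back connection: writing `W = ∑ wⁱ (eᵢ ∘ ι)` in the coordinate frame `e` around `ι p`, it is
`∑ dwⁱ(v) eᵢ + ∇_{dι v} (∑ wⁱ(p) eᵢ)`. -/
def covAlong (cov : CovariantDerivative 𝓘(ℝ, E) E (TangentSpace 𝓘(ℝ, E) : N → Type _))
    (ι : M → N) (W : Π p : M, TangentSpace 𝓘(ℝ, E) (ι p)) (p : M)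
    (v : TangentSpace 𝓘(ℝ, F) p) : TangentSpace 𝓘(ℝ, E) (ι p) :=
  let t := trivializationAt E (TangentSpace 𝓘(ℝ, E) : N → Type _) (ι p)
  t.symm (ι p) (mfderiv 𝓘(ℝ, F) 𝓘(ℝ, E) (fun q ↦ (t ⟨ι q, W q⟩).2) p v)
    + cov (FiberBundle.extend E (W p)) (ι p) (mfderiv 𝓘(ℝ, F) 𝓘(ℝ, E) ι p v)

variable (G : SemiRiemannianMetric E N) (ι : M → N)

/-- The metric on `M` induced by `G`. -/
def induced (p : M) (v w : TangentSpace 𝓘(ℝ, F) p) : ℝ :=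
  G.inner (ι p) (mfderiv 𝓘(ℝ, F) 𝓘(ℝ, E) ι p v) (mfderiv 𝓘(ℝ, F) 𝓘(ℝ, E) ι p w)

/-- `Rad T_p M = T_p M ∩ (T_p M)^⊥`. -/
def radical (p : M) : Submodule ℝ (TangentSpace 𝓘(ℝ, F) p) where
  carrier := {v | ∀ w, induced G ι p v w = 0}
  zero_mem' w := by simp [induced]
  add_mem' hv hw u := by
    have h1 := hv u
    have h2 := hw u
    simp only [induced] at h1 h2 ⊢
    simp [h1, h2]
  smul_mem' c v hv u := by
    have h1 := hv u
    simp only [induced] at h1 ⊢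
    simp [h1]

/-- A distribution on `M` is smooth if it is locally spanned by smooth vector fields. -/
def IsSmoothDistribution
    (S : Π p : M, Submodule ℝ (TangentSpace 𝓘(ℝ, F) p)) : Prop :=
  ∀ p : M, ∃ U : Set M, IsOpen U ∧ p ∈ U ∧ ∃ (k : ℕ) (X : Fin k → Π q : M, TangentSpace 𝓘(ℝ, F) q),
    (∀ i, CMDiff[U] ∞ (T% (X i))) ∧ ∀ q ∈ U, S q = Submodule.span ℝ (range fun i ↦ X i q)

/-- `S` is a screen distribution: a smooth distribution complementary to the radical one. -/
structure IsScreen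
    (S : Π p : M, Submodule ℝ (TangentSpace 𝓘(ℝ, F) p)) : Prop where
  smooth : IsSmoothDistribution S
  isCompl (p : M) : IsCompl (S p) (radical G ι p)

/-- The conditions `ξ ∈ Rad T_p M`, `G(n, ξ) = 1`, `G(n, n) = G(n, w) = 0` for all `w ∈ S(TM)`. -/
structure IsNullPair (S : Π p : M, Submodule ℝ (TangentSpace 𝓘(ℝ, F) p)) (p : M)
    (ξ : TangentSpace 𝓘(ℝ, F) p) (n : TangentSpace 𝓘(ℝ, E) (ι p)) : Prop where
  mem_radical : ξ ∈ radical G ι p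
  pairing : G.inner (ι p) n (mfderiv 𝓘(ℝ, F) 𝓘(ℝ, E) ι p ξ) = 1
  null : G.inner (ι p) n n = 0
  orthogonal : ∀ w ∈ S p, G.inner (ι p) n (mfderiv 𝓘(ℝ, F) 𝓘(ℝ, E) ι p w) = 0

/-- The fibre at `p` of the transversal bundle `tr(TM)` determined by the screen distribution. -/
def transversal (S : Π p : M, Submodule ℝ (TangentSpace 𝓘(ℝ, F) p)) (p : M) :
    Submodule ℝ (TangentSpace 𝓘(ℝ, E) (ι p)) :=
  Submodule.span ℝ {n | ∃ ξ, IsNullPair G ι S p ξ n}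

/-- `(M, G, S(TM))` is a radical transversal lightlike hypersurface: its radical is non-zero at
every point, `S` is a screen distribution, and `J (Rad TM) = tr(TM)`. -/
structure IsRadicalTransversal
    (J : Π x : N, TangentSpace 𝓘(ℝ, E) x →L[ℝ] TangentSpace 𝓘(ℝ, E) x)
    (S : Π p : M, Submodule ℝ (TangentSpace 𝓘(ℝ, F) p)) : Prop where
  hypersurface : IsHypersurface E F ι
  lightlike (p : M) : radical (F := F) G ι p ≠ ⊥
  screen : IsScreen G ι S
  radical_transversal (p : M) :
    (((radical G ι p).map (mfderiv 𝓘(ℝ, F) 𝓘(ℝ, E) ι p).toLinearMap).map (J (ι p)).toLinearMap)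
      = transversal G ι S p

/-- The induced connection: `∇_v Y` is the tangent part of the ambient derivative of `Y` with
respect to the decomposition `TN = TM ⊕ tr(TM)`. -/
def inducedConnection (S : Π p : M, Submodule ℝ (TangentSpace 𝓘(ℝ, F) p))
    (Y : Π p : M, TangentSpace 𝓘(ℝ, F) p) (p : M) (v : TangentSpace 𝓘(ℝ, F) p) :
    TangentSpace 𝓘(ℝ, F) p :=
  Classical.epsilon fun u : TangentSpace 𝓘(ℝ, F) p ↦
    covAlong (leviCivita G) ι (fun q ↦ mfderiv 𝓘(ℝ, F) 𝓘(ℝ, E) ι q (Y q)) p v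
      - mfderiv 𝓘(ℝ, F) 𝓘(ℝ, E) ι p u ∈ transversal G ι S p

/-- The local second fundamental form `B(v, w)` at `p` relative to the pair `{ξ, n}`. In the Gauss
formula, `B(v, w)` is the coefficient of `n` in the ambient derivative of `w` along `v`; as
`G(n, ξ) = 1` and `G(TM, ξ) = 0`, it is obtained by pairing with `ξ`. -/
def secondFundamentalForm (p : M) (ξ v w : TangentSpace 𝓘(ℝ, F) p) : ℝ :=
  G.inner (ι p)
    (covAlong (leviCivita G) ι
      (fun q ↦ mfderiv 𝓘(ℝ, F) 𝓘(ℝ, E) ι q (FiberBundle.extend F w q)) p v)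
    (mfderiv 𝓘(ℝ, F) 𝓘(ℝ, E) ι p ξ)

/-- A smooth local section `ξ` of the radical bundle over the open set `U`, together with the
section `n` of `tr(TM)` that it determines. -/
structure IsNullPairOn
    (S : Π p : M, Submodule ℝ (TangentSpace 𝓘(ℝ, F) p)) (U : Set M)
    (ξ : Π p : M, TangentSpace 𝓘(ℝ, F) p) (n : Π p : M, TangentSpace 𝓘(ℝ, E) (ι p)) : Prop where
  isOpen : IsOpen U
  smooth : CMDiff[U] ∞ (T% ξ)
  pair : ∀ p ∈ U, IsNullPair G ι S p (ξ p) (n p)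

/-- `B = ρ G` on `U`, for the local second fundamental form `B` relative to `ξ`. -/
def IsUmbilicalOn (U : Set M) (ξ : Π p : M, TangentSpace 𝓘(ℝ, F) p) (ρ : M → ℝ) : Prop :=
  ∀ p ∈ U, ∀ v w : TangentSpace 𝓘(ℝ, F) p,
    secondFundamentalForm G ι p (ξ p) v w = ρ p * induced G ι p v w

/-- `M` is totally umbilical: locally, `B = ρ G` for a smooth function `ρ`. -/
def IsTotallyUmbilical
    (S : Π p : M, Submodule ℝ (TangentSpace 𝓘(ℝ, F) p)) : Prop :=
  ∀ p : M, ∃ (U : Set M) (ξ : Π q : M, TangentSpace 𝓘(ℝ, F) q)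
    (n : Π q : M, TangentSpace 𝓘(ℝ, E) (ι q)) (ρ : M → ℝ), p ∈ U ∧ IsNullPairOn G ι S U ξ n ∧ CMDiff[U] ∞ ρ ∧ IsUmbilicalOn G ι U ξ ρ

/-- The functions of the hypersurface defined by `J ξ = b n` and `B = ρ G` are the constants `b`
and `ρ`, for suitable pairs `{ξ, n}` defined on the sets of an open cover of `M`. -/
def HasConstantFunctions
    (J : Π x : N, TangentSpace 𝓘(ℝ, E) x →L[ℝ] TangentSpace 𝓘(ℝ, E) x)
    (S : Π p : M, Submodule ℝ (TangentSpace 𝓘(ℝ, F) p)) (b ρ : ℝ) : Prop :=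
  ∀ p : M, ∃ (U : Set M) (ξ : Π q : M, TangentSpace 𝓘(ℝ, F) q)
    (n : Π q : M, TangentSpace 𝓘(ℝ, E) (ι q)), p ∈ U ∧ IsNullPairOn G ι S U ξ n ∧
    (∀ q ∈ U, J (ι q) (mfderiv 𝓘(ℝ, F) 𝓘(ℝ, E) ι q (ξ q)) = b • n q) ∧
    IsUmbilicalOn G ι U ξ fun _ ↦ ρ

/-- `M`, with the connection `cov`, is almost Einstein: `Ric = k g + c g'` with constants `k`, `c`,
where `g`, `g'` are the metrics on `M` induced by `g` and by its associated metric. -/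
def IsAlmostEinstein [FiniteDimensional ℝ F] {g : SemiRiemannianMetric E N} (j : NordenStructure g)
    (cov : (Π p : M, TangentSpace 𝓘(ℝ, F) p) → Π p : M,
      TangentSpace 𝓘(ℝ, F) p → TangentSpace 𝓘(ℝ, F) p) : Prop :=
  ∃ k c : ℝ, ∀ (p : M) (x y : TangentSpace 𝓘(ℝ, F) p),
    ricci cov p x y = k * induced g ι p x y + c * induced j.associated ι p x y

end Hypersurface

end KahlerNorden
end

open Bundle Manifold Set Module
open scoped Manifold ContDiff Topology

noncomputable section

/-! Write η(X) = G(N, X), let g̃ be the metric associated with G, and let a bar mark ambient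
objects. The point is that the induced connection has constant curvature with respect to g̃, and
that g̃ is parallel for it; every conclusion follows from these two facts.

Ambient curvature. `J` makes each tangent space a complex vector space on which H = G - i g̃ is
symmetric, complex bilinear and nondegenerate. The curvature of a Kähler-Norden metric is complex
trilinear. Totally real orthonormal pairs are exactly the H-orthonormal pairs, so the hypothesis
fixes the complex sectional curvature ν + iκ, with κ = -ν', on such pairs. Over ℂ almost every pair
can be normalized, and a polynomial argument covers the null vectors. Hence the curvature is that of
constant complex sectional curvature (`eq_of_totallyReal`).

Hypersurface. Umbilicity gives the products of ∇̄ξ with TM. Since b = G(Jξ, ξ) is constant and `J`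
is parallel, also G(N, ∇̄ξ) = 0. Therefore ∇̄_X ξ = -ρX + ρη(X)ξ (`cov_xi`), and N = b⁻¹Jξ yields
∇̄N. A second derivative gives R̄(X,Y)ξ = ρ²(η(X)Y - η(Y)X) (`curvature_xi`). Comparison with the
ambient form forces ν = 0 and κ = -ρ²/b along M (`curvature_coefficients`). With these values the
terms containing JX and JY cancel in the Gauss equation, which leaves R(X,Y)Z = -(ρ²/b)(g̃(Y,Z)X -
g̃(X,Z)Y) (`curvature_inducedConnection`).

Since JN is a multiple of ξ, the transversal field is g̃-orthogonal to M, so g̃ restricts to a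
parallel tensor on M. A constant times a parallel expression has ∇R = 0. Each R(X,Y) is skew for g̃,
so it annihilates g̃, and with it R and Ric. The trace is a multiple of g̃.

The second case is the first one applied to the Kähler-Norden pair (g̃, J): it has the same
Levi-Civita connection, its associated metric is -g, and (ν, κ) becomes (κ, -ν).

The analytic part establishes the pull-back connection along `ι`: Leibniz rule, compatibility with
metric and `J`, torsion and curvature, by computation in coordinate frames with Christoffel symbols.
-/

namespace KahlerNorden

/-! ### Derivatives of vector-valued functions and Lie brackets, read in a chart. -/

section Calculus

set_option linter.unusedSectionVars false

variable {F : Type*} [NormedAddCommGroup F] [NormedSpace ℝ F] [CompleteSpace F]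
  {M : Type*} [TopologicalSpace M] [ChartedSpace F M] [IsManifold 𝓘(ℝ, F) ∞ M]
  {V : Type*} [NormedAddCommGroup V] [NormedSpace ℝ V]

/-- The vector field `X` read in the chart at `p`. -/
def chartField (p : M) (X : Π q : M, TangentSpace 𝓘(ℝ, F) q) : F → F :=
  VectorField.mpullbackWithin 𝓘(ℝ, F) 𝓘(ℝ, F) (extChartAt 𝓘(ℝ, F) p).symm X (range 𝓘(ℝ, F))

lemma mlieBracket_eq_lieBracket_chartField (p : M) (X Y : Π q : M, TangentSpace 𝓘(ℝ, F) q) :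
    VectorField.mlieBracket 𝓘(ℝ, F) X Y p = VectorField.lieBracket ℝ (chartField p X)
      (chartField p Y) (extChartAt 𝓘(ℝ, F) p p) := by
  have h2 : (range 𝓘(ℝ, F)) = univ := by simp
  have h : VectorField.lieBracketWithin ℝ (chartField p X) (chartField p Y)
      ((extChartAt 𝓘(ℝ, F) p).symm ⁻¹' univ ∩ range 𝓘(ℝ, F)) (extChartAt 𝓘(ℝ, F) p p) =
      VectorField.lieBracket ℝ (chartField p X)
      (chartField p Y) (extChartAt 𝓘(ℝ, F) p p) := by
    rw [preimage_univ, univ_inter, h2, VectorField.lieBracketWithin_univ]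
  -- The chart at `p` has identity derivative at `p` itself, so the pull-back in the definition of
  -- the bracket is invisible there.
  have hi (v : TangentSpace 𝓘(ℝ, F) p) :
      (mfderiv 𝓘(ℝ, F) 𝓘(ℝ, F) (extChartAt 𝓘(ℝ, F) p) p).inverse v = v := by
    rw [mfderiv_extChartAt_self]
    exact DFunLike.congr_fun (ContinuousLinearMap.inverse_id (R := ℝ) (M := F)) v
  rw [← h]
  exact hi _

lemma mvfderiv_eq_fderiv_chart {f : M → V} {p q : M} (hf : MDiffAt f q)
    (hq : q ∈ (extChartAt 𝓘(ℝ, F) p).source) (X : Π q : M, TangentSpace 𝓘(ℝ, F) q) :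
    d% f q (X q) = fderiv ℝ (f ∘ (extChartAt 𝓘(ℝ, F) p).symm) (extChartAt 𝓘(ℝ, F) p q)
      (chartField p X (extChartAt 𝓘(ℝ, F) p q)) := by
  set φ := extChartAt 𝓘(ℝ, F) p with hφ
  have hz : φ q ∈ φ.target := φ.map_source hq
  have hinv := isInvertible_mfderivWithin_extChartAt_symm (I := 𝓘(ℝ, F)) hz
  have hqq : φ.symm (φ q) = q := φ.left_inv hq
  have h2 : (range 𝓘(ℝ, F)) = univ := by simp
  have hd : MDifferentiableAt 𝓘(ℝ, F) 𝓘(ℝ, F) φ.symm (φ q) := by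
    have := mdifferentiableWithinAt_extChartAt_symm (I := 𝓘(ℝ, F)) hz
    rwa [h2, mdifferentiableWithinAt_univ] at this
  have h1 : mfderiv 𝓘(ℝ, F) 𝓘(ℝ, V) (f ∘ φ.symm) (φ q) =
      (mfderiv 𝓘(ℝ, F) 𝓘(ℝ, V) f (φ.symm (φ q))).comp
        (mfderiv 𝓘(ℝ, F) 𝓘(ℝ, F) φ.symm (φ q)) :=
    mfderiv_comp (I' := 𝓘(ℝ, F)) (φ q) (by rw [hqq]; exact hf) hd
  have h3 : mfderiv[range 𝓘(ℝ, F)] φ.symm (φ q) = mfderiv 𝓘(ℝ, F) 𝓘(ℝ, F) φ.symm (φ q) := by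
    rw [h2, mfderivWithin_univ]
  have h5 : mfderiv 𝓘(ℝ, F) 𝓘(ℝ, F) φ.symm (φ q) (VectorField.mpullbackWithin 𝓘(ℝ, F) 𝓘(ℝ, F)
      φ.symm X (range 𝓘(ℝ, F)) (φ q)) = X (φ.symm (φ q)) := by
    rw [← h3]
    exact DFunLike.congr_fun hinv.self_comp_inverse (X (φ.symm (φ q)))
  have h6 : mfderiv 𝓘(ℝ, F) 𝓘(ℝ, V) (f ∘ φ.symm) (φ q) (VectorField.mpullbackWithin 𝓘(ℝ, F)
      𝓘(ℝ, F) φ.symm X (range 𝓘(ℝ, F)) (φ q)) =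
      mfderiv 𝓘(ℝ, F) 𝓘(ℝ, V) f (φ.symm (φ q)) (X (φ.symm (φ q))) := by
    rw [h1, ← h5]; rfl
  -- `φ.symm (φ q)` equals `q` only propositionally, while the tangent spaces depend on it;
  -- generalizing the point to `r` permits the substitution.
  have h7 : ∀ r, r = q → d% f q (X q) = mfderiv 𝓘(ℝ, F) 𝓘(ℝ, V) f r (X r) := by
    rintro r rfl; rfl
  rw [h7 _ hqq, ← mfderiv_eq_fderiv]
  exact h6.symm

lemma mfderiv_eq_fderiv_chart_self {f : M → V} {p : M} (hf : MDiffAt f p) :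
    d% f p = fderiv ℝ (f ∘ (extChartAt 𝓘(ℝ, F) p).symm) (extChartAt 𝓘(ℝ, F) p p) := by
  rw [hf.mvfderiv]
  simp [writtenInExtChartAt]
  rfl

lemma differentiableAt_chart {f : M → V} {p : M} (hf : MDiffAt f p) :
    DifferentiableAt ℝ (f ∘ (extChartAt 𝓘(ℝ, F) p).symm) (extChartAt 𝓘(ℝ, F) p p) := by
  have := hf.differentiableWithinAt_writtenInExtChartAt
  rw [modelWithCornersSelf_coe, range_id] at this
  exact differentiableWithinAt_univ.1 this

lemma contDiffAt_chart {n : ℕ∞} {f : M → V} {p : M} (hf : CMDiffAt n f p) :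
    ContDiffAt ℝ n (f ∘ (extChartAt 𝓘(ℝ, F) p).symm) (extChartAt 𝓘(ℝ, F) p p) := by
  have := (contMDiffAt_iff.1 hf).2
  simpa using! this

/-- In the chart each iterated derivative is a second derivative of `f` plus a first-order term.
Symmetry of second derivatives cancels the former, and the latter assemble into the bracket. Vector
values are allowed so that `f` can be a chart or a coordinate vector. -/
lemma mvfderiv_commutator {f : M → V} {X Y : Π q : M, TangentSpace 𝓘(ℝ, F) q} {p : M}
    (hf : CMDiffAt 2 f p) (hX : MDiffAt (T% X) p) (hY : MDiffAt (T% Y) p) :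
    d% (fun q ↦ d% f q (Y q)) p (X p) - d% (fun q ↦ d% f q (X q)) p (Y p)
      = d% f p (VectorField.mlieBracket 𝓘(ℝ, F) X Y p) := by
  set φ := extChartAt 𝓘(ℝ, F) p with hφ
  have hs : φ.source ∈ 𝓝 p := extChartAt_source_mem_nhds p
  have h2 : (range 𝓘(ℝ, F)) = univ := by simp
  have hP {X : Π q : M, TangentSpace 𝓘(ℝ, F) q} (hX : MDiffAt (T% X) p) :
      DifferentiableAt ℝ (chartField p X) (φ p) := by
    have := MDifferentiableWithinAt.differentiableWithinAt_mpullbackWithin_vectorField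
      (mdifferentiableWithinAt_univ.2 hX)
    rw [preimage_univ, univ_inter, h2] at this
    rw [chartField, h2]
    exact differentiableWithinAt_univ.1 this
  have hf' : ContDiffAt ℝ 2 (f ∘ φ.symm) (φ p) := contDiffAt_chart hf
  have hdf : DifferentiableAt ℝ (fderiv ℝ (f ∘ φ.symm)) (φ p) :=
    (hf'.fderiv_right (m := 1) (by norm_num)).differentiableAt (by norm_num)
  have hev : ∀ᶠ q in 𝓝 p, MDiffAt f q := by
    filter_upwards [(contMDiffAt_iff_contMDiffAt_nhds (n := 2) (by simp)).1 hf] with q hq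
    exact ContMDiffAt.mdifferentiableAt hq two_ne_zero
  have key (X Y : Π q : M, TangentSpace 𝓘(ℝ, F) q) (hX : MDiffAt (T% X) p)
      (hY : MDiffAt (T% Y) p) :
      d% (fun q ↦ d% f q (Y q)) p (X p) =
        fderiv ℝ (fderiv ℝ (f ∘ φ.symm)) (φ p) (chartField p X (φ p)) (chartField p Y (φ p)) +
        fderiv ℝ (f ∘ φ.symm) (φ p) (fderiv ℝ (chartField p Y) (φ p) (chartField p X (φ p))) := by
    have e1 : (fun q ↦ d% f q (Y q)) =ᶠ[𝓝 p]
        (fun z ↦ fderiv ℝ (f ∘ φ.symm) z (chartField p Y z)) ∘ φ := by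
      filter_upwards [hs, hev] with q hq hq' using mvfderiv_eq_fderiv_chart hq' hq Y
    have hG : DifferentiableAt ℝ (fun z ↦ fderiv ℝ (f ∘ φ.symm) z (chartField p Y z)) (φ p) :=
      hdf.clm_apply (hP hY)
    have hm : MDiffAt (fun q ↦ d% f q (Y q)) p := by
      refine MDifferentiableAt.congr_of_eventuallyEq ?_ e1
      exact hG.mdifferentiableAt.comp p (mdifferentiableAt_extChartAt (mem_chart_source F p))
    rw [mvfderiv_eq_fderiv_chart hm (mem_extChartAt_source p) X]
    have e2 : (fun q ↦ d% f q (Y q)) ∘ φ.symm =ᶠ[𝓝 (φ p)]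
        (fun z ↦ fderiv ℝ (f ∘ φ.symm) z (chartField p Y z)) := by
      have hc : Filter.Tendsto φ.symm (𝓝 (φ p)) (𝓝 p) := by
        have := continuousAt_extChartAt_symm (I := 𝓘(ℝ, F)) p
        rwa [ContinuousAt, extChartAt_to_inv] at this
      filter_upwards [hc.eventually e1, extChartAt_target_mem_nhds p] with z hz hz'
      simp only [Function.comp_apply] at hz ⊢
      rw [hz, φ.right_inv hz']
    rw [← hφ, e2.fderiv_eq, fderiv_clm_apply hdf (hP hY)]
    simp only [add_apply, ContinuousLinearMap.comp_apply, ContinuousLinearMap.flip_apply]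
    rw [add_comm]
  have hb : d% f p (VectorField.mlieBracket 𝓘(ℝ, F) X Y p) = fderiv ℝ (f ∘ φ.symm) (φ p)
      (fderiv ℝ (chartField p Y) (φ p) (chartField p X (φ p)) -
        fderiv ℝ (chartField p X) (φ p) (chartField p Y (φ p))) := by
    rw [mlieBracket_eq_lieBracket_chartField]
    exact DFunLike.congr_fun (mfderiv_eq_fderiv_chart_self hev.self_of_nhds) _
  rw [key X Y hX hY, key Y X hY hX, hb, map_sub]
  have := (hf'.isSymmSndFDerivAt (by simp)) (chartField p X (φ p)) (chartField p Y (φ p))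
  rw [this]
  abel

section

variable {E : Type*} [NormedAddCommGroup E] [NormedSpace ℝ E]
  {N : Type*} [TopologicalSpace N] [ChartedSpace E N] [IsManifold 𝓘(ℝ, E) ∞ N]

lemma contMDiffAt_mfderiv_apply {n m : ℕ∞} {f : M → N} {X : Π q : M, TangentSpace 𝓘(ℝ, F) q}
    {p : M} (hf : CMDiffAt m f p) (hX : CMDiffAt n (T% X) p) (hnm : n + 1 ≤ m) :
    ContMDiffAt 𝓘(ℝ, F) (𝓘(ℝ, E).prod 𝓘(ℝ, E)) n (fun q ↦ TotalSpace.mk' E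
      (E := fun x : N ↦ TangentSpace 𝓘(ℝ, E) x) (f q) (mfderiv 𝓘(ℝ, F) 𝓘(ℝ, E) f q (X q))) p := by
  have h1 := ContMDiffAt.mfderiv_const (m := n) hf (by exact_mod_cast hnm)
  have hfn : CMDiffAt n f p := hf.of_le (by exact_mod_cast le_self_add.trans hnm)
  exact ContMDiffAt.clm_apply_of_inCoordinates h1 hX hfn

lemma contMDiffAt_mvfderiv_apply {n m : ℕ∞} {f : M → V} {X : Π q : M, TangentSpace 𝓘(ℝ, F) q}
    {p : M} (hf : CMDiffAt m f p) (hX : CMDiffAt n (T% X) p) (hnm : n + 1 ≤ m) :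
    CMDiffAt n (fun q ↦ d% f q (X q)) p :=
  (contMDiff_snd_tangentBundle_modelSpace V 𝓘(ℝ, V)).contMDiffAt.comp p
    (contMDiffAt_mfderiv_apply hf hX hnm)

end

/-! ### Product rule and smoothness for operator-valued functions. -/

section ProductRule

variable {V' W : Type*} [NormedAddCommGroup V'] [NormedSpace ℝ V'] [NormedAddCommGroup W]
  [NormedSpace ℝ W]

lemma mdifferentiableAt_clm_apply {a : M → V →L[ℝ] W} {w : M → V} {p : M} (ha : MDiffAt a p)
    (hw : MDiffAt w p) : MDiffAt (fun q ↦ a q (w q)) p :=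
  ((isBoundedBilinearMap_apply (𝕜 := ℝ) (E := V) (F := W)).differentiableAt
    (a p, w p)).mdifferentiableAt.comp p (ha.prodMk_space hw)

lemma mvfderiv_clm_apply {a : M → V →L[ℝ] W} {w : M → V} {p : M} (ha : MDiffAt a p)
    (hw : MDiffAt w p) (v : TangentSpace 𝓘(ℝ, F) p) :
    d% (fun q ↦ a q (w q)) p v = d% a p v (w p) + a p (d% w p v) := by
  rw [mfderiv_eq_fderiv_chart_self (mdifferentiableAt_clm_apply ha hw),
    mfderiv_eq_fderiv_chart_self ha, mfderiv_eq_fderiv_chart_self hw]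
  have := fderiv_clm_apply (differentiableAt_chart ha) (differentiableAt_chart hw)
  have h2 := DFunLike.congr_fun this v
  simp only [Function.comp_apply, extChartAt_to_inv] at h2
  rw [add_comm]
  exact h2

lemma mvfderiv_clm_const {a : M → V →L[ℝ] W} {p : M} (ha : MDiffAt a p) (w : V)
    (v : TangentSpace 𝓘(ℝ, F) p) : d% (fun q ↦ a q w) p v = d% a p v w := by
  have := mvfderiv_clm_apply ha (mdifferentiableAt_const (c := w)) v
  rw [mvfderiv_const] at this
  simpa using this

/-- An operator on a finite-dimensional space is a fixed continuous linear function of its values on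
a basis. This reduces smoothness of the Gram matrix and of the Christoffel symbols to their entries.
-/
lemma contMDiffAt_clm_of_apply [FiniteDimensional ℝ V] {n : ℕ∞} {a : M → V →L[ℝ] W} {p : M}
    (h : ∀ i, CMDiffAt n (fun q ↦ a q (finBasis ℝ V i)) p) : CMDiffAt n a p := by
  have e : a = fun q ↦ ∑ i, (ContinuousLinearMap.smulRightL ℝ V W
      (LinearMap.toContinuousLinearMap ((finBasis ℝ V).coord i))) (a q (finBasis ℝ V i)) := by
    ext q v
    have := congrArg (a q) ((finBasis ℝ V).sum_repr v).symm
    rw [map_sum] at this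
    simpa only [map_smul, sum_apply, ContinuousLinearMap.smulRightL_apply_apply,
      ContinuousLinearMap.smulRight_apply, LinearMap.coe_toContinuousLinearMap', Basis.coord_apply] using this
  rw [e]
  exact ContMDiffAt.sum fun i _ ↦ ((ContinuousLinearMap.smulRightL ℝ V W
    (LinearMap.toContinuousLinearMap ((finBasis ℝ V).coord i))).contMDiff.contMDiffAt).comp p (h i)

lemma contMDiffAt_clm_apply {n : ℕ∞} {a : M → V →L[ℝ] W} {w : M → V} {p : M}
    (ha : CMDiffAt n a p) (hw : CMDiffAt n w p) : CMDiffAt n (fun q ↦ a q (w q)) p :=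
  ha.clm_apply hw

end ProductRule

end Calculus

/-! ### Coordinate frames and vector fields along a map. -/

section Along

set_option linter.unusedSectionVars false

variable {E : Type*} [NormedAddCommGroup E] [NormedSpace ℝ E] [FiniteDimensional ℝ E]
  {N : Type*} [TopologicalSpace N] [ChartedSpace E N] [IsManifold 𝓘(ℝ, E) ∞ N]
  {F : Type*} [NormedAddCommGroup F] [NormedSpace ℝ F] [FiniteDimensional ℝ F]
  {M : Type*} [TopologicalSpace M] [ChartedSpace F M] [IsManifold 𝓘(ℝ, F) ∞ M]

/-- The vector field of the coordinate frame around `x₀` with constant components `w`. -/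
def frame (x₀ : N) (w : E) (x : N) : TangentSpace 𝓘(ℝ, E) x :=
  (trivializationAt E (TangentSpace 𝓘(ℝ, E)) x₀).symmL ℝ x w

/-- The coordinates at `x` of a tangent vector in the frame around `x₀`. -/
def coords (x₀ x : N) : TangentSpace 𝓘(ℝ, E) x →L[ℝ] E :=
  (trivializationAt E (TangentSpace 𝓘(ℝ, E)) x₀).continuousLinearMapAt ℝ x

/-- The domain of the coordinate frame around `x₀`. -/
def frameDomain (E : Type*) [NormedAddCommGroup E] [NormedSpace ℝ E]
    {N : Type*} [TopologicalSpace N] [ChartedSpace E N] [IsManifold 𝓘(ℝ, E) ∞ N] (x₀ : N) : Set N :=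
  (trivializationAt E (TangentSpace 𝓘(ℝ, E) : N → Type _) x₀).baseSet

lemma mem_frameDomain (x₀ : N) : x₀ ∈ frameDomain E x₀ :=
  FiberBundle.mem_baseSet_trivializationAt' x₀

lemma isOpen_frameDomain (x₀ : N) : IsOpen (frameDomain E x₀) :=
  (trivializationAt E (TangentSpace 𝓘(ℝ, E) : N → Type _) x₀).open_baseSet

lemma frame_coords {x₀ x : N} (hx : x ∈ frameDomain E x₀) (v : TangentSpace 𝓘(ℝ, E) x) :
    frame x₀ (coords x₀ x v) x = v :=
  Bundle.Trivialization.symmL_continuousLinearMapAt _ hx v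

lemma coords_frame {x₀ x : N} (hx : x ∈ frameDomain E x₀) (w : E) :
    coords x₀ x (frame x₀ w x) = w :=
  Bundle.Trivialization.continuousLinearMapAt_symmL _ hx w

lemma coords_apply {x₀ x : N} (hx : x ∈ frameDomain E x₀) (v : TangentSpace 𝓘(ℝ, E) x) :
    coords x₀ x v = (trivializationAt E (TangentSpace 𝓘(ℝ, E)) x₀ ⟨x, v⟩).2 :=
  Bundle.Trivialization.continuousLinearMapAt_apply_of_mem (R := ℝ)
    (trivializationAt E (TangentSpace 𝓘(ℝ, E)) x₀) hx v

lemma frame_add (x₀ : N) (v w : E) : frame x₀ (v + w) = frame x₀ v + frame x₀ w := by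
  ext x; simp [frame]

lemma frame_smul (x₀ : N) (c : ℝ) (w : E) : frame x₀ (c • w) = c • frame x₀ w := by
  ext x; simp [frame]

/-- Links the extensions in the definitions of `covAlong` and `curvature` to the constant-component
fields used in the computations. -/
lemma extend_eq_frame {x y : N} (v : TangentSpace 𝓘(ℝ, E) x) (hy : y ∈ frameDomain E x) :
    FiberBundle.extend E v y = frame x (coords x x v) y := by
  rw [coords_apply (mem_frameDomain x)]
  exact (Bundle.Trivialization.symmL_apply (R := ℝ)
    (trivializationAt E (TangentSpace 𝓘(ℝ, E)) x) hy _).symm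

lemma contMDiffAt_frame {x₀ x : N} {n : ℕ∞} (hx : x ∈ frameDomain E x₀) (w : E) :
    CMDiffAt n (T% (frame x₀ w)) x := by
  rw [Trivialization.contMDiffAt_section_iff (e := trivializationAt E (TangentSpace 𝓘(ℝ, E)) x₀) hx]
  refine (contMDiffAt_const (c := w)).congr_of_eventuallyEq ?_
  filter_upwards [(isOpen_frameDomain x₀).mem_nhds hx] with y hy
  rw [← coords_apply hy, coords_frame hy]

lemma mdifferentiableAt_frame {x₀ x : N} (hx : x ∈ frameDomain E x₀) (w : E) :
    MDiffAt (T% (frame x₀ w)) x :=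
  (contMDiffAt_frame (n := 1) hx w).mdifferentiableAt one_ne_zero

variable {ι : M → N}

/-- A vector field along `ι`, as a map to the tangent bundle. -/
def alongMk (ι : M → N) (W : Π p : M, TangentSpace 𝓘(ℝ, E) (ι p)) :
    M → TotalSpace E (TangentSpace 𝓘(ℝ, E) : N → Type _) :=
  fun p ↦ ⟨ι p, W p⟩

variable {W W' : Π p : M, TangentSpace 𝓘(ℝ, E) (ι p)} {p : M}

lemma mdifferentiableAt_coords_along {x₀ : N} (hx : ι p ∈ frameDomain E x₀)
    (hW : MDiffAt (alongMk ι W) p) : MDiffAt (fun q ↦ coords x₀ (ι q) (W q)) p := by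
  have h := (Trivialization.mdifferentiableAt_totalSpace_iff (IB := 𝓘(ℝ, E))
    (trivializationAt E (TangentSpace 𝓘(ℝ, E)) x₀) (alongMk ι W)
    ((Trivialization.coe_mem_source _).mpr hx)).1 hW
  refine h.2.congr_of_eventuallyEq ?_
  filter_upwards [h.1.continuousAt.preimage_mem_nhds ((isOpen_frameDomain x₀).mem_nhds hx)]
    with q hq
  exact coords_apply hq _

lemma mdifferentiableAt_along_base (hW : MDiffAt (alongMk ι W) p) : MDiffAt ι p :=
  ((mdifferentiableAt_totalSpace ..).1 hW).1

lemma mdifferentiableAt_along {x₀ : N} (hx : ι p ∈ frameDomain E x₀) (hι : MDiffAt ι p)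
    (h : MDiffAt (fun q ↦ coords x₀ (ι q) (W q)) p) : MDiffAt (alongMk ι W) p := by
  refine (Trivialization.mdifferentiableAt_totalSpace_iff (IB := 𝓘(ℝ, E))
    (trivializationAt E (TangentSpace 𝓘(ℝ, E)) x₀) (alongMk ι W)
    ((Trivialization.coe_mem_source _).mpr hx)).2 ⟨hι, h.congr_of_eventuallyEq ?_⟩
  filter_upwards [hι.continuousAt.preimage_mem_nhds ((isOpen_frameDomain x₀).mem_nhds hx)] with q hq
  exact (coords_apply hq _).symm

lemma contMDiffAt_coords_along {n : ℕ∞} {x₀ : N} (hx : ι p ∈ frameDomain E x₀)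
    (hW : CMDiffAt n (alongMk ι W) p) : CMDiffAt n (fun q ↦ coords x₀ (ι q) (W q)) p := by
  have h := (Trivialization.contMDiffAt_iff (IB := 𝓘(ℝ, E)) 
    (e := trivializationAt E (TangentSpace 𝓘(ℝ, E)) x₀) (f := alongMk ι W)
    ((Trivialization.coe_mem_source _).mpr hx)).1 hW
  refine h.2.congr_of_eventuallyEq ?_
  filter_upwards [h.1.continuousAt.preimage_mem_nhds ((isOpen_frameDomain x₀).mem_nhds hx)]
    with q hq
  exact coords_apply hq _

lemma MDiffAlong.add (hW : MDiffAt (alongMk ι W) p) (hW' : MDiffAt (alongMk ι W') p) :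
    MDiffAt (alongMk ι (W + W')) p := by
  refine mdifferentiableAt_along (mem_frameDomain (ι p)) (mdifferentiableAt_along_base hW) ?_
  have := (mdifferentiableAt_coords_along (mem_frameDomain (ι p)) hW).add
    (mdifferentiableAt_coords_along (mem_frameDomain (ι p)) hW')
  simpa only [Pi.add_apply, map_add] using! this

lemma MDiffAlong.smul {f : M → ℝ} (hf : MDiffAt f p) (hW : MDiffAt (alongMk ι W) p) :
    MDiffAt (alongMk ι (f • W)) p := by
  refine mdifferentiableAt_along (mem_frameDomain (ι p)) (mdifferentiableAt_along_base hW) ?_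
  have := hf.smul (mdifferentiableAt_coords_along (mem_frameDomain (ι p)) hW)
  simpa only [Pi.smul_apply', map_smul] using! this

lemma MDiffAlong.comp {Y : Π x : N, TangentSpace 𝓘(ℝ, E) x} (hι : MDiffAt ι p)
    (hY : MDiffAt (T% Y) (ι p)) : MDiffAt (alongMk ι fun q ↦ Y (ι q)) p :=
  hY.comp p hι

lemma MDiffAlong.congr (hW : MDiffAt (alongMk ι W) p) (h : ∀ᶠ q in 𝓝 p, W' q = W q) :
    MDiffAt (alongMk ι W') p := by
  refine hW.congr_of_eventuallyEq ?_
  filter_upwards [h] with q hq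
  simp [alongMk, hq]

/-! ### Leibniz calculus of the pull-back connection. -/

section Connection

variable (cov : CovariantDerivative 𝓘(ℝ, E) E (TangentSpace 𝓘(ℝ, E) : N → Type _))

variable {cov} in
lemma cov_congr {Y Y' : Π x : N, TangentSpace 𝓘(ℝ, E) x} {x : N} (hY : MDiffAt (T% Y) x)
    (h : ∀ᶠ y in 𝓝 x, Y' y = Y y) : cov Y' x = cov Y x := by
  have hY' : MDiffAt (T% Y') x := by
    refine hY.congr_of_eventuallyEq ?_
    filter_upwards [h] with y hy
    simp [hy]
  exact cov.isCovariantDerivativeOn.congr_of_eventuallyEq hY' hY Filter.univ_mem h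

lemma cov_frame_add {x₀ x : N} (hx : x ∈ frameDomain E x₀) (v w : E) :
    cov (frame x₀ (v + w)) x = cov (frame x₀ v) x + cov (frame x₀ w) x := by
  rw [frame_add, cov.isCovariantDerivativeOn.add (mdifferentiableAt_frame hx v)
    (mdifferentiableAt_frame hx w) (mem_univ x)]

lemma cov_frame_smul {x₀ x : N} (hx : x ∈ frameDomain E x₀) (c : ℝ) (w : E) :
    cov (frame x₀ (c • w)) x = c • cov (frame x₀ w) x := by
  rw [frame_smul]
  exact cov.isCovariantDerivativeOn.smul_const c (mdifferentiableAt_frame hx w) (mem_univ x)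

/-- `w ↦ ∇ w` for the fields with constant components in the frame around `x₀`. -/
def covFrame {x₀ x : N} (hx : x ∈ frameDomain E x₀) :
    E →ₗ[ℝ] (TangentSpace 𝓘(ℝ, E) x →L[ℝ] TangentSpace 𝓘(ℝ, E) x) where
  toFun w := cov (frame x₀ w) x
  map_add' := cov_frame_add cov hx
  map_smul' := cov_frame_smul cov hx

lemma cov_sum {α : Type*} (s : Finset α) {f : α → N → ℝ} {Y : α → Π x : N, TangentSpace 𝓘(ℝ, E) x}
    {x : N} (hf : ∀ i ∈ s, MDiffAt (f i) x) (hY : ∀ i ∈ s, MDiffAt (T% (Y i)) x) :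
    cov (fun y ↦ ∑ i ∈ s, f i y • Y i y) x =
      ∑ i ∈ s, (f i x • cov (Y i) x + (d% (f i) x).smulRight (Y i x)) := by
  classical
  induction s using Finset.induction_on with
  | empty => 
    simp only [Finset.sum_empty]
    exact cov.isCovariantDerivativeOn.zero (mem_univ x)
  | insert a s ha ih =>
    simp only [Finset.forall_mem_insert] at hf hY
    simp only [Finset.sum_insert ha]
    rw [← ih hf.2 hY.2, ← cov.isCovariantDerivativeOn.leibniz hY.1 hf.1 (mem_univ x),
      ← cov.isCovariantDerivativeOn.add (hf.1.smul_section hY.1) _ (mem_univ x)]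
    · rfl
    · exact MDifferentiableAt.sum_section fun i hi ↦ (hf.2 i hi).smul_section (hY.2 i hi)

lemma frame_eq_sum (x₀ x : N) (w : E) :
    frame x₀ w x = ∑ i, (finBasis ℝ E).coord i w • frame x₀ (finBasis ℝ E i) x := by
  have := congrArg ((trivializationAt E (TangentSpace 𝓘(ℝ, E)) x₀).symmL ℝ x)
    ((finBasis ℝ E).sum_repr w).symm
  rw [map_sum] at this
  simpa only [map_smul] using! this

lemma covFrame_eq_sum {x₀ x : N} (hx : x ∈ frameDomain E x₀) (w : E) :
    cov (frame x₀ w) x =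
      ∑ i, (finBasis ℝ E).coord i w • cov (frame x₀ (finBasis ℝ E i)) x := by
  have := congrArg (covFrame cov hx) ((finBasis ℝ E).sum_repr w).symm
  rw [map_sum] at this
  simpa only [map_smul] using! this

lemma mdifferentiableAt_coord {s : M → E} (hs : MDiffAt s p) (i : Fin (finrank ℝ E)) :
    MDiffAt (fun q ↦ (finBasis ℝ E).coord i (s q)) p :=
  ((finBasis ℝ E).coord i).toContinuousLinearMap.mdifferentiableAt.comp p hs

lemma mvfderiv_coord {s : M → E} (hs : MDiffAt s p) (i : Fin (finrank ℝ E))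
    (v : TangentSpace 𝓘(ℝ, F) p) :
    d% (fun q ↦ (finBasis ℝ E).coord i (s q)) p v = (finBasis ℝ E).coord i (d% s p v) := by
  have := mvfderiv_clm_apply (mdifferentiableAt_const
    (c := ((finBasis ℝ E).coord i).toContinuousLinearMap)) hs v
  rw [mvfderiv_const] at this
  simpa using! this

/-- Leibniz rule on the finite expansion in a basis: the derivatives of the components form the
first term, those of the frame the second. -/
lemma cov_frame_variable {x₀ x : N} (hx : x ∈ frameDomain E x₀) {s : N → E} (hs : MDiffAt s x)
    (v : TangentSpace 𝓘(ℝ, E) x) :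
    cov (fun y ↦ frame x₀ (s y) y) x v = frame x₀ (d% s x v) x + cov (frame x₀ (s x)) x v := by
  have e : (fun y ↦ frame x₀ (s y) y) = fun y ↦ ∑ i, (finBasis ℝ E).coord i (s y) •
      frame x₀ (finBasis ℝ E i) y := by
    ext y; exact frame_eq_sum x₀ y (s y)
  rw [e, cov_sum cov _ (fun i _ ↦ mdifferentiableAt_coord hs i)
    (fun i _ ↦ mdifferentiableAt_frame hx _), frame_eq_sum, covFrame_eq_sum cov hx (s x)]
  simp only [sum_apply, add_apply, smul_apply,
    ContinuousLinearMap.smulRight_apply, Finset.sum_add_distrib, mvfderiv_coord hs]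
  rw [add_comm]

lemma cov_coords {x₀ x : N} (hx : x ∈ frameDomain E x₀) {Y : Π x : N, TangentSpace 𝓘(ℝ, E) x}
    (hY : MDiffAt (T% Y) x) (v : TangentSpace 𝓘(ℝ, E) x) :
    cov Y x v = frame x₀ (d% (fun y ↦ coords x₀ y (Y y)) x v) x +
      cov (frame x₀ (coords x₀ x (Y x))) x v := by
  have hs : MDiffAt (fun y ↦ coords x₀ y (Y y)) x := mdifferentiableAt_coords_along (ι := id) hx hY
  rw [← cov_frame_variable cov hx hs]
  refine DFunLike.congr_fun (cov_congr hY ?_).symm v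
  filter_upwards [(isOpen_frameDomain x₀).mem_nhds hx] with y hy using frame_coords hy _

lemma cov_extend {x : N} (v : TangentSpace 𝓘(ℝ, E) x) :
    cov (FiberBundle.extend E v) x = cov (frame x (coords x x v)) x := by
  refine cov_congr (mdifferentiableAt_frame (mem_frameDomain x) _) ?_
  filter_upwards [(isOpen_frameDomain (E := E) x).mem_nhds (mem_frameDomain x)] with y hy
  exact extend_eq_frame v hy

lemma covAlong_def (hι : ContinuousAt ι p) (v : TangentSpace 𝓘(ℝ, F) p) :
    covAlong cov ι W p v = frame (ι p) (d% (fun q ↦ coords (ι p) (ι q) (W q)) p v) (ι p) +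
      cov (frame (ι p) (coords (ι p) (ι p) (W p))) (ι p) (mfderiv 𝓘(ℝ, F) 𝓘(ℝ, E) ι p v) := by
  rw [← cov_extend]
  have : (fun q ↦ coords (ι p) (ι q) (W q)) =ᶠ[𝓝 p]
      fun q ↦ (trivializationAt E (TangentSpace 𝓘(ℝ, E)) (ι p) ⟨ι q, W q⟩).2 := by
    filter_upwards [hι.preimage_mem_nhds ((isOpen_frameDomain (E := E) (ι p)).mem_nhds
      (mem_frameDomain (ι p)))] with q hq
    exact coords_apply hq _
  have h2 : d% (fun q ↦ coords (ι p) (ι q) (W q)) p = d% (fun q ↦ (trivializationAt E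
      (TangentSpace 𝓘(ℝ, E)) (ι p) ⟨ι q, W q⟩).2) p := this.mfderiv_eq
  rw [h2]
  refine congrArg (· + _) ?_
  exact (Bundle.Trivialization.symmL_apply (R := ℝ)
    (trivializationAt E (TangentSpace 𝓘(ℝ, E)) (ι p)) (mem_frameDomain (ι p)) _).symm

variable {cov} in
lemma covAlong_congr (hW : MDiffAt (alongMk ι W) p) (h : ∀ᶠ q in 𝓝 p, W' q = W q)
    (v : TangentSpace 𝓘(ℝ, F) p) : covAlong cov ι W' p v = covAlong cov ι W p v := by
  have hc := (mdifferentiableAt_along_base hW).continuousAt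
  rw [covAlong_def cov hc, covAlong_def cov hc, h.self_of_nhds]
  have : (fun q ↦ coords (ι p) (ι q) (W' q)) =ᶠ[𝓝 p] fun q ↦ coords (ι p) (ι q) (W q) := by
    filter_upwards [h] with q hq
    rw [hq]
  have h2 : d% (fun q ↦ coords (ι p) (ι q) (W' q)) p = d% (fun q ↦ coords (ι p) (ι q) (W q)) p :=
    this.mfderiv_eq
  rw [h2]

lemma covAlong_add (hW : MDiffAt (alongMk ι W) p) (hW' : MDiffAt (alongMk ι W') p)
    (v : TangentSpace 𝓘(ℝ, F) p) :
    covAlong cov ι (W + W') p v = covAlong cov ι W p v + covAlong cov ι W' p v := by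
  have hc := (mdifferentiableAt_along_base hW).continuousAt
  have hx := mem_frameDomain (E := E) (ι p)
  have h1 := mvfderiv_add (mdifferentiableAt_coords_along hx hW)
    (mdifferentiableAt_coords_along hx hW')
  have e : (fun q ↦ coords (ι p) (ι q) ((W + W') q)) =
      (fun q ↦ coords (ι p) (ι q) (W q)) + fun q ↦ coords (ι p) (ι q) (W' q) := by
    ext q; simp
  rw [covAlong_def cov hc, covAlong_def cov hc, covAlong_def cov hc, e, h1, Pi.add_apply,
    map_add, cov_frame_add cov hx, add_apply, add_apply, frame_add, Pi.add_apply]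
  abel

lemma covAlong_smul {f : M → ℝ} (hf : MDiffAt f p) (hW : MDiffAt (alongMk ι W) p)
    (v : TangentSpace 𝓘(ℝ, F) p) :
    covAlong cov ι (f • W) p v = d% f p v • W p + f p • covAlong cov ι W p v := by
  have hc := (mdifferentiableAt_along_base hW).continuousAt
  have hx := mem_frameDomain (E := E) (ι p)
  have h1 := mvfderiv_smul hf (mdifferentiableAt_coords_along hx hW)
  have e : (fun q ↦ coords (ι p) (ι q) ((f • W) q)) =
      f • fun q ↦ coords (ι p) (ι q) (W q) := by
    ext q; simp
  rw [covAlong_def cov hc, covAlong_def cov hc, e, h1, Pi.smul_apply',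
    map_smul, cov_frame_smul cov hx, add_apply, smul_apply, smul_apply,
    ContinuousLinearMap.smulRight_apply, frame_add, frame_smul, frame_smul, Pi.add_apply,
    Pi.smul_apply, Pi.smul_apply, frame_coords hx]
  module

lemma covAlong_comp {Y : Π x : N, TangentSpace 𝓘(ℝ, E) x} (hι : MDiffAt ι p)
    (hY : MDiffAt (T% Y) (ι p)) (v : TangentSpace 𝓘(ℝ, F) p) :
    covAlong cov ι (fun q ↦ Y (ι q)) p v = cov Y (ι p) (mfderiv 𝓘(ℝ, F) 𝓘(ℝ, E) ι p v) := by
  have hx := mem_frameDomain (E := E) (ι p)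
  rw [covAlong_def cov hι.continuousAt, cov_coords cov hx hY]
  have hs : MDiffAt (fun y ↦ coords (ι p) y (Y y)) (ι p) :=
    mdifferentiableAt_coords_along (ι := id) hx hY
  have h1 : d% (fun q ↦ coords (ι p) (ι q) (Y (ι q))) p v =
      d% (fun y ↦ coords (ι p) y (Y y)) (ι p) (mfderiv 𝓘(ℝ, F) 𝓘(ℝ, E) ι p v) :=
    mfderiv_comp_apply p hs hι v
  rw [h1]

lemma covAlong_sum {α : Type*} (s : Finset α) {f : α → M → ℝ}
    {Y : α → Π q : M, TangentSpace 𝓘(ℝ, E) (ι q)} (hι : MDiffAt ι p)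
    (hf : ∀ i ∈ s, MDiffAt (f i) p) (hY : ∀ i ∈ s, MDiffAt (alongMk ι (Y i)) p)
    (v : TangentSpace 𝓘(ℝ, F) p) :
    MDiffAt (alongMk ι (fun q ↦ ∑ i ∈ s, f i q • Y i q)) p ∧
    covAlong cov ι (fun q ↦ ∑ i ∈ s, f i q • Y i q) p v =
      ∑ i ∈ s, (d% (f i) p v • Y i p + f i p • covAlong cov ι (Y i) p v) := by
  classical
  induction s using Finset.induction_on with
  | empty =>
    have h0 : MDiffAt (alongMk ι (fun q ↦ (0 : TangentSpace 𝓘(ℝ, E) (ι q)))) p :=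
      MDiffAlong.comp (Y := 0) hι (mdifferentiableAt_zeroSection ..)
    simp only [Finset.sum_empty]
    refine ⟨h0, ?_⟩
    -- Additivity for 0 + 0 = 0 shows that the derivative of the zero field vanishes.
    have := covAlong_add cov h0 h0 v
    have e : ((fun q ↦ (0 : TangentSpace 𝓘(ℝ, E) (ι q))) + fun q ↦ 0) = fun q ↦ 0 := by
      ext q; simp
    rw [e] at this
    simpa using this
  | insert a s ha ih =>
    simp only [Finset.forall_mem_insert] at hf hY
    simp only [Finset.sum_insert ha]
    obtain ⟨h1, h2⟩ := ih hf.2 hY.2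
    rw [← h2, ← covAlong_smul cov hf.1 hY.1, ← covAlong_add cov (MDiffAlong.smul hf.1 hY.1) h1]
    exact ⟨MDiffAlong.add (MDiffAlong.smul hf.1 hY.1) h1, rfl⟩

/-- The definition of `covAlong` uses the frame around `ι p`, which moves with `p`. Differentiating
a covariant derivative again requires one frame valid at all nearby points; the Leibniz rule gives
independence of the frame. -/
lemma covAlong_coords {x₀ : N} (hx : ι p ∈ frameDomain E x₀) (hW : MDiffAt (alongMk ι W) p)
    (v : TangentSpace 𝓘(ℝ, F) p) :
    covAlong cov ι W p v = frame x₀ (d% (fun q ↦ coords x₀ (ι q) (W q)) p v) (ι p) +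
      cov (frame x₀ (coords x₀ (ι p) (W p))) (ι p) (mfderiv 𝓘(ℝ, F) 𝓘(ℝ, E) ι p v) := by
  have hι := mdifferentiableAt_along_base hW
  have hs := mdifferentiableAt_coords_along hx hW
  obtain ⟨h1, h2⟩ := covAlong_sum cov Finset.univ (p := p)
    (f := fun i q ↦ (finBasis ℝ E).coord i (coords x₀ (ι q) (W q)))
    (Y := fun i q ↦ frame x₀ (finBasis ℝ E i) (ι q)) hι
    (fun i _ ↦ mdifferentiableAt_coord hs i)
    (fun i _ ↦ MDiffAlong.comp hι (mdifferentiableAt_frame hx _)) v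
  have e : ∀ᶠ q in 𝓝 p, W q = ∑ i, (finBasis ℝ E).coord i (coords x₀ (ι q) (W q)) •
      frame x₀ (finBasis ℝ E i) (ι q) := by
    filter_upwards [hι.continuousAt.preimage_mem_nhds
      ((isOpen_frameDomain (E := E) x₀).mem_nhds hx)] with q hq
    rw [← frame_eq_sum, frame_coords hq]
  rw [covAlong_congr h1 e, h2, frame_eq_sum, covFrame_eq_sum cov hx]
  simp only [sum_apply, smul_apply, Finset.sum_add_distrib, mvfderiv_coord hs]
  congr 1
  refine Finset.sum_congr rfl fun i _ ↦ ?_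
  rw [covAlong_comp cov hι (mdifferentiableAt_frame hx _)]

end Connection

end Along

/-! ### The Levi-Civita connection in coordinate frames. -/

section LeviCivita

set_option linter.unusedSectionVars false

variable {E : Type*} [NormedAddCommGroup E] [NormedSpace ℝ E] [FiniteDimensional ℝ E]
  {N : Type*} [TopologicalSpace N] [ChartedSpace E N] [IsManifold 𝓘(ℝ, E) ∞ N]
  {F : Type*} [NormedAddCommGroup F] [NormedSpace ℝ F] [FiniteDimensional ℝ F]
  {M : Type*} [TopologicalSpace M] [ChartedSpace F M] [IsManifold 𝓘(ℝ, F) ∞ M]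
  {G : SemiRiemannianMetric E N}
  {cov : CovariantDerivative 𝓘(ℝ, E) E (TangentSpace 𝓘(ℝ, E) : N → Type _)}
  {ι : M → N} {W W' : Π p : M, TangentSpace 𝓘(ℝ, E) (ι p)} {p : M}

lemma frameDomain_eq_chart_source (x₀ : N) : frameDomain E x₀ = (chartAt E x₀).source :=
  TangentBundle.trivializationAt_baseSet x₀

lemma coords_eq_mvfderiv {x₀ x : N} (hx : x ∈ frameDomain E x₀) :
    coords x₀ x = d% (extChartAt 𝓘(ℝ, E) x₀) x :=
  TangentBundle.continuousLinearMapAt_trivializationAt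
    (by rwa [← frameDomain_eq_chart_source])

/-- The commutator formula is applied to the chart: its derivative along a frame field is constant,
so it sends the bracket to zero, and the derivative of the chart is injective. -/
lemma mlieBracket_frame {x₀ x : N} (hx : x ∈ frameDomain E x₀) (u w : E) :
    VectorField.mlieBracket 𝓘(ℝ, E) (frame x₀ u) (frame x₀ w) x = 0 := by
  have hf : CMDiffAt 2 (extChartAt 𝓘(ℝ, E) x₀) x := contMDiffAt_extChartAt'
    (by rwa [← frameDomain_eq_chart_source])
  have h := mvfderiv_commutator hf (mdifferentiableAt_frame hx u) (mdifferentiableAt_frame hx w)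
  have hc (w : E) (v : TangentSpace 𝓘(ℝ, E) x) :
      d% (fun q ↦ d% (extChartAt 𝓘(ℝ, E) x₀) q (frame x₀ w q)) x v = 0 := by
    have e : (fun q ↦ d% (extChartAt 𝓘(ℝ, E) x₀) q (frame x₀ w q)) =ᶠ[𝓝 x] fun _ ↦ w := by
      filter_upwards [(isOpen_frameDomain x₀).mem_nhds hx] with y hy
      rw [← coords_eq_mvfderiv hy, coords_frame hy]
    have e2 : d% (fun q ↦ d% (extChartAt 𝓘(ℝ, E) x₀) q (frame x₀ w q)) x =
      d% (fun _ : N ↦ w) x := e.mfderiv_eq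
    rw [e2, mvfderiv_const, zero_apply]
  rw [hc, hc, sub_zero, ← coords_eq_mvfderiv hx] at h
  rw [← frame_coords hx (VectorField.mlieBracket 𝓘(ℝ, E) (frame x₀ u) (frame x₀ w) x), ← h, frame,
    map_zero]

lemma IsLeviCivita.cov_frame_symm (hL : IsLeviCivita G cov) {x₀ x : N}
    (hx : x ∈ frameDomain E x₀) (u w : E) :
    cov (frame x₀ w) x (frame x₀ u x) = cov (frame x₀ u) x (frame x₀ w x) := by
  have := hL.torsion_free (mdifferentiableAt_frame hx u) (mdifferentiableAt_frame hx w)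
  rw [mlieBracket_frame hx] at this
  exact sub_eq_zero.1 this

/-! ### Compatibility of the pull-back connection with the metric and with `J`. -/

section Metric

lemma contMDiffAt_inner {n : ℕ∞} (hW : CMDiffAt n (alongMk ι W) p)
    (hW' : CMDiffAt n (alongMk ι W') p) :
    CMDiffAt n (fun q ↦ G.inner (ι q) (W q) (W' q)) p := by
  have hι : CMDiffAt n ι p := (contMDiffAt_totalSpace.1 hW).1
  have hg := ((G.contMDiff (ι p)).of_le (m := n) (by exact_mod_cast le_top)).comp p hι
  have : ContMDiffAt 𝓘(ℝ, F) (𝓘(ℝ, E).prod 𝓘(ℝ)) n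
      (fun m ↦ TotalSpace.mk' ℝ (E := Bundle.Trivial N ℝ) (ι m) (G.inner (ι m) (W m) (W' m))) p :=
    ContMDiffAt.clm_bundle_apply₂ (F₁ := E) (F₂ := E) hg hW hW'
  exact (contMDiffAt_totalSpace.1 this).2

lemma contMDiffAt_J {g : SemiRiemannianMetric E N} (j : NordenStructure g) {n : ℕ∞}
    (hW : CMDiffAt n (alongMk ι W) p) :
    CMDiffAt n (alongMk ι (fun q ↦ j.J (ι q) (W q))) p := by
  have hι : CMDiffAt n ι p := (contMDiffAt_totalSpace.1 hW).1
  have hg := ((j.contMDiff (ι p)).of_le (m := n) (by exact_mod_cast le_top)).comp p hι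
  exact ContMDiffAt.clm_bundle_apply (F₁ := E) (F₂ := E) hg hW

variable (G) in
/-- The matrix of the metric in the frame around `x₀`. -/
def gram (x₀ x : N) : E →L[ℝ] E →L[ℝ] ℝ :=
  (ContinuousLinearMap.precomp ℝ
    ((trivializationAt E (TangentSpace 𝓘(ℝ, E)) x₀).symmL ℝ x)).comp
    ((G.inner x).comp ((trivializationAt E (TangentSpace 𝓘(ℝ, E)) x₀).symmL ℝ x))

lemma gram_apply (x₀ x : N) (u w : E) :
    gram G x₀ x u w = G.inner x (frame x₀ u x) (frame x₀ w x) := rfl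

lemma contMDiffAt_gram {n : ℕ∞} {x₀ x : N} (hx : x ∈ frameDomain E x₀) :
    CMDiffAt n (gram G x₀) x := by
  refine contMDiffAt_clm_of_apply fun i ↦ contMDiffAt_clm_of_apply fun k ↦ ?_
  exact contMDiffAt_inner (ι := id) (contMDiffAt_frame hx _) (contMDiffAt_frame hx _)

lemma IsLeviCivita.covAlong_metric (hL : IsLeviCivita G cov) (hW : MDiffAt (alongMk ι W) p)
    (hW' : MDiffAt (alongMk ι W') p) (v : TangentSpace 𝓘(ℝ, F) p) :
    d% (fun q ↦ G.inner (ι q) (W q) (W' q)) p v =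
      G.inner (ι p) (covAlong cov ι W p v) (W' p) + G.inner (ι p) (W p) (covAlong cov ι W' p v) := by
  have hx := mem_frameDomain (E := E) (ι p)
  have hι := mdifferentiableAt_along_base hW
  have hw := mdifferentiableAt_coords_along hx hW
  have hw' := mdifferentiableAt_coords_along hx hW'
  have hg : MDiffAt (gram G (ι p)) (ι p) :=
    (contMDiffAt_gram (n := 1) hx).mdifferentiableAt one_ne_zero
  have hgι : MDiffAt (fun q ↦ gram G (ι p) (ι q)) p := hg.comp p hι
  have e : (fun q ↦ G.inner (ι q) (W q) (W' q)) =ᶠ[𝓝 p]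
      fun q ↦ gram G (ι p) (ι q) (coords (ι p) (ι q) (W q)) (coords (ι p) (ι q) (W' q)) := by
    filter_upwards [hι.continuousAt.preimage_mem_nhds
      ((isOpen_frameDomain (E := E) (ι p)).mem_nhds hx)] with q hq
    rw [gram_apply, frame_coords hq, frame_coords hq]
  have e2 : d% (fun q ↦ G.inner (ι q) (W q) (W' q)) p = d% (fun q ↦ gram G (ι p) (ι q)
      (coords (ι p) (ι q) (W q)) (coords (ι p) (ι q) (W' q))) p := e.mfderiv_eq
  set w₀ := coords (ι p) (ι p) (W p)
  set w₀' := coords (ι p) (ι p) (W' p)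
  -- Metric compatibility is available for fields on `N` only; for constant components it computes
  -- the derivative of the Gram matrix, and the product rule supplies the rest.
  have h3 : d% (fun q ↦ gram G (ι p) (ι q)) p v w₀ w₀' =
      G.inner (ι p) (cov (frame (ι p) w₀) (ι p) (mfderiv 𝓘(ℝ, F) 𝓘(ℝ, E) ι p v)) (W' p) +
      G.inner (ι p) (W p) (cov (frame (ι p) w₀') (ι p) (mfderiv 𝓘(ℝ, F) 𝓘(ℝ, E) ι p v)) := by
    have h4 := hL.metric (mdifferentiableAt_frame hx w₀) (mdifferentiableAt_frame hx w₀')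
      (mfderiv 𝓘(ℝ, F) 𝓘(ℝ, E) ι p v)
    rw [frame_coords hx, frame_coords hx] at h4
    rw [← h4]
    rw [← mvfderiv_clm_const hgι, ← mvfderiv_clm_const
      (mdifferentiableAt_clm_apply hgι mdifferentiableAt_const)]
    exact mvfderiv_comp_apply (g := fun x ↦ G.inner x (frame (ι p) w₀ x) (frame (ι p) w₀' x)) p
      (G.mdifferentiableAt_inner (mdifferentiableAt_frame hx w₀) (mdifferentiableAt_frame hx w₀'))
      hι v
  rw [e2, mvfderiv_clm_apply (mdifferentiableAt_clm_apply hgι hw) hw',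
    mvfderiv_clm_apply hgι hw, add_apply, h3, covAlong_def cov hι.continuousAt,
    covAlong_def cov hι.continuousAt, gram_apply, gram_apply, frame_coords hx, frame_coords hx]
  simp only [map_add, add_apply]
  ring

lemma covAlong_J {g : SemiRiemannianMetric E N} (j : NordenStructure g)
    (hJ : ∀ (x : N) (Y : Π x : N, TangentSpace 𝓘(ℝ, E) x) (v : TangentSpace 𝓘(ℝ, E) x),
      MDiffAt (T% Y) x → cov (fun y ↦ j.J y (Y y)) x v = j.J x (cov Y x v))
    (hW : MDiffAt (alongMk ι W) p) (v : TangentSpace 𝓘(ℝ, F) p) :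
    covAlong cov ι (fun q ↦ j.J (ι q) (W q)) p v = j.J (ι p) (covAlong cov ι W p v) := by
  have hι := mdifferentiableAt_along_base hW
  have hx := mem_frameDomain (E := E) (ι p)
  have hs := mdifferentiableAt_coords_along hx hW
  have hJe (i) : MDiffAt (T% (fun x ↦ j.J x (frame (ι p) (finBasis ℝ E i) x))) (ι p) :=
    (contMDiffAt_J (ι := id) (n := 1) j (contMDiffAt_frame hx _)).mdifferentiableAt one_ne_zero
  obtain ⟨h1, h2⟩ := covAlong_sum cov Finset.univ (p := p)
    (f := fun i q ↦ (finBasis ℝ E).coord i (coords (ι p) (ι q) (W q)))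
    (Y := fun i q ↦ j.J (ι q) (frame (ι p) (finBasis ℝ E i) (ι q))) hι
    (fun i _ ↦ mdifferentiableAt_coord hs i)
    (fun i _ ↦ MDiffAlong.comp (Y := fun x ↦ j.J x (frame (ι p) (finBasis ℝ E i) x)) hι (hJe i)) v
  have e : ∀ᶠ q in 𝓝 p, j.J (ι q) (W q) = ∑ i, (finBasis ℝ E).coord i (coords (ι p) (ι q) (W q)) •
      j.J (ι q) (frame (ι p) (finBasis ℝ E i) (ι q)) := by
    filter_upwards [hι.continuousAt.preimage_mem_nhds
      ((isOpen_frameDomain (E := E) (ι p)).mem_nhds hx)] with q hq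
    simp only [← map_smul, ← map_sum]
    rw [← frame_eq_sum, frame_coords hq]
  rw [covAlong_congr h1 e, h2, covAlong_coords cov hx hW, frame_eq_sum, covFrame_eq_sum cov hx]
  simp only [sum_apply, smul_apply, Finset.sum_add_distrib, mvfderiv_coord hs, map_add, map_sum,
    map_smul]
  congr 1
  refine Finset.sum_congr rfl fun i _ ↦ ?_
  rw [covAlong_comp (Y := fun x ↦ j.J x (frame (ι p) (finBasis ℝ E i) x)) cov hι (hJe i),
    hJ _ _ _ (mdifferentiableAt_frame hx _)]

end Metric

/-! ### Christoffel symbols: symmetry, Koszul formula, smoothness. -/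

section Christoffel

variable (cov) in
/-- The Christoffel symbols of a connection in the frame around `x₀`; `christoffel cov x₀ x w u` are
the coordinates of `∇_u w` for vector fields with constant components `u` and `w`. -/
def christoffel (x₀ x : N) : E →L[ℝ] E →L[ℝ] E :=
  ∑ i, ((finBasis ℝ E).coord i).toContinuousLinearMap.smulRight
    ((coords x₀ x).comp ((cov (frame x₀ (finBasis ℝ E i)) x).comp
      ((trivializationAt E (TangentSpace 𝓘(ℝ, E)) x₀).symmL ℝ x)))

lemma christoffel_apply {x₀ x : N} (hx : x ∈ frameDomain E x₀) (w u : E) :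
    christoffel cov x₀ x w u = coords x₀ x (cov (frame x₀ w) x (frame x₀ u x)) := by
  rw [covFrame_eq_sum cov hx]
  simp only [christoffel, sum_apply, ContinuousLinearMap.smulRight_apply, smul_apply, map_sum,
    map_smul]
  rfl

lemma IsLeviCivita.christoffel_symm (hL : IsLeviCivita G cov) {x₀ x : N}
    (hx : x ∈ frameDomain E x₀) (w u : E) :
    christoffel cov x₀ x w u = christoffel cov x₀ x u w := by
  rw [christoffel_apply hx, christoffel_apply hx, hL.cov_frame_symm hx]

/-- Frame fields commute, so only the derivative terms of the Koszul formula survive. The right-hand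
side involves the metric alone, which gives both smoothness and uniqueness of the symbols. -/
lemma IsLeviCivita.koszul_frame (hL : IsLeviCivita G cov) {x₀ x : N}
    (hx : x ∈ frameDomain E x₀) (w u z : E) :
    gram G x₀ x (christoffel cov x₀ x w u) z = 2⁻¹ *
      (d% (fun y ↦ G.inner y (frame x₀ w y) (frame x₀ z y)) x (frame x₀ u x) +
        d% (fun y ↦ G.inner y (frame x₀ u y) (frame x₀ z y)) x (frame x₀ w x) -
        d% (fun y ↦ G.inner y (frame x₀ u y) (frame x₀ w y)) x (frame x₀ z x)) := by
  have hd (w : E) := mdifferentiableAt_frame hx w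
  rw [hL.metric (hd w) (hd z), hL.metric (hd u) (hd z), hL.metric (hd u) (hd w),
    hL.cov_frame_symm hx w u, hL.cov_frame_symm hx z u, hL.cov_frame_symm hx z w, gram_apply,
    christoffel_apply hx, frame_coords hx, G.symm x (frame x₀ w x)]
  ring

variable (G) in
lemma isInvertible_gram {x₀ x : N} (hx : x ∈ frameDomain E x₀) : (gram G x₀ x).IsInvertible := by
  have hinj : Function.Injective (gram G x₀ x) := by
    rw [injective_iff_map_eq_zero]
    intro u hu
    have h0 : frame x₀ u x = 0 := by
      refine G.nondegenerate x _ fun v ↦ ?_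
      have := DFunLike.congr_fun hu (coords x₀ x v)
      rwa [gram_apply, frame_coords hx, zero_apply] at this
    rw [← coords_frame hx u, h0, map_zero]
  have hfr : finrank ℝ E = finrank ℝ (E →L[ℝ] ℝ) := by
    rw [← LinearEquiv.finrank_eq (LinearMap.toContinuousLinearMap (𝕜 := ℝ) (E := E) (F' := ℝ))]
    exact (Subspace.dual_finrank_eq).symm
  let e := LinearEquiv.ofInjectiveOfFinrankEq (gram G x₀ x).toLinearMap hinj hfr
  exact ⟨e.toContinuousLinearEquiv, by ext u; rfl⟩

/-- Smoothness is not among the axioms of `IsLeviCivita`. The symbols lowered by the Gram matrix are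
derivatives of the metric, hence smooth, and inversion of operators is smooth at the invertible Gram
matrix. -/
lemma IsLeviCivita.contMDiffAt_christoffel (hL : IsLeviCivita G cov) {n : ℕ∞} {x₀ x : N}
    (hx : x ∈ frameDomain E x₀) : CMDiffAt n (christoffel cov x₀) x := by
  refine contMDiffAt_clm_of_apply fun i ↦ contMDiffAt_clm_of_apply fun k ↦ ?_
  set w := finBasis ℝ E i
  set u := finBasis ℝ E k
  have hz : CMDiffAt n (fun y ↦ gram G x₀ y (christoffel cov x₀ y w u)) x := by
    refine contMDiffAt_clm_of_apply fun l ↦ ?_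
    set z := finBasis ℝ E l
    have hd (u w z : E) : CMDiffAt n (fun y ↦ d% (fun y ↦ G.inner y (frame x₀ w y)
        (frame x₀ z y)) y (frame x₀ u y)) x :=
      contMDiffAt_mvfderiv_apply (m := n + 1) (contMDiffAt_inner (ι := id)
        (contMDiffAt_frame hx w) (contMDiffAt_frame hx z)) (contMDiffAt_frame hx u) le_rfl
    refine ((contMDiffAt_const (c := (2⁻¹ : ℝ))).mul (((hd u w z).add (hd w u z)).sub
      (hd z u w))).congr_of_eventuallyEq ?_
    filter_upwards [(isOpen_frameDomain x₀).mem_nhds hx] with y hy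
    exact hL.koszul_frame hy w u z
  have hi : CMDiffAt n (fun y ↦ (gram G x₀ y).inverse) x := by
    obtain ⟨e, he⟩ := isInvertible_gram G hx
    have h1 : ContDiffAt ℝ n (ContinuousLinearMap.inverse : (E →L[ℝ] E →L[ℝ] ℝ) → _)
        (gram G x₀ x) := he ▸ contDiffAt_map_inverse e
    exact h1.contMDiffAt.comp x (contMDiffAt_gram hx)
  refine (contMDiffAt_clm_apply hi hz).congr_of_eventuallyEq ?_
  filter_upwards [(isOpen_frameDomain x₀).mem_nhds hx] with y hy
  exact (DFunLike.congr_fun (isInvertible_gram G hy).inverse_comp_self _).symm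

lemma coords_covAlong {x₀ : N} (hx : ι p ∈ frameDomain E x₀) (hW : MDiffAt (alongMk ι W) p)
    (v : TangentSpace 𝓘(ℝ, F) p) :
    coords x₀ (ι p) (covAlong cov ι W p v) = d% (fun q ↦ coords x₀ (ι q) (W q)) p v +
      christoffel cov x₀ (ι p) (coords x₀ (ι p) (W p))
        (coords x₀ (ι p) (mfderiv 𝓘(ℝ, F) 𝓘(ℝ, E) ι p v)) := by
  rw [covAlong_coords cov hx hW, map_add, coords_frame hx, christoffel_apply hx, frame_coords hx]

end Christoffel

/-! ### Vector fields pushed forward by the immersion, and vanishing torsion. -/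

section Pushforward

variable {X Y : Π q : M, TangentSpace 𝓘(ℝ, F) q}

variable (E) in
/-- The vector field along `ι` induced by a vector field on `M`. -/
def push (ι : M → N) (X : Π q : M, TangentSpace 𝓘(ℝ, F) q) (q : M) : TangentSpace 𝓘(ℝ, E) (ι q) :=
  mfderiv 𝓘(ℝ, F) 𝓘(ℝ, E) ι q (X q)

lemma contMDiffAt_push {n : ℕ∞} (hι : CMDiffAt ∞ ι p) (hX : CMDiffAt n (T% X) p) :
    CMDiffAt n (alongMk ι (push E ι X)) p :=
  contMDiffAt_mfderiv_apply (m := ⊤) hι hX le_top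

lemma mdifferentiableAt_push (hι : CMDiffAt ∞ ι p) (hX : MDiffAt (T% X) p) :
    MDiffAt (alongMk ι (push E ι X)) p := by
  have h1 := ContMDiffAt.mfderiv_const (m := 1) hι
    (WithTop.coe_le_coe.2 (le_top : (1 + 1 : ℕ∞) ≤ ⊤))
  exact MDifferentiableAt.clm_apply_of_inCoordinates (h1.mdifferentiableAt one_ne_zero) hX
    (hι.mdifferentiableAt (by simp))

lemma eventually_mdifferentiableAt {f : M → N} {n : ℕ∞} (hn : 1 ≤ n) (hf : CMDiffAt n f p) :
    ∀ᶠ q in 𝓝 p, MDiffAt f q := by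
  have h1 : CMDiffAt 1 f p := hf.of_le (by exact_mod_cast hn)
  filter_upwards [(contMDiffAt_iff_contMDiffAt_nhds (by simp)).1 h1] with q hq
    using hq.mdifferentiableAt one_ne_zero

lemma coords_push {x₀ : N} (hx : ι p ∈ frameDomain E x₀) (hι : MDiffAt ι p) :
    coords x₀ (ι p) (push E ι X p) = d% (extChartAt 𝓘(ℝ, E) x₀ ∘ ι) p (X p) := by
  rw [coords_eq_mvfderiv hx]
  have hd : MDiffAt (extChartAt 𝓘(ℝ, E) x₀) (ι p) := mdifferentiableAt_extChartAt
    (by rwa [← frameDomain_eq_chart_source])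
  exact (mfderiv_comp_apply p hd hι (X p)).symm

/-- The components of a pushed-forward field are derivatives of chart ∘ `ι`, so their
antisymmetrized derivatives produce the bracket; the Christoffel terms cancel by symmetry. -/
lemma IsLeviCivita.covAlong_torsion (hL : IsLeviCivita G cov) (hι : CMDiffAt ∞ ι p)
    (hX : MDiffAt (T% X) p) (hY : MDiffAt (T% Y) p) :
    covAlong cov ι (push E ι Y) p (X p) - covAlong cov ι (push E ι X) p (Y p) =
      mfderiv 𝓘(ℝ, F) 𝓘(ℝ, E) ι p (VectorField.mlieBracket 𝓘(ℝ, F) X Y p) := by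
  have hx := mem_frameDomain (E := E) (ι p)
  have hιd : MDiffAt ι p := hι.mdifferentiableAt (by simp)
  have hf : CMDiffAt 2 (extChartAt 𝓘(ℝ, E) (ι p) ∘ ι) p :=
    (contMDiffAt_extChartAt (n := 2)).comp p (hι.of_le (WithTop.coe_le_coe.2 (le_top : (2 : ℕ∞) ≤ ⊤)))
  have hev : ∀ᶠ q in 𝓝 p, MDiffAt ι q ∧ ι q ∈ frameDomain E (ι p) :=
    (eventually_mdifferentiableAt le_top hι).and (hιd.continuousAt.preimage_mem_nhds
      ((isOpen_frameDomain (E := E) (ι p)).mem_nhds hx))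
  have e (X : Π q : M, TangentSpace 𝓘(ℝ, F) q) : d% (fun q ↦ coords (ι p) (ι q) (push E ι X q)) p =
      d% (fun q ↦ d% (extChartAt 𝓘(ℝ, E) (ι p) ∘ ι) q (X q)) p := by
    have : (fun q ↦ coords (ι p) (ι q) (push E ι X q)) =ᶠ[𝓝 p]
        (fun q ↦ d% (extChartAt 𝓘(ℝ, E) (ι p) ∘ ι) q (X q)) := by
      filter_upwards [hev] with q hq using coords_push hq.2 hq.1
    exact this.mfderiv_eq
  have h := mvfderiv_commutator hf hX hY
  rw [← e, ← e] at h
  have hb : d% (extChartAt 𝓘(ℝ, E) (ι p) ∘ ι) p (VectorField.mlieBracket 𝓘(ℝ, F) X Y p) = _ :=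
    (coords_push (X := VectorField.mlieBracket 𝓘(ℝ, F) X Y) hx hιd).symm
  rw [hb] at h
  have h1 := coords_covAlong (cov := cov) hx (mdifferentiableAt_push hι hX) (Y p)
  have h2 := coords_covAlong (cov := cov) hx (mdifferentiableAt_push hι hY) (X p)
  rw [hL.christoffel_symm hx] at h1
  have h3 : coords (ι p) (ι p) (covAlong cov ι (push E ι Y) p (X p) -
      covAlong cov ι (push E ι X) p (Y p)) =
      coords (ι p) (ι p) (push E ι (VectorField.mlieBracket 𝓘(ℝ, F) X Y) p) := by
    rw [map_sub, h1, h2, ← h]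
    simp only [push]
    abel
  rw [← frame_coords hx (covAlong cov ι (push E ι Y) p (X p) - covAlong cov ι (push E ι X) p (Y p)), h3,
    frame_coords hx]
  rfl

end Pushforward

lemma contMDiffAt_along {n : ℕ∞} {x₀ : N} (hx : ι p ∈ frameDomain E x₀) (hι : CMDiffAt n ι p)
    (h : CMDiffAt n (fun q ↦ coords x₀ (ι q) (W q)) p) : CMDiffAt n (alongMk ι W) p := by
  refine (Trivialization.contMDiffAt_iff (IB := 𝓘(ℝ, E)) (f := alongMk ι W)
    (e := trivializationAt E (TangentSpace 𝓘(ℝ, E)) x₀)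
    ((Trivialization.coe_mem_source _).mpr hx)).2 ⟨hι, h.congr_of_eventuallyEq ?_⟩
  filter_upwards [hι.continuousAt.preimage_mem_nhds ((isOpen_frameDomain (E := E) x₀).mem_nhds hx)]
    with q hq
  exact (coords_apply hq _).symm

lemma ContMDiffAt.eventually_mdifferentiableAt_along {n : ℕ∞} (hn : 1 ≤ n)
    (hW : CMDiffAt n (alongMk ι W) p) : ∀ᶠ q in 𝓝 p, MDiffAt (alongMk ι W) q := by
  have hx := mem_frameDomain (E := E) (ι p)
  have hι : CMDiffAt n ι p := (contMDiffAt_totalSpace.1 hW).1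
  filter_upwards [eventually_mdifferentiableAt hn hι,
    hι.continuousAt.preimage_mem_nhds ((isOpen_frameDomain (E := E) (ι p)).mem_nhds hx),
    eventually_mdifferentiableAt (N := E) hn (contMDiffAt_coords_along hx hW)] with q h1 h2 h3
  exact mdifferentiableAt_along h2 h1 h3

lemma IsLeviCivita.contMDiffAt_covAlong (hL : IsLeviCivita G cov) {n m : ℕ∞} (hnm : n + 1 ≤ m)
    (hι : CMDiffAt ∞ ι p) (hW : CMDiffAt m (alongMk ι W) p) {Y : Π q : M, TangentSpace 𝓘(ℝ, F) q}
    (hY : CMDiffAt n (T% Y) p) : CMDiffAt n (alongMk ι (fun q ↦ covAlong cov ι W q (Y q))) p := by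
  have hx := mem_frameDomain (E := E) (ι p)
  have hn : (n : ℕ∞ω) ≤ m := WithTop.coe_le_coe.2 (le_self_add.trans hnm)
  have hιn : CMDiffAt n ι p := hι.of_le (WithTop.coe_le_coe.2 le_top)
  refine contMDiffAt_along hx hιn ?_
  have h1 : CMDiffAt n (fun q ↦ d% (fun q ↦ coords (ι p) (ι q) (W q)) q (Y q)) p :=
    contMDiffAt_mvfderiv_apply (contMDiffAt_coords_along hx hW) hY hnm
  have h2 : CMDiffAt n (fun q ↦ christoffel cov (ι p) (ι q)) p :=
    (hL.contMDiffAt_christoffel hx).comp p hιn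
  have h3 := contMDiffAt_clm_apply (contMDiffAt_clm_apply h2
    (contMDiffAt_coords_along hx (hW.of_le hn)))
    (contMDiffAt_coords_along hx (contMDiffAt_push (E := E) hι hY))
  refine (h1.add h3).congr_of_eventuallyEq ?_
  filter_upwards [hι.continuousAt.preimage_mem_nhds
    ((isOpen_frameDomain (E := E) (ι p)).mem_nhds hx),
    ContMDiffAt.eventually_mdifferentiableAt_along (le_add_self.trans hnm) hW] with q hq hq'
  exact coords_covAlong hq hq' (Y q)

/-! ### Curvature of the pull-back connection. -/

section Curvature

variable {X Y : Π q : M, TangentSpace 𝓘(ℝ, F) q}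

variable (cov) in
/-- The curvature tensor of a connection in terms of its Christoffel symbols. -/
def curvatureForm (x : N) (u v w : TangentSpace 𝓘(ℝ, E) x) : TangentSpace 𝓘(ℝ, E) x :=
  frame x (d% (christoffel cov x) x u (coords x x w) (coords x x v) -
    d% (christoffel cov x) x v (coords x x w) (coords x x u) +
    christoffel cov x x (christoffel cov x x (coords x x w) (coords x x v)) (coords x x u) -
    christoffel cov x x (christoffel cov x x (coords x x w) (coords x x u)) (coords x x v)) x

/-- The non-tensorial contributions are isolated here: the second derivative of the components of
`W`, and the first derivatives of the components of `W` and of the direction field. -/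
lemma IsLeviCivita.coords_covAlong_covAlong (hL : IsLeviCivita G cov) (hι : CMDiffAt ∞ ι p)
    (hW : CMDiffAt 2 (alongMk ι W) p) (hY : CMDiffAt 1 (T% Y) p) (v : TangentSpace 𝓘(ℝ, F) p) :
    coords (ι p) (ι p) (covAlong cov ι (fun q ↦ covAlong cov ι W q (Y q)) p v) =
      d% (fun q ↦ d% (fun q ↦ coords (ι p) (ι q) (W q)) q (Y q)) p v +
      (d% (christoffel cov (ι p)) (ι p) (mfderiv 𝓘(ℝ, F) 𝓘(ℝ, E) ι p v)
        (coords (ι p) (ι p) (W p)) (coords (ι p) (ι p) (push E ι Y p)) +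
      christoffel cov (ι p) (ι p) (d% (fun q ↦ coords (ι p) (ι q) (W q)) p v)
        (coords (ι p) (ι p) (push E ι Y p)) +
      christoffel cov (ι p) (ι p) (coords (ι p) (ι p) (W p))
        (d% (fun q ↦ coords (ι p) (ι q) (push E ι Y q)) p v)) +
      christoffel cov (ι p) (ι p) (d% (fun q ↦ coords (ι p) (ι q) (W q)) p (Y p) +
        christoffel cov (ι p) (ι p) (coords (ι p) (ι p) (W p))
          (coords (ι p) (ι p) (push E ι Y p)))
        (coords (ι p) (ι p) (mfderiv 𝓘(ℝ, F) 𝓘(ℝ, E) ι p v)) := by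
  have hx := mem_frameDomain (E := E) (ι p)
  have hιd : MDiffAt ι p := hι.mdifferentiableAt (by simp)
  have hWd : MDiffAt (alongMk ι W) p := hW.mdifferentiableAt two_ne_zero
  have hYd : MDiffAt (T% Y) p := hY.mdifferentiableAt one_ne_zero
  have hA := mdifferentiableAt_coords_along hx hWd
  have hf := mdifferentiableAt_coords_along hx (mdifferentiableAt_push (E := E) hι hYd)
  have hΓ : MDiffAt (christoffel cov (ι p)) (ι p) :=
    (hL.contMDiffAt_christoffel (n := 1) hx).mdifferentiableAt one_ne_zero
  have hΓι : MDiffAt (fun q ↦ christoffel cov (ι p) (ι q)) p := hΓ.comp p hιd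
  have hD : MDiffAt (alongMk ι (fun q ↦ covAlong cov ι W q (Y q))) p :=
    (hL.contMDiffAt_covAlong (n := 1) (m := 2) (by norm_num) hι hW hY).mdifferentiableAt one_ne_zero
  rw [coords_covAlong hx hD, coords_covAlong hx hWd]
  have e : (fun q ↦ coords (ι p) (ι q) (covAlong cov ι W q (Y q))) =ᶠ[𝓝 p]
      fun q ↦ d% (fun q ↦ coords (ι p) (ι q) (W q)) q (Y q) + christoffel cov (ι p) (ι q)
        (coords (ι p) (ι q) (W q)) (coords (ι p) (ι q) (push E ι Y q)) := by
    filter_upwards [hι.continuousAt.preimage_mem_nhds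
      ((isOpen_frameDomain (E := E) (ι p)).mem_nhds hx),
      ContMDiffAt.eventually_mdifferentiableAt_along (n := 2) (by norm_num) hW] with q hq hq'
    exact coords_covAlong hq hq' (Y q)
  have e2 : d% (fun q ↦ coords (ι p) (ι q) (covAlong cov ι W q (Y q))) p = d% (fun q ↦
      d% (fun q ↦ coords (ι p) (ι q) (W q)) q (Y q) + christoffel cov (ι p) (ι q)
        (coords (ι p) (ι q) (W q)) (coords (ι p) (ι q) (push E ι Y q))) p := e.mfderiv_eq
  have hdA : MDiffAt (fun q ↦ d% (fun q ↦ coords (ι p) (ι q) (W q)) q (Y q)) p :=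
    (contMDiffAt_mvfderiv_apply (n := 1) (m := 2) (contMDiffAt_coords_along hx hW) hY
      (by norm_num)).mdifferentiableAt one_ne_zero
  have hc : d% (fun q ↦ christoffel cov (ι p) (ι q)) p v =
      d% (christoffel cov (ι p)) (ι p) (mfderiv 𝓘(ℝ, F) 𝓘(ℝ, E) ι p v) :=
    mfderiv_comp_apply p hΓ hιd v
  rw [e2, mvfderiv_fun_add hdA (mdifferentiableAt_clm_apply (mdifferentiableAt_clm_apply hΓι hA) hf),
    add_apply, mvfderiv_clm_apply (mdifferentiableAt_clm_apply hΓι hA) hf, mvfderiv_clm_apply hΓι hA,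
    add_apply, hc]
  rfl

/-- The curvature of the pull-back connection is the pull-back of the curvature. -/
lemma IsLeviCivita.covAlong_curvature (hL : IsLeviCivita G cov) (hι : CMDiffAt ∞ ι p)
    (hW : CMDiffAt 2 (alongMk ι W) p) (hX : CMDiffAt 1 (T% X) p) (hY : CMDiffAt 1 (T% Y) p) :
    covAlong cov ι (fun q ↦ covAlong cov ι W q (Y q)) p (X p) -
      covAlong cov ι (fun q ↦ covAlong cov ι W q (X q)) p (Y p) -
      covAlong cov ι W p (VectorField.mlieBracket 𝓘(ℝ, F) X Y p) =
    curvatureForm cov (ι p) (push E ι X p) (push E ι Y p) (W p) := by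
  have hx := mem_frameDomain (E := E) (ι p)
  have hWd : MDiffAt (alongMk ι W) p := hW.mdifferentiableAt two_ne_zero
  have hXd : MDiffAt (T% X) p := hX.mdifferentiableAt one_ne_zero
  have hYd : MDiffAt (T% Y) p := hY.mdifferentiableAt one_ne_zero
  have h1 := mvfderiv_commutator (contMDiffAt_coords_along (n := 2) hx hW) hXd hYd
  -- `h1` turns the second derivatives of the components of `W` into a derivative along the bracket;
  -- `h2` does so for the derivatives of the direction fields. Both are absorbed by the bracket term
  -- of the curvature.
  have h2 : d% (fun q ↦ coords (ι p) (ι q) (push E ι Y q)) p (X p) -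
      d% (fun q ↦ coords (ι p) (ι q) (push E ι X q)) p (Y p) =
      coords (ι p) (ι p) (mfderiv 𝓘(ℝ, F) 𝓘(ℝ, E) ι p
        (VectorField.mlieBracket 𝓘(ℝ, F) X Y p)) := by
    have h := congrArg (coords (ι p) (ι p)) (hL.covAlong_torsion hι hXd hYd)
    rw [map_sub, coords_covAlong hx (mdifferentiableAt_push hι hXd),
      coords_covAlong hx (mdifferentiableAt_push hι hYd), hL.christoffel_symm hx] at h
    rw [← h]
    simp only [push]
    abel
  set C := covAlong cov ι (fun q ↦ covAlong cov ι W q (Y q)) p (X p) -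
      covAlong cov ι (fun q ↦ covAlong cov ι W q (X q)) p (Y p) -
      covAlong cov ι W p (VectorField.mlieBracket 𝓘(ℝ, F) X Y p)
  rw [← frame_coords hx C, curvatureForm]
  congr 1
  simp only [C]
  rw [map_sub, map_sub, hL.coords_covAlong_covAlong hι hW hY, hL.coords_covAlong_covAlong hι hW hX,
    coords_covAlong hx hWd, ← h1, ← h2]
  simp only [map_add, map_sub, add_apply, push]
  abel

end Curvature

/-! ### Algebraic symmetries of the ambient curvature. -/

section CurvatureForm

lemma covAlong_id {Y : Π x : N, TangentSpace 𝓘(ℝ, E) x} {x : N} (hY : MDiffAt (T% Y) x)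
    (v : TangentSpace 𝓘(ℝ, E) x) : covAlong cov id Y x v = cov Y x v := by
  have h := covAlong_comp cov (ι := id) mdifferentiableAt_id hY v
  rwa [mfderiv_id] at h

/-- The case `ι = id` of `covAlong_curvature`. It makes the value independent of the extensions of
the three vectors. -/
lemma IsLeviCivita.curvatureOp_eq (hL : IsLeviCivita G cov) {X Y Z : Π x : N, TangentSpace 𝓘(ℝ, E) x}
    {x : N} (hX : CMDiffAt 1 (T% X) x) (hY : CMDiffAt 1 (T% Y) x) (hZ : CMDiffAt 2 (T% Z) x) :
    curvatureOp (fun Y q v ↦ cov Y q v) X Y Z x = curvatureForm cov x (X x) (Y x) (Z x) := by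
  have key (X Y : Π x : N, TangentSpace 𝓘(ℝ, E) x) (hY : CMDiffAt 1 (T% Y) x) :
      covAlong cov id (fun q ↦ covAlong cov id Z q (Y q)) x (X x) =
        cov (fun q ↦ cov Z q (Y q)) x (X x) := by
    have h1 : MDiffAt (T% (fun q ↦ covAlong cov id Z q (Y q))) x :=
      (hL.contMDiffAt_covAlong (ι := id) (n := 1) (m := 2) (by norm_num) contMDiffAt_id hZ
        hY).mdifferentiableAt one_ne_zero
    rw [covAlong_id h1]
    refine DFunLike.congr_fun (cov_congr h1 ?_) (X x) |>.symm
    filter_upwards [ContMDiffAt.eventually_mdifferentiableAt_along (ι := id) (n := 2) (by norm_num)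
      hZ] with q hq
    exact (covAlong_id hq (Y q)).symm
  have h := hL.covAlong_curvature (ι := id) contMDiffAt_id hZ hX hY
  rw [key X Y hY, key Y X hX, covAlong_id (hZ.mdifferentiableAt two_ne_zero)] at h
  have hp (X : Π x : N, TangentSpace 𝓘(ℝ, E) x) : push E id X x = X x := by
    simp only [push, mfderiv_id]; rfl
  rw [hp, hp] at h
  exact h

lemma IsLeviCivita.curvature_eq (hL : IsLeviCivita G cov) (x : N) (u v w : TangentSpace 𝓘(ℝ, E) x) :
    curvature (fun Y q v ↦ cov Y q v) x u v w = curvatureForm cov x u v w := by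
  have h := hL.curvatureOp_eq (x := x) (FiberBundle.contMDiffAt_extend 𝓘(ℝ, E) E u)
    (FiberBundle.contMDiffAt_extend 𝓘(ℝ, E) E v) (FiberBundle.contMDiffAt_extend 𝓘(ℝ, E) E w)
  simp only [FiberBundle.extend_apply_self] at h
  exact h

lemma frame_add_apply (x₀ x : N) (v w : E) : frame x₀ (v + w) x = frame x₀ v x + frame x₀ w x := by
  rw [frame_add, Pi.add_apply]

lemma frame_smul_apply (x₀ x : N) (c : ℝ) (w : E) : frame x₀ (c • w) x = c • frame x₀ w x := by
  rw [frame_smul, Pi.smul_apply]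

lemma clm₂_add {T : Type*} [AddCommGroup T] [Module ℝ T] [TopologicalSpace T]
    (D : T →L[ℝ] E →L[ℝ] E →L[ℝ] E) (u u' : T) (a b : E) : D (u + u') a b = D u a b + D u' a b := by
  rw [ContinuousLinearMap.map_add]; rfl

lemma clm₂_smul {T : Type*} [AddCommGroup T] [Module ℝ T] [TopologicalSpace T]
    (D : T →L[ℝ] E →L[ℝ] E →L[ℝ] E) (c : ℝ) (u : T) (a b : E) : D (c • u) a b = c • D u a b := by
  rw [ContinuousLinearMap.map_smul]; rfl

lemma clm₁_add (D : E →L[ℝ] E →L[ℝ] E) (u u' : E) (a : E) : D (u + u') a = D u a + D u' a := by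
  rw [map_add, add_apply]

lemma clm₁_smul (D : E →L[ℝ] E →L[ℝ] E) (c : ℝ) (u a : E) : D (c • u) a = c • D u a := by
  rw [map_smul, smul_apply]

lemma curvatureForm_add_left (x : N) (u u' v w : TangentSpace 𝓘(ℝ, E) x) :
    curvatureForm cov x (u + u') v w = curvatureForm cov x u v w + curvatureForm cov x u' v w := by
  rw [curvatureForm, curvatureForm, curvatureForm, ← frame_add_apply, clm₂_add,
    ContinuousLinearMap.map_add (coords x x), ContinuousLinearMap.map_add _ (coords x x u),
    ContinuousLinearMap.map_add _ (coords x x u), ContinuousLinearMap.map_add _ (coords x x u),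
    clm₁_add]
  congr 1
  abel

lemma curvatureForm_smul_left (x : N) (c : ℝ) (u v w : TangentSpace 𝓘(ℝ, E) x) :
    curvatureForm cov x (c • u) v w = c • curvatureForm cov x u v w := by
  rw [curvatureForm, curvatureForm, ← frame_smul_apply, clm₂_smul,
    ContinuousLinearMap.map_smul (coords x x), ContinuousLinearMap.map_smul _ c (coords x x u),
    ContinuousLinearMap.map_smul _ c (coords x x u),
    ContinuousLinearMap.map_smul _ c (coords x x u), clm₁_smul]
  congr 1
  module

lemma curvatureForm_skew (x : N) (u v w : TangentSpace 𝓘(ℝ, E) x) :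
    curvatureForm cov x u v w = - curvatureForm cov x v u w := by
  rw [eq_neg_iff_add_eq_zero, curvatureForm, curvatureForm, ← frame_add_apply]
  have h0 : frame x (0 : E) x = 0 := by rw [frame, map_zero]
  rw [← h0]
  congr 1
  abel

lemma curvatureForm_add_right (x : N) (u v w w' : TangentSpace 𝓘(ℝ, E) x) :
    curvatureForm cov x u v (w + w') = curvatureForm cov x u v w + curvatureForm cov x u v w' := by
  rw [curvatureForm, curvatureForm, curvatureForm, ← frame_add_apply,
    ContinuousLinearMap.map_add (coords x x), clm₁_add, clm₁_add, clm₁_add, clm₁_add,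
    clm₁_add, clm₁_add]
  congr 1
  abel

lemma curvatureForm_smul_right (x : N) (c : ℝ) (u v w : TangentSpace 𝓘(ℝ, E) x) :
    curvatureForm cov x u v (c • w) = c • curvatureForm cov x u v w := by
  rw [curvatureForm, curvatureForm, ← frame_smul_apply,
    ContinuousLinearMap.map_smul (coords x x), clm₁_smul, clm₁_smul, clm₁_smul, clm₁_smul,
    clm₁_smul, clm₁_smul]
  congr 1
  module

variable (cov) in
/-- `curvatureForm` as a trilinear map. -/
def curvatureTensor (x : N) : TangentSpace 𝓘(ℝ, E) x →ₗ[ℝ] TangentSpace 𝓘(ℝ, E) x →ₗ[ℝ]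
    TangentSpace 𝓘(ℝ, E) x →ₗ[ℝ] TangentSpace 𝓘(ℝ, E) x :=
  LinearMap.mk₂ ℝ (fun u v ↦
    { toFun w := curvatureForm cov x u v w
      map_add' := curvatureForm_add_right x u v
      map_smul' c := curvatureForm_smul_right x c u v })
    (fun u u' v ↦ LinearMap.ext fun w ↦ curvatureForm_add_left x u u' v w)
    (fun c u v ↦ LinearMap.ext fun w ↦ curvatureForm_smul_left x c u v w)
    (fun u v v' ↦ LinearMap.ext fun w ↦ by
      change curvatureForm cov x u (v + v') w = curvatureForm cov x u v w + curvatureForm cov x u v' w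
      rw [curvatureForm_skew, curvatureForm_add_left, neg_add, ← curvatureForm_skew,
        ← curvatureForm_skew])
    (fun c u v ↦ LinearMap.ext fun w ↦ by
      change curvatureForm cov x u (c • v) w = c • curvatureForm cov x u v w
      rw [curvatureForm_skew, curvatureForm_smul_left, ← smul_neg, ← curvatureForm_skew])

/-- Symmetry of the Christoffel symbols holds on a neighbourhood, hence also for their derivatives;
the cyclic sum then cancels term by term. -/
lemma IsLeviCivita.curvatureForm_bianchi (hL : IsLeviCivita G cov) (x : N)
    (u v w : TangentSpace 𝓘(ℝ, E) x) :
    curvatureForm cov x u v w + curvatureForm cov x v w u + curvatureForm cov x w u v = 0 := by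
  have hx := mem_frameDomain (E := E) x
  have hΓ : MDiffAt (christoffel cov x) x :=
    (hL.contMDiffAt_christoffel (n := 1) hx).mdifferentiableAt one_ne_zero
  have hd (a b : E) (c : TangentSpace 𝓘(ℝ, E) x) :
      d% (christoffel cov x) x c a b = d% (christoffel cov x) x c b a := by
    rw [← mvfderiv_clm_const hΓ, ← mvfderiv_clm_const hΓ,
      ← mvfderiv_clm_const (mdifferentiableAt_clm_apply hΓ mdifferentiableAt_const),
      ← mvfderiv_clm_const (mdifferentiableAt_clm_apply hΓ mdifferentiableAt_const)]
    have e : (fun q ↦ christoffel cov x q a b) =ᶠ[𝓝 x] fun q ↦ christoffel cov x q b a := by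
      filter_upwards [(isOpen_frameDomain x).mem_nhds hx] with y hy using hL.christoffel_symm hy a b
    have e2 : d% (fun q ↦ christoffel cov x q a b) x = d% (fun q ↦ christoffel cov x q b a) x :=
      e.mfderiv_eq
    rw [e2]
  have h0 : frame x (0 : E) x = 0 := by rw [frame, map_zero]
  simp only [curvatureForm, ← Pi.add_apply, ← frame_add]
  rw [← h0]
  congr 1
  rw [hd (coords x x w) (coords x x v), hd (coords x x w) (coords x x u),
    hd (coords x x u) (coords x x v), hL.christoffel_symm hx (coords x x w) (coords x x v),
    hL.christoffel_symm hx (coords x x w) (coords x x u),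
    hL.christoffel_symm hx (coords x x u) (coords x x v)]
  abel

/-- The commutator formula is applied to the function G(Z, Z). By metric compatibility the products
of two first derivatives of Z are symmetric and cancel, which leaves 2 G(R(X,Y)Z, Z) = 0. -/
lemma IsLeviCivita.inner_curvatureForm_self (hL : IsLeviCivita G cov) (x : N)
    (u v w : TangentSpace 𝓘(ℝ, E) x) : G.inner x (curvatureForm cov x u v w) w = 0 := by
  set X : Π y : N, TangentSpace 𝓘(ℝ, E) y := FiberBundle.extend E u
  set Y : Π y : N, TangentSpace 𝓘(ℝ, E) y := FiberBundle.extend E v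
  set Z : Π y : N, TangentSpace 𝓘(ℝ, E) y := FiberBundle.extend E w
  have hX : CMDiffAt 1 (T% X) x := FiberBundle.contMDiffAt_extend 𝓘(ℝ, E) E u
  have hY : CMDiffAt 1 (T% Y) x := FiberBundle.contMDiffAt_extend 𝓘(ℝ, E) E v
  have hZ : CMDiffAt 2 (T% Z) x := FiberBundle.contMDiffAt_extend 𝓘(ℝ, E) E w
  have hZd : MDiffAt (alongMk id Z) x := hZ.mdifferentiableAt two_ne_zero
  have hR := hL.covAlong_curvature (ι := id) contMDiffAt_id hZ hX hY
  have hp (X : Π x : N, TangentSpace 𝓘(ℝ, E) x) : push E id X x = X x := by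
    simp only [push, mfderiv_id]; rfl
  have e (w) : (FiberBundle.extend E w : Π y : N, TangentSpace 𝓘(ℝ, E) y) x = w := by simp
  rw [hp, hp, show X x = u from e u, show Y x = v from e v, show Z x = w from e w] at hR
  have hD (Y : Π x : N, TangentSpace 𝓘(ℝ, E) x) (hY : CMDiffAt 1 (T% Y) x) :
      MDiffAt (alongMk id (fun q ↦ covAlong cov id Z q (Y q))) x :=
    (hL.contMDiffAt_covAlong (ι := id) (n := 1) (m := 2) (by norm_num) contMDiffAt_id hZ
        hY).mdifferentiableAt one_ne_zero
  have key (Y : Π x : N, TangentSpace 𝓘(ℝ, E) x) (hY : CMDiffAt 1 (T% Y) x)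
      (u : TangentSpace 𝓘(ℝ, E) x) :
      d% (fun q ↦ d% (fun q ↦ G.inner q (Z q) (Z q)) q (Y q)) x u =
        2 * (G.inner x (covAlong cov id (fun q ↦ covAlong cov id Z q (Y q)) x u) (Z x) +
        G.inner x (covAlong cov id Z x (Y x)) (covAlong cov id Z x u)) := by
    have e1 : (fun q ↦ d% (fun q ↦ G.inner q (Z q) (Z q)) q (Y q)) =ᶠ[𝓝 x]
        fun q ↦ G.inner q (covAlong cov id Z q (Y q)) (Z q) +
          G.inner q (covAlong cov id Z q (Y q)) (Z q) := by
      filter_upwards [ContMDiffAt.eventually_mdifferentiableAt_along (ι := id) (n := 2)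
        (by norm_num) hZ] with q hq
      have := hL.covAlong_metric hq hq (Y q)
      simp only [id_eq] at this
      rw [this, G.symm q (Z q)]
    have e2 : d% (fun q ↦ d% (fun q ↦ G.inner q (Z q) (Z q)) q (Y q)) x =
        d% (fun q ↦ G.inner q (covAlong cov id Z q (Y q)) (Z q) +
          G.inner q (covAlong cov id Z q (Y q)) (Z q)) x := e1.mfderiv_eq
    have h3 := hL.covAlong_metric (hD Y hY) hZd u
    simp only [id_eq] at h3
    have hd := G.mdifferentiableAt_inner (hD Y hY) hZd
    rw [e2, mvfderiv_fun_add hd hd, add_apply, h3]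
    ring
  have hf : CMDiffAt 2 (fun q ↦ G.inner q (Z q) (Z q)) x := contMDiffAt_inner (ι := id) (n := 2) hZ hZ
  have hc := mvfderiv_commutator hf (hX.mdifferentiableAt one_ne_zero)
    (hY.mdifferentiableAt one_ne_zero)
  have hb := hL.covAlong_metric hZd hZd (VectorField.mlieBracket 𝓘(ℝ, E) X Y x)
  simp only [id_eq] at hb
  rw [key Y hY, key X hX, hb, G.symm x (Z x), show X x = u from e u, show Y x = v from e v,
    show Z x = w from e w] at hc
  have hR' := congrArg (fun z : TangentSpace 𝓘(ℝ, E) x ↦ G.inner x z w) hR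
  simp only [id_eq, map_sub, sub_apply] at hR'
  have hs := G.symm x (covAlong cov id Z x u) (covAlong cov id Z x v)
  have hR2 : G.inner x (curvatureForm cov x u v w) w = _ := hR'.symm
  rw [hR2]
  rw [hs] at hc
  linarith

lemma IsLeviCivita.curvatureForm_J (hL : IsLeviCivita G cov) {g : SemiRiemannianMetric E N}
    (j : NordenStructure g)
    (hJ : ∀ (x : N) (Y : Π x : N, TangentSpace 𝓘(ℝ, E) x) (v : TangentSpace 𝓘(ℝ, E) x),
      MDiffAt (T% Y) x → cov (fun y ↦ j.J y (Y y)) x v = j.J x (cov Y x v)) (x : N)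
    (u v w : TangentSpace 𝓘(ℝ, E) x) :
    curvatureForm cov x u v (j.J x w) = j.J x (curvatureForm cov x u v w) := by
  set X : Π y : N, TangentSpace 𝓘(ℝ, E) y := FiberBundle.extend E u
  set Y : Π y : N, TangentSpace 𝓘(ℝ, E) y := FiberBundle.extend E v
  set Z : Π y : N, TangentSpace 𝓘(ℝ, E) y := FiberBundle.extend E w
  have hX : CMDiffAt 1 (T% X) x := FiberBundle.contMDiffAt_extend 𝓘(ℝ, E) E u
  have hY : CMDiffAt 1 (T% Y) x := FiberBundle.contMDiffAt_extend 𝓘(ℝ, E) E v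
  have hZ : CMDiffAt 2 (T% Z) x := FiberBundle.contMDiffAt_extend 𝓘(ℝ, E) E w
  have hZd : MDiffAt (alongMk id Z) x := hZ.mdifferentiableAt two_ne_zero
  have hJZ : CMDiffAt 2 (alongMk id (fun y ↦ j.J y (Z y))) x :=
    contMDiffAt_J (ι := id) (n := 2) j hZ
  have hR := hL.covAlong_curvature (ι := id) contMDiffAt_id hZ hX hY
  have hR' := hL.covAlong_curvature (ι := id) contMDiffAt_id hJZ hX hY
  have key (X Y : Π x : N, TangentSpace 𝓘(ℝ, E) x) (hY : CMDiffAt 1 (T% Y) x) :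
      covAlong cov id (fun q ↦ covAlong cov id (fun y ↦ j.J y (Z y)) q (Y q)) x (X x) =
        j.J x (covAlong cov id (fun q ↦ covAlong cov id Z q (Y q)) x (X x)) := by
    have h1 : CMDiffAt 1 (alongMk id (fun q ↦ covAlong cov id Z q (Y q))) x :=
      hL.contMDiffAt_covAlong (ι := id) (n := 1) (m := 2) (by norm_num) contMDiffAt_id hZ hY
    refine Eq.trans ?_ (covAlong_J (ι := id) j hJ (h1.mdifferentiableAt one_ne_zero) (X x))
    refine covAlong_congr ((contMDiffAt_J (n := 1) j h1).mdifferentiableAt one_ne_zero) ?_ _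
    filter_upwards [ContMDiffAt.eventually_mdifferentiableAt_along (ι := id) (n := 2)
      (by norm_num) hZ] with q hq
    exact covAlong_J (ι := id) j hJ hq (Y q)
  have hb : covAlong cov id (fun y ↦ j.J y (Z y)) x (VectorField.mlieBracket 𝓘(ℝ, E) X Y x) =
      j.J x (covAlong cov id Z x (VectorField.mlieBracket 𝓘(ℝ, E) X Y x)) :=
    covAlong_J (ι := id) j hJ hZd _
  rw [key X Y hY, key Y X hX, hb, ← map_sub, ← map_sub] at hR'
  have hp (X : Π x : N, TangentSpace 𝓘(ℝ, E) x) : push E id X x = X x := by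
    simp only [push, mfderiv_id]; rfl
  have e (w) : (FiberBundle.extend E w : Π y : N, TangentSpace 𝓘(ℝ, E) y) x = w := by simp
  rw [hp, hp, show X x = u from e u, show Y x = v from e v, show Z x = w from e w] at hR hR'
  exact hR'.symm.trans (congrArg (j.J x) hR)

end CurvatureForm

/-! ### Uniqueness of the Levi-Civita connection, and the associated metric. -/

section Uniqueness

lemma mdifferentiableAt_J {g : SemiRiemannianMetric E N} (j : NordenStructure g)
    (hW : MDiffAt (alongMk ι W) p) : MDiffAt (alongMk ι (fun q ↦ j.J (ι q) (W q))) p := by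
  have hg := ((j.contMDiff (ι p)).mdifferentiableAt (by simp)).comp p
    (mdifferentiableAt_along_base hW)
  exact MDifferentiableAt.clm_bundle_apply (F₁ := E) (F₂ := E) hg hW

variable {cov' : CovariantDerivative 𝓘(ℝ, E) E (TangentSpace 𝓘(ℝ, E) : N → Type _)}

lemma IsLeviCivita.christoffel_eq (hL : IsLeviCivita G cov) (hL' : IsLeviCivita G cov') {x₀ x : N}
    (hx : x ∈ frameDomain E x₀) : christoffel cov x₀ x = christoffel cov' x₀ x := by
  ext w u
  refine (isInvertible_gram G hx).injective ?_
  ext z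
  rw [hL.koszul_frame hx, hL'.koszul_frame hx]

/-- The axioms do not constrain the connections on non-differentiable fields, so agreement can be
claimed only for fields differentiable at the point. -/
lemma IsLeviCivita.cov_eq (hL : IsLeviCivita G cov) (hL' : IsLeviCivita G cov')
    {Y : Π x : N, TangentSpace 𝓘(ℝ, E) x} {x : N} (hY : MDiffAt (T% Y) x)
    (v : TangentSpace 𝓘(ℝ, E) x) : cov Y x v = cov' Y x v := by
  have hx := mem_frameDomain (E := E) x
  have h (c : CovariantDerivative 𝓘(ℝ, E) E (TangentSpace 𝓘(ℝ, E) : N → Type _)) (w : E) :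
      c (frame x w) x v = frame x (christoffel c x x w (coords x x v)) x := by
    rw [christoffel_apply hx, frame_coords hx, frame_coords hx]
  rw [cov_coords cov hx hY, cov_coords cov' hx hY, h, h, hL.christoffel_eq hL' hx]

lemma IsLeviCivita.curvatureForm_eq (hL : IsLeviCivita G cov) (hL' : IsLeviCivita G cov') (x : N)
    (u v w : TangentSpace 𝓘(ℝ, E) x) : curvatureForm cov x u v w = curvatureForm cov' x u v w := by
  have hx := mem_frameDomain (E := E) x
  have e : christoffel cov x =ᶠ[𝓝 x] christoffel cov' x := by
    filter_upwards [(isOpen_frameDomain x).mem_nhds hx] with y hy using hL.christoffel_eq hL' hy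
  have e2 : mfderiv 𝓘(ℝ, E) 𝓘(ℝ, E →L[ℝ] E →L[ℝ] E) (christoffel cov x) x =
      mfderiv 𝓘(ℝ, E) 𝓘(ℝ, E →L[ℝ] E →L[ℝ] E) (christoffel cov' x) x := e.mfderiv_eq
  have e3 : d% (christoffel cov x) x = d% (christoffel cov' x) x := e2
  rw [curvatureForm, curvatureForm, e3, e.self_of_nhds]

/-- The Levi-Civita connection of a Kähler-Norden metric is that of the associated metric. -/
lemma NordenStructure.IsKahler.isLeviCivita_associated {g : SemiRiemannianMetric E N}
    {j : NordenStructure g} (hK : j.IsKahler) : IsLeviCivita j.associated (leviCivita g) where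
  torsion_free := (isLeviCivita_leviCivita g).torsion_free
  metric {x Y Z} hY hZ v := by
    have hJY : MDiffAt (T% (fun y ↦ j.J y (Y y))) x := by
      exact mdifferentiableAt_J (ι := id) j hY
    have := (isLeviCivita_leviCivita g).metric hJY hZ v
    rw [hK x Y v hY] at this
    exact this

end Uniqueness

end LeviCivita

/-! ### Linear algebra of curvature-like tensors. -/

section Algebra

section CurvatureLike

set_option linter.unusedSectionVars false

variable {K : Type*} [Field K] [CharZero K] {V : Type*} [AddCommGroup V] [Module K V]

/-- A curvature-like tensor of type `(0,4)`. -/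
structure IsCurvatureLike (T : V → V → V → V → K) : Prop where
  add (x x' y z w : V) : T (x + x') y z w = T x y z w + T x' y z w
  smul (c : K) (x y z w : V) : T (c • x) y z w = c * T x y z w
  skew (x y z w : V) : T x y z w = - T y x z w
  skew' (x y z w : V) : T x y z w = - T x y w z
  bianchi (x y z w : V) : T x y z w + T y z x w + T z x y w = 0

variable {T : V → V → V → V → K}

namespace IsCurvatureLike

lemma pair (hT : IsCurvatureLike T) (x y z w : V) : T x y z w = T z w x y := by
  have b1 := hT.bianchi x y z w
  have b2 := hT.bianchi y z w x
  have b3 := hT.bianchi z w x y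
  have b4 := hT.bianchi w x y z
  have s1 := hT.skew' y z w x
  have s2 := hT.skew' z w y x
  have s3 := hT.skew' w x z y
  have s4 := hT.skew' x z w y
  have s5 := hT.skew x z y w
  have s6 := hT.skew' x y w z
  have s7 := hT.skew w y z x
  have s8 := hT.skew' y w x z
  grind

lemma add₂ (hT : IsCurvatureLike T) (x y y' z w : V) : T x (y + y') z w =
    T x y z w + T x y' z w := by
  rw [hT.skew, hT.add, hT.skew y x, hT.skew y' x]; ring

lemma add₃ (hT : IsCurvatureLike T) (x y z z' w : V) : T x y (z + z') w =
    T x y z w + T x y z' w := by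
  rw [hT.pair, hT.add, hT.pair z, hT.pair z']

lemma add₄ (hT : IsCurvatureLike T) (x y z w w' : V) : T x y z (w + w') =
    T x y z w + T x y z w' := by
  rw [hT.pair, hT.add₂, hT.pair z, hT.pair z w']

lemma smul₂ (hT : IsCurvatureLike T) (c : K) (x y z w : V) : T x (c • y) z w = c * T x y z w := by
  rw [hT.skew, hT.smul, hT.skew y x]; ring

lemma smul₃ (hT : IsCurvatureLike T) (c : K) (x y z w : V) : T x y (c • z) w = c * T x y z w := by
  rw [hT.pair, hT.smul, hT.pair z]

lemma smul₄ (hT : IsCurvatureLike T) (c : K) (x y z w : V) : T x y z (c • w) = c * T x y z w := by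
  rw [hT.pair, hT.smul₂, hT.pair z]

lemma apply_self (hT : IsCurvatureLike T) (x z w : V) : T x x z w = 0 := by
  have := hT.skew x x z w
  grind

/-- A curvature-like tensor is determined by its sectional curvatures. -/
lemma eq_zero (hT : IsCurvatureLike T) (h : ∀ x y, T x y y x = 0) (x y z w : V) :
    T x y z w = 0 := by
  -- Polarization, first in the middle pair and then in the outer pair. The result `h2` makes `T`
  -- alternating in its first three arguments, so the Bianchi identity reads 3T = 0.
  have h1 (x y z : V) : T x y z x = 0 := by
    have e := h x (y + z)
    rw [hT.add₂, hT.add₃, hT.add₃, h, h] at e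
    have e2 : T x z y x = T x y z x := by
      rw [hT.pair, hT.skew, hT.skew', neg_neg]
    grind
  have h2 (x y z w : V) : T x y z w = - T x z y w := by
    have e := h1 (x + w) y z
    rw [hT.add, hT.add₄, hT.add₄, h1, h1] at e
    have e2 : T w y z x = T x z y w := by rw [hT.pair, hT.skew, hT.skew', neg_neg]
    grind
  have e1 := hT.bianchi x y z w
  have e2 := h2 y z x w
  have e3 := hT.skew y x z w
  have e4 := h2 z x y w
  have e5 := hT.skew z y x w
  grind

end IsCurvatureLike

end CurvatureLike

/-! ### Complex sectional curvature and null vectors. -/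

section Complex

variable {V : Type*} [AddCommGroup V] [Module ℂ V] {h : V →ₗ[ℂ] V →ₗ[ℂ] ℂ}
  {T : V → V → V → V → ℂ}

/-- Replaces a density argument. Along the line x + s w the product of h(x + s w, x + s w) and q(x +
s w) is a polynomial in s that vanishes identically; its first factor has leading coefficient h(w,
w) ≠ 0, so the second factor is zero. -/
lemma eq_zero_of_forall_line (hs : ∀ x y, h x y = h y x) {q : V → ℂ} {x w : V} {B : ℂ}
    (hq : ∀ s : ℂ, q (x + s • w) = q x + s * B + s ^ 2 * q w) (hw : h w w ≠ 0)
    (h0 : ∀ s : ℂ, h (x + s • w) (x + s • w) ≠ 0 → q (x + s • w) = 0) (hqw : q w = 0) :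
    q x = 0 := by
  have hx (s : ℂ) : h (x + s • w) (x + s • w) = h x x + 2 * s * h x w + s ^ 2 * h w w := by
    simp only [map_add, map_smul, LinearMap.add_apply, LinearMap.smul_apply, smul_eq_mul, hs w x]
    ring
  have hz (s : ℂ) : (h x x + 2 * s * h x w + s ^ 2 * h w w) * (q x + s * B) = 0 := by
    by_cases h1 : h (x + s • w) (x + s • w) = 0
    · rw [← hx, h1, zero_mul]
    · have := h0 s h1
      rw [hq, hqw] at this
      rw [show q x + s * B = 0 by linear_combination this, mul_zero]
  have e0 := hz 0
  have e1 := hz 1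
  have e2 := hz (-1)
  have e3 := hz 2
  have e4 := hz (-2)
  -- Finite differences at 0, ±1, ±2 extract the cubic and then the quadratic coefficient.
  have c3 : h w w * B = 0 := by linear_combination (e3 - e4 - 2 * e1 + 2 * e2) / 12
  have c2 : h w w * q x + 2 * h x w * B = 0 := by
    linear_combination (e1 + e2 - 2 * e0) / 2
  have hB : B = 0 := by simpa [hw] using c3
  rw [hB] at c2
  simpa [hw] using c2

/-- If every vector orthogonal to the non-null `x` were null, then by polarization `h` would vanish
on that complement, whose elements would be orthogonal to everything; the complement would be zero
and `x` would span the space. -/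
lemma exists_orthogonal_nonnull (hs : ∀ x y, h x y = h y x) (hnd : ∀ x, (∀ y, h x y = 0) → x = 0)
    {x : V} (hx : h x x ≠ 0) (hu : ∃ u, ∀ a : ℂ, u ≠ a • x) : ∃ w, h w x = 0 ∧ h w w ≠ 0 := by
  by_contra! hc
  obtain ⟨u, hu⟩ := hu
  have hp (u : V) : h (u - (h u x / h x x) • x) x = 0 := by
    simp only [map_sub, map_smul, LinearMap.sub_apply, LinearMap.smul_apply, smul_eq_mul]
    field_simp
    ring
  set w := u - (h u x / h x x) • x with hw
  have hw0 : w = 0 := by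
    refine hnd w fun y ↦ ?_
    set z := y - (h y x / h x x) • x
    have e : y = z + (h y x / h x x) • x := by simp [z]
    have h1 := hc w (hp u)
    have h2 := hc z (hp y)
    have h3 := hc (w + z) (by rw [map_add, LinearMap.add_apply, hp, hp, add_zero])
    simp only [map_add, LinearMap.add_apply, hs z w, h1, h2] at h3
    rw [e, map_add, map_smul, hp u, smul_zero, add_zero]
    linear_combination h3 / 2
  exact hu _ (sub_eq_zero.1 hw0)

lemma exists_nonnull [Nontrivial V] (hs : ∀ x y, h x y = h y x)
    (hnd : ∀ x, (∀ y, h x y = 0) → x = 0) : ∃ w, h w w ≠ 0 := by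
  by_contra! hc
  obtain ⟨u, hu⟩ := exists_ne (0 : V)
  refine hu (hnd u fun y ↦ ?_)
  have h3 := hc (u + y)
  simp only [map_add, LinearMap.add_apply, hs y u, hc] at h3
  linear_combination h3 / 2

/-- Square roots in ℂ normalize any non-null vector. The non-null requirement is then removed, first
for `y` orthogonal to `x`, then for arbitrary `y` by projecting along `x`, and finally for `x`, the
null cases by the line argument. -/
lemma IsCurvatureLike.eq_zero_of_orthonormal [Nontrivial V] (hT : IsCurvatureLike T)
    (hs : ∀ x y, h x y = h y x) (hnd : ∀ x, (∀ y, h x y = 0) → x = 0)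
    (hdim : ∀ x : V, ∃ u, ∀ a : ℂ, u ≠ a • x)
    (h0 : ∀ x y, h x x = 1 → h y y = 1 → h x y = 0 → T x y y x = 0) (x y z w : V) :
    T x y z w = 0 := by
  have hsq (c : ℂ) (hc : c ≠ 0) : ∃ a : ℂ, a ≠ 0 ∧ a * a * c = 1 := by
    obtain ⟨a, ha⟩ := IsAlgClosed.exists_pow_nat_eq c⁻¹ two_pos
    refine ⟨a, fun h ↦ ?_, ?_⟩
    · rw [h] at ha
      exact inv_ne_zero hc (by rw [← ha]; simp)
    · rw [← sq, ha, inv_mul_cancel₀ hc]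
  have hnn (x y : V) (hx : h x x ≠ 0) (hy : h y y ≠ 0) (hxy : h y x = 0) : T x y y x = 0 := by
    obtain ⟨a, ha, ha'⟩ := hsq _ hx
    obtain ⟨b, hb, hb'⟩ := hsq _ hy
    have := h0 (a • x) (b • y) (by simp [← ha', mul_assoc]) (by simp [← hb', mul_assoc])
      (by simp [hs x, hxy])
    rw [hT.smul, hT.smul₂, hT.smul₃, hT.smul₄] at this
    simpa [ha, hb] using this
  have hperp (x y : V) (hx : h x x ≠ 0) (hxy : h y x = 0) : T x y y x = 0 := by
    obtain ⟨w, hwx, hw⟩ := exists_orthogonal_nonnull hs hnd hx (hdim x)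
    refine eq_zero_of_forall_line (q := fun y ↦ T x y y x) (B := T x y w x + T x w y x) hs
      (fun s ↦ ?_) hw (fun s h1 ↦ hnn x _ hx h1 ?_) (hnn x w hx hw hwx)
    · simp only [hT.add₂, hT.add₃, hT.smul₂, hT.smul₃]
      ring
    · simp [hxy, hwx]
  have hany (x y : V) (hx : h x x ≠ 0) : T x y y x = 0 := by
    have hp : h (y - (h y x / h x x) • x) x = 0 := by
      simp only [map_sub, map_smul, LinearMap.sub_apply, LinearMap.smul_apply, smul_eq_mul]
      field_simp
      ring
    have e := hperp x _ hx hp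
    have hy : y = (y - (h y x / h x x) • x) + (h y x / h x x) • x := by simp
    rw [hy]
    simp only [hT.add₂, hT.add₃, hT.smul₂, hT.smul₃, hT.apply_self, e]
    have e2 : T x (y - (h y x / h x x) • x) x x = 0 := by
      rw [hT.pair, hT.apply_self]
    simp [e2]
  refine hT.eq_zero (fun x y ↦ ?_) x y z w
  obtain ⟨w, hw⟩ := exists_nonnull hs hnd
  refine eq_zero_of_forall_line (q := fun x ↦ T x y y x) (B := T x y y w + T w y y x) hs
    (fun s ↦ ?_) hw (fun s h1 ↦ hany _ _ h1) (hany w y hw)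
  simp only [hT.add, hT.add₄, hT.smul, hT.smul₄]
  ring

end Complex

/-! ### Kähler-Norden curvature tensors as complex tensors. -/

section Norden

variable {V : Type*} [AddCommGroup V] [Module ℝ V] {g : V →ₗ[ℝ] V →ₗ[ℝ] ℝ} {J : V →ₗ[ℝ] V}
  {R : V →ₗ[ℝ] V →ₗ[ℝ] V →ₗ[ℝ] V}

/-- The algebraic properties of the curvature tensor of a Kähler-Norden manifold. -/
structure IsKahlerCurvature (g : V →ₗ[ℝ] V →ₗ[ℝ] ℝ) (J : V →ₗ[ℝ] V)
    (R : V →ₗ[ℝ] V →ₗ[ℝ] V →ₗ[ℝ] V) : Prop where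
  symm (x y : V) : g x y = g y x
  nondegenerate (x : V) (h : ∀ y, g x y = 0) : x = 0
  sq (x : V) : J (J x) = -x
  anti_isometry (x y : V) : g (J x) (J y) = - g x y
  skew (x y z : V) : R x y z = - R y x z
  metric (x y z : V) : g (R x y z) z = 0
  bianchi (x y z : V) : R x y z + R y z x + R z x y = 0
  parallel (x y z : V) : R x y (J z) = J (R x y z)

namespace IsKahlerCurvature

lemma inner_J (hR : IsKahlerCurvature g J R) (x y : V) : g (J x) y = g x (J y) := by
  have := hR.anti_isometry x (J y)
  rw [hR.sq, map_neg] at this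
  linarith

lemma ext (hR : IsKahlerCurvature g J R) {x y : V} (h : ∀ z, g x z = g y z) : x = y := by
  rw [← sub_eq_zero]
  refine hR.nondegenerate _ fun z ↦ ?_
  rw [map_sub, LinearMap.sub_apply, h, sub_self]

lemma metric' (hR : IsKahlerCurvature g J R) (x y z w : V) : g (R x y z) w = - g (R x y w) z := by
  have := hR.metric x y (z + w)
  simp only [map_add, LinearMap.add_apply, hR.metric] at this
  linarith

lemma isCurvatureLike (hR : IsKahlerCurvature g J R) :
    IsCurvatureLike (fun x y z w ↦ g (R x y z) w) where
  add x x' y z w := by simp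
  smul c x y z w := by simp
  skew x y z w := by rw [hR.skew, map_neg, LinearMap.neg_apply]
  skew' := hR.metric'
  bianchi x y z w := by
    rw [← LinearMap.add_apply, ← LinearMap.add_apply, ← map_add, ← map_add, hR.bianchi, map_zero,
      LinearMap.zero_apply]

/-- Pair symmetry moves `J` to the last two slots, where it commutes with the curvature operator and
is self-adjoint. -/
lemma J_left_eq_J_middle (hR : IsKahlerCurvature g J R) (x y z : V) :
    R (J x) y z = R x (J y) z := by
  refine hR.ext fun w ↦ ?_
  have h1 := hR.isCurvatureLike.pair (J x) y z w
  have h2 := hR.isCurvatureLike.pair x (J y) z w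
  rw [h1, h2, hR.parallel, hR.inner_J]

/-- The Bianchi identity with `J` on one argument relates two of the three cyclic expressions R(Jx,
y)z. Its three cyclic instances form a linear system, solved with the help of `J` applied to the
plain Bianchi identity. -/
lemma J_left (hR : IsKahlerCurvature g J R) (x y z : V) : R (J x) y z = J (R x y z) := by
  have e (x y z : V) : R (J x) y z + J (R y z x) + R (J z) x y = 0 := by
    rw [hR.J_left_eq_J_middle z, ← hR.parallel]
    exact hR.bianchi _ _ _
  have b : J (R x y z) + J (R y z x) + J (R z x y) = 0 := by
    rw [← map_add, ← map_add, hR.bianchi, map_zero]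
  linear_combination (norm := module) (2⁻¹ : ℝ) • (e x y z + e y z x - e z x y - b)

/-- Constant totally real sectional curvatures determine the curvature tensor. -/
theorem eq_of_totallyReal (hR : IsKahlerCurvature g J R)
    (hdim : ∀ x, ∃ u, ∀ a b : ℝ, u ≠ a • x + b • J x)
    {ν κ : ℝ} (h : ∀ x y, g x x = 1 → g y y = 1 → g x y = 0 → g (J x) x = 0 → g (J x) y = 0 →
      g (J y) y = 0 → g (R x y y) x = ν ∧ g (R x y y) (J x) = - κ) (x y z : V) :
    R x y z = ν • (g y z • x - g (J y) z • J x - g x z • y + g (J x) z • J y) +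
      κ • (g y z • J x + g (J y) z • x - g x z • J y - g (J x) z • y) := by
  have hJ : J * J = -1 := LinearMap.ext fun v ↦ by simp [hR.sq]
  -- The imaginary unit acts as `J`. The real part of `H` is `g`, so `H` inherits nondegeneracy, and
  -- identities for `g` are recovered as real parts.
  let _ : Module ℂ V := Module.compHom V (Complex.liftAux (A := Module.End ℝ V) J hJ).toRingHom
  have hsm (c : ℂ) (v : V) : c • v = c.re • v + c.im • J v := by
    change Complex.liftAux (A := Module.End ℝ V) J hJ c v = _
    rw [Complex.liftAux_apply]
    simp
  let H : V →ₗ[ℂ] V →ₗ[ℂ] ℂ := LinearMap.mk₂ ℂ (fun x y ↦ (g x y : ℂ) - Complex.I * g (J x) y)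
    (fun x x' y ↦ by simp; ring)
    (fun c x y ↦ by
      apply Complex.ext <;> (simp [hsm, hR.sq]; try ring))
    (fun x y y' ↦ by simp; ring)
    (fun c x y ↦ by
      apply Complex.ext <;> (simp [hsm, hR.anti_isometry, ← hR.inner_J]; try ring))
  have hH (x y : V) : H x y = (g x y : ℂ) - Complex.I * g (J x) y := rfl
  have hs (x y : V) : H x y = H y x := by
    rw [hH, hH, hR.symm x y, hR.inner_J, hR.symm x]
  have hnd (x : V) (hx : ∀ y, H x y = 0) : x = 0 := by
    refine hR.nondegenerate x fun y ↦ ?_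
    have := congrArg Complex.re (hx y)
    simpa [hH] using this
  have hdim' (x : V) : ∃ u, ∀ a : ℂ, u ≠ a • x := by
    obtain ⟨u, hu⟩ := hdim x
    exact ⟨u, fun a ↦ by rw [hsm]; exact hu _ _⟩
  have : Nontrivial V := by
    obtain ⟨u, hu⟩ := hdim 0
    exact ⟨u, 0, by simpa using hu 0 0⟩
  -- For an H-orthonormal pair, H(R(x,y)y, x) = g(R(x,y)y, x) - i g(R(x,y)y, Jx) = ν + iκ, whence
  -- the sign of κ in the hypothesis.
  let c : ℂ := ⟨ν, κ⟩
  have hT : IsCurvatureLike (K := ℂ) fun x y z w ↦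
      H (R x y z) w - c * (H y z * H x w - H x z * H y w) :=
    { add x x' y z w := by simp; ring
      smul a x y z w := by
        have : R (a • x) y z = a • R x y z := by
          simp only [hsm, map_add, map_smul, LinearMap.add_apply, LinearMap.smul_apply, hR.J_left]
        rw [this]
        simp; ring
      skew x y z w := by
        rw [hR.skew, map_neg, LinearMap.neg_apply]; ring
      skew' x y z w := by
        have : H (R x y z) w = - H (R x y w) z := by
          rw [hH, hH, ← hR.parallel, hR.metric' x y z, hR.metric' x y (J z), ← hR.inner_J]
          push_cast; ring
        rw [this]; ring
      bianchi x y z w := by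
        have := congrArg (fun v ↦ H v w) (hR.bianchi x y z)
        simp only [map_add, LinearMap.add_apply, map_zero, LinearMap.zero_apply] at this
        rw [hs z y, hs z x, hs y x]
        linear_combination this }
  have key := hT.eq_zero_of_orthonormal hs hnd hdim' fun x y hx hy hxy ↦ by
    have h1 := congrArg Complex.re hx
    have h2 := congrArg Complex.im hx
    have h3 := congrArg Complex.re hy
    have h4 := congrArg Complex.im hy
    have h5 := congrArg Complex.re hxy
    have h6 := congrArg Complex.im hxy
    simp only [hH] at h1 h2 h3 h4 h5 h6
    simp at h1 h2 h3 h4 h5 h6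
    obtain ⟨e1, e2⟩ := h x y h1 h3 h5 h2 h6 h4
    rw [hx, hy, hxy, hs y x, hxy, hH, hR.inner_J, e1, e2]
    apply Complex.ext <;> simp [c]
  refine hR.ext fun w ↦ ?_
  have := congrArg Complex.re (key x y z w)
  simp only [hH] at this
  simp [c] at this
  simp only [map_add, map_sub, map_smul, LinearMap.add_apply, LinearMap.sub_apply,
    LinearMap.smul_apply, smul_eq_mul]
  linarith

end IsKahlerCurvature

end Norden

end Algebra

section LeviCivita

set_option linter.unusedSectionVars false

variable {E : Type*} [NormedAddCommGroup E] [NormedSpace ℝ E] [FiniteDimensional ℝ E]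
  {N : Type*} [TopologicalSpace N] [ChartedSpace E N] [IsManifold 𝓘(ℝ, E) ∞ N]
  {F : Type*} [NormedAddCommGroup F] [NormedSpace ℝ F] [FiniteDimensional ℝ F]
  {M : Type*} [TopologicalSpace M] [ChartedSpace F M] [IsManifold 𝓘(ℝ, F) ∞ M]
  {G : SemiRiemannianMetric E N}
  {cov : CovariantDerivative 𝓘(ℝ, E) E (TangentSpace 𝓘(ℝ, E) : N → Type _)}
  {ι : M → N} {W W' : Π p : M, TangentSpace 𝓘(ℝ, E) (ι p)} {p : M}


/-! ### Null pairs and the transversal decomposition. -/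

section NullPair

variable {S : Π p : M, Submodule ℝ (TangentSpace 𝓘(ℝ, F) p)} {ξ : TangentSpace 𝓘(ℝ, F) p}
  {n : TangentSpace 𝓘(ℝ, E) (ι p)}

lemma IsNullPair.inner_tangent (h : IsNullPair G ι S p ξ n) (w : TangentSpace 𝓘(ℝ, F) p) :
    G.inner (ι p) (mfderiv 𝓘(ℝ, F) 𝓘(ℝ, E) ι p w) (mfderiv 𝓘(ℝ, F) 𝓘(ℝ, E) ι p ξ) = 0 := by
  rw [G.symm]
  exact h.mem_radical w

/-- The tangent space lies in the kernel of G(ξ, ·) and has the same dimension, hence equals it;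
subtracting the `n`-component G(w, ξ) n lands in this kernel. -/
lemma IsNullPair.exists_decomposition (hS : IsHypersurface E F ι) (h : IsNullPair G ι S p ξ n)
    (w : TangentSpace 𝓘(ℝ, E) (ι p)) : ∃ v, w = mfderiv 𝓘(ℝ, F) 𝓘(ℝ, E) ι p v +
      G.inner (ι p) w (mfderiv 𝓘(ℝ, F) 𝓘(ℝ, E) ι p ξ) • n := by
  have : FiniteDimensional ℝ (TangentSpace 𝓘(ℝ, F) p) := inferInstanceAs (FiniteDimensional ℝ F)
  have : FiniteDimensional ℝ (TangentSpace 𝓘(ℝ, E) (ι p)) :=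
    inferInstanceAs (FiniteDimensional ℝ E)
  let A : TangentSpace 𝓘(ℝ, F) p →ₗ[ℝ] TangentSpace 𝓘(ℝ, E) (ι p) :=
    (mfderiv 𝓘(ℝ, F) 𝓘(ℝ, E) ι p).toLinearMap
  let f : TangentSpace 𝓘(ℝ, E) (ι p) →ₗ[ℝ] ℝ :=
    (G.inner (ι p) (mfderiv 𝓘(ℝ, F) 𝓘(ℝ, E) ι p ξ)).toLinearMap
  have hf (w) : f w = G.inner (ι p) w (mfderiv 𝓘(ℝ, F) 𝓘(ℝ, E) ι p ξ) := G.symm _ _ _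
  have hfn : f n = 1 := by rw [hf]; exact h.pairing
  have hle : LinearMap.range A ≤ LinearMap.ker f := by
    rintro _ ⟨v, rfl⟩
    rw [LinearMap.mem_ker, hf]
    exact h.inner_tangent v
  have h1 : finrank ℝ (LinearMap.range A) = finrank ℝ F :=
    LinearMap.finrank_range_of_inj (hS.injective p)
  have hsurj : LinearMap.range f = ⊤ := by
    rw [LinearMap.range_eq_top]
    exact fun c ↦ ⟨c • n, by rw [map_smul, hfn, smul_eq_mul, mul_one]⟩
  have h2 := f.finrank_range_add_finrank_ker
  rw [hsurj, finrank_top, finrank_self] at h2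
  have h3 : finrank ℝ (TangentSpace 𝓘(ℝ, E) (ι p)) = finrank ℝ F + 1 := hS.codim.symm
  have heq : LinearMap.range A = LinearMap.ker f :=
    Submodule.eq_of_le_of_finrank_eq hle (by omega)
  have hmem : w - f w • n ∈ LinearMap.range A := by
    rw [heq, LinearMap.mem_ker, map_sub, map_smul, hfn, smul_eq_mul, mul_one, sub_self]
  obtain ⟨v, hv⟩ := hmem
  exact ⟨v, by rw [← hf, ← sub_eq_iff_eq_add]; exact hv.symm⟩

lemma IsNullPair.eq_of_inner (hS : IsHypersurface E F ι) (h : IsNullPair G ι S p ξ n)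
    {w w' : TangentSpace 𝓘(ℝ, E) (ι p)}
    (h1 : ∀ v, G.inner (ι p) w (mfderiv 𝓘(ℝ, F) 𝓘(ℝ, E) ι p v) =
      G.inner (ι p) w' (mfderiv 𝓘(ℝ, F) 𝓘(ℝ, E) ι p v))
    (h2 : G.inner (ι p) w n = G.inner (ι p) w' n) : w = w' := by
  rw [← sub_eq_zero]
  refine G.nondegenerate _ _ fun z ↦ ?_
  obtain ⟨v, hv⟩ := h.exists_decomposition hS z
  rw [hv, map_add, map_smul, map_sub, sub_apply, sub_apply, h1, h2]
  simp

/-- Pairing with ξ forces `c = 0`. Tangential identities can thus be proved modulo `n`, without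
knowing the transversal coefficients. -/
lemma IsNullPair.eq_of_tangent (hS : IsHypersurface E F ι) (h : IsNullPair G ι S p ξ n)
    {u u' : TangentSpace 𝓘(ℝ, F) p} {c : ℝ} (he : mfderiv 𝓘(ℝ, F) 𝓘(ℝ, E) ι p u =
      mfderiv 𝓘(ℝ, F) 𝓘(ℝ, E) ι p u' + c • n) : u = u' := by
  have h1 := congrArg (fun w ↦ G.inner (ι p) w (mfderiv 𝓘(ℝ, F) 𝓘(ℝ, E) ι p ξ)) he
  simp only [map_add, map_smul, add_apply, smul_apply, h.inner_tangent, h.pairing, smul_eq_mul,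
    zero_add, mul_one] at h1
  rw [← h1, zero_smul, add_zero] at he
  exact hS.injective p he

/-- `transversal` is spanned by the vectors of all null pairs, so uniqueness up to scale is needed.
The tangent part of another such `n'` is orthogonal to the screen, hence radical, hence a multiple r
ξ; nullity of r ξ + k n reads 2kr = 0 with k ≠ 0. -/
lemma IsNullPair.transversal_eq (hS : IsHypersurface E F ι) (hScr : IsScreen G ι S)
    (h : IsNullPair G ι S p ξ n) : transversal G ι S p = Submodule.span ℝ {n} := by
  refine le_antisymm (Submodule.span_le.2 ?_) (Submodule.span_mono ?_)
  · rintro n' ⟨ξ', h'⟩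
    obtain ⟨v, hv⟩ := h.exists_decomposition hS n'
    set k := G.inner (ι p) n' (mfderiv 𝓘(ℝ, F) 𝓘(ℝ, E) ι p ξ)
    have hrad (x : TangentSpace 𝓘(ℝ, F) p) (hx : x ∈ radical G ι p) :
        mfderiv 𝓘(ℝ, F) 𝓘(ℝ, E) ι p x = G.inner (ι p) n (mfderiv 𝓘(ℝ, F) 𝓘(ℝ, E) ι p x) •
          mfderiv 𝓘(ℝ, F) 𝓘(ℝ, E) ι p ξ := by
      refine h.eq_of_inner hS (fun y ↦ ?_) ?_
      · have e1 := hx y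
        have e2 := h.mem_radical y
        simp only [induced] at e1 e2
        rw [map_smul, smul_apply, e1, e2, smul_zero]
      · rw [map_smul, smul_apply, G.symm _ _ n, G.symm _ _ n, h.pairing, smul_eq_mul, mul_one]
    have hvr : v ∈ radical G ι p := by
      intro w
      obtain ⟨s, hs, r, hr, rfl⟩ := Submodule.mem_sup.1
        ((hScr.isCompl p).sup_eq_top ▸ Submodule.mem_top : w ∈ S p ⊔ radical G ι p)
      have hve : mfderiv 𝓘(ℝ, F) 𝓘(ℝ, E) ι p v = n' - k • n := eq_sub_of_add_eq hv.symm
      have hr' := hr v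
      simp only [induced] at hr' ⊢
      rw [map_add, map_add, G.symm _ _ (mfderiv 𝓘(ℝ, F) 𝓘(ℝ, E) ι p r), hr', hve, map_sub,
        map_smul, sub_apply, smul_apply, h.orthogonal s hs, h'.orthogonal s hs]
      simp
    have hk := hrad v hvr
    set r := G.inner (ι p) n (mfderiv 𝓘(ℝ, F) 𝓘(ℝ, E) ι p v)
    rw [hk] at hv
    have hk0 : k ≠ 0 := by
      intro h0
      have e := h'.pairing
      rw [hrad ξ' h'.mem_radical, map_smul] at e
      change _ • k = 1 at e
      rw [h0, smul_zero] at e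
      exact zero_ne_one e
    have hnull := h'.null
    have hξξ := h.inner_tangent ξ
    rw [hv] at hnull
    simp only [map_add, map_smul, add_apply, smul_apply, h.null, h.pairing, hξξ,
      G.symm _ (mfderiv 𝓘(ℝ, F) 𝓘(ℝ, E) ι p ξ) n, smul_eq_mul] at hnull
    have hr : r = 0 := by
      have : 2 * k * r = 0 := by linear_combination hnull
      simpa [hk0] using this
    rw [hr, zero_smul, zero_add] at hv
    rw [hv]
    exact Submodule.smul_mem _ _ (Submodule.mem_span_singleton_self n)
  · rintro _ rfl
    exact ⟨ξ, h⟩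

/-- The choice in `inducedConnection` is always meaningful, because the decomposition exists for any
ambient vector; no regularity of `Y` is involved. -/
lemma IsNullPair.inducedConnection_spec (hS : IsHypersurface E F ι) (hScr : IsScreen G ι S)
    (h : IsNullPair G ι S p ξ n) (Y : Π p : M, TangentSpace 𝓘(ℝ, F) p)
    (v : TangentSpace 𝓘(ℝ, F) p) :
    covAlong (leviCivita G) ι (push E ι Y) p v =
      mfderiv 𝓘(ℝ, F) 𝓘(ℝ, E) ι p (inducedConnection G ι S Y p v) +
      G.inner (ι p) (covAlong (leviCivita G) ι (push E ι Y) p v)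
        (mfderiv 𝓘(ℝ, F) 𝓘(ℝ, E) ι p ξ) • n := by
  set W := covAlong (leviCivita G) ι (push E ι Y) p v
  have hex : ∃ u, W - mfderiv 𝓘(ℝ, F) 𝓘(ℝ, E) ι p u ∈ transversal G ι S p := by
    obtain ⟨u, hu⟩ := h.exists_decomposition hS W
    refine ⟨u, ?_⟩
    rw [h.transversal_eq hS hScr, sub_eq_of_eq_add' hu]
    exact Submodule.smul_mem _ _ (Submodule.mem_span_singleton_self n)
  have hsp : W - mfderiv 𝓘(ℝ, F) 𝓘(ℝ, E) ι p (inducedConnection G ι S Y p v) ∈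
      transversal G ι S p := Classical.epsilon_spec hex
  rw [h.transversal_eq hS hScr, Submodule.mem_span_singleton] at hsp
  obtain ⟨c, hc⟩ := hsp
  have h1 := congrArg (fun w ↦ G.inner (ι p) w (mfderiv 𝓘(ℝ, F) 𝓘(ℝ, E) ι p ξ)) hc
  simp only [map_sub, map_smul, sub_apply, smul_apply, h.inner_tangent, h.pairing, smul_eq_mul,
    sub_zero, mul_one] at h1
  rw [← h1, hc, add_sub_cancel]

end NullPair

/-- A local null pair of a totally umbilical radical transversal lightlike hypersurface for which
the functions `b` and `ρ` are constant. -/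
structure IsUmbilicalPair (j : NordenStructure G) (ι : M → N)
    (S : Π p : M, Submodule ℝ (TangentSpace 𝓘(ℝ, F) p)) (U : Set M)
    (ξ : Π p : M, TangentSpace 𝓘(ℝ, F) p) (n : Π p : M, TangentSpace 𝓘(ℝ, E) (ι p))
    (b ρ : ℝ) : Prop where
  isKahler : j.IsKahler
  hypersurface : IsHypersurface E F ι
  screen : IsScreen G ι S
  pairOn : IsNullPairOn G ι S U ξ n
  J_radical : ∀ q ∈ U, j.J (ι q) (mfderiv 𝓘(ℝ, F) 𝓘(ℝ, E) ι q (ξ q)) = b • n q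
  umbilical : IsUmbilicalOn G ι U ξ fun _ ↦ ρ

lemma NordenStructure.inner_J (j : NordenStructure G) (x : N) (v w : TangentSpace 𝓘(ℝ, E) x) :
    G.inner x (j.J x v) w = G.inner x v (j.J x w) := by
  have := j.anti_isometry x v (j.J x w)
  rw [j.sq, map_neg] at this
  linarith

/-! ### Derivatives of ξ and N when b and ρ are constant. -/

namespace IsUmbilicalPair

variable {j : NordenStructure G} {S : Π p : M, Submodule ℝ (TangentSpace 𝓘(ℝ, F) p)} {U : Set M}
    {ξ : Π p : M, TangentSpace 𝓘(ℝ, F) p} {n : Π p : M, TangentSpace 𝓘(ℝ, E) (ι p)} {b ρ : ℝ}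
    {Y Z : Π p : M, TangentSpace 𝓘(ℝ, F) p}

lemma contMDiffAt_xi (h : IsUmbilicalPair j ι S U ξ n b ρ) (hp : p ∈ U) :
    CMDiffAt ∞ (T% ξ) p :=
  (h.pairOn.smooth p hp).contMDiffAt (h.pairOn.isOpen.mem_nhds hp)

lemma mdifferentiableAt_push_xi (h : IsUmbilicalPair j ι S U ξ n b ρ) (hp : p ∈ U) :
    MDiffAt (alongMk ι (push E ι ξ)) p :=
  mdifferentiableAt_push (h.hypersurface.contMDiff p)
    ((h.contMDiffAt_xi hp).mdifferentiableAt (by simp))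

lemma b_ne_zero (h : IsUmbilicalPair j ι S U ξ n b ρ) (hp : p ∈ U) :
    b ≠ 0 := by
  rintro rfl
  have h1 := h.J_radical p hp
  rw [zero_smul] at h1
  have h2 := j.sq (ι p) (mfderiv 𝓘(ℝ, F) 𝓘(ℝ, E) ι p (ξ p))
  rw [h1, map_zero] at h2
  have h3 := (h.pairOn.pair p hp).pairing
  rw [neg_eq_zero.1 h2.symm, map_zero] at h3
  exact zero_ne_one h3

/-- Regularity of `n` is not part of `IsNullPairOn`; it is inherited from Jξ through this formula.
-/
lemma n_eq (h : IsUmbilicalPair j ι S U ξ n b ρ) (hp : p ∈ U) :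
    n p = b⁻¹ • j.J (ι p) (push E ι ξ p) := by
  have : j.J (ι p) (push E ι ξ p) = b • n p := h.J_radical p hp
  rw [this, inv_smul_smul₀ (h.b_ne_zero hp)]

lemma eventually_n_eq (h : IsUmbilicalPair j ι S U ξ n b ρ) (hp : p ∈ U) :
    ∀ᶠ q in 𝓝 p, n q = b⁻¹ • j.J (ι q) (push E ι ξ q) := by
  filter_upwards [h.pairOn.isOpen.mem_nhds hp] with q hq using h.n_eq hq

lemma J_n (h : IsUmbilicalPair j ι S U ξ n b ρ) (hp : p ∈ U) :
    j.J (ι p) (n p) = - (b⁻¹ • push E ι ξ p) := by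
  rw [h.n_eq hp, map_smul, j.sq, smul_neg]

lemma inner_J_tangent (h : IsUmbilicalPair j ι S U ξ n b ρ) (hp : p ∈ U)
    (v : TangentSpace 𝓘(ℝ, F) p) :
    G.inner (ι p) (j.J (ι p) (push E ι ξ p)) (mfderiv 𝓘(ℝ, F) 𝓘(ℝ, E) ι p v) =
      b * G.inner (ι p) (n p) (mfderiv 𝓘(ℝ, F) 𝓘(ℝ, E) ι p v) := by
  have : j.J (ι p) (push E ι ξ p) = b • n p := h.J_radical p hp
  rw [this, map_smul, smul_apply, smul_eq_mul]

lemma mdifferentiableAt_J_xi (h : IsUmbilicalPair j ι S U ξ n b ρ) (hp : p ∈ U) :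
    MDiffAt (alongMk ι (fun q ↦ j.J (ι q) (push E ι ξ q))) p :=
  mdifferentiableAt_J j (h.mdifferentiableAt_push_xi hp)

lemma mdifferentiableAt_smul_J_xi (h : IsUmbilicalPair j ι S U ξ n b ρ) (hp : p ∈ U) :
   
    MDiffAt (alongMk ι ((fun _ : M ↦ b⁻¹) • fun q ↦ j.J (ι q) (push E ι ξ q))) p :=
  MDiffAlong.smul mdifferentiableAt_const (h.mdifferentiableAt_J_xi hp)

lemma mdifferentiableAt_n (h : IsUmbilicalPair j ι S U ξ n b ρ) (hp : p ∈ U) :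
    MDiffAt (alongMk ι n) p :=
  MDiffAlong.congr (h.mdifferentiableAt_smul_J_xi hp) (h.eventually_n_eq hp)

lemma cov_n (h : IsUmbilicalPair j ι S U ξ n b ρ) (hp : p ∈ U)
    (v : TangentSpace 𝓘(ℝ, F) p) : covAlong (leviCivita G) ι n p v =
    b⁻¹ • j.J (ι p) (covAlong (leviCivita G) ι (push E ι ξ) p v) := by
  rw [covAlong_congr (h.mdifferentiableAt_smul_J_xi hp) (h.eventually_n_eq hp),
    covAlong_smul _ mdifferentiableAt_const (h.mdifferentiableAt_J_xi hp), mvfderiv_const,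
    zero_apply, zero_smul, zero_add, covAlong_J j h.isKahler (h.mdifferentiableAt_push_xi hp)]

lemma inner_cov_xi_of_field (h : IsUmbilicalPair j ι S U ξ n b ρ) (hp : p ∈ U)
    (hY : MDiffAt (T% Y) p) (v : TangentSpace 𝓘(ℝ, F) p) :
    G.inner (ι p) (covAlong (leviCivita G) ι (push E ι Y) p v) (push E ι ξ p) =
      - G.inner (ι p) (push E ι Y p) (covAlong (leviCivita G) ι (push E ι ξ) p v) := by
  have h1 := (isLeviCivita_leviCivita G).covAlong_metric
    (mdifferentiableAt_push (h.hypersurface.contMDiff p) hY) (h.mdifferentiableAt_push_xi hp) v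
  have e : (fun q ↦ G.inner (ι q) (push E ι Y q) (push E ι ξ q)) =ᶠ[𝓝 p] fun _ ↦ (0 : ℝ) := by
    filter_upwards [h.pairOn.isOpen.mem_nhds hp] with q hq
    exact (h.pairOn.pair q hq).inner_tangent (Y q)
  have e2 : d% (fun q ↦ G.inner (ι q) (push E ι Y q) (push E ι ξ q)) p = d% (fun _ : M ↦ (0 : ℝ)) p :=
    e.mfderiv_eq
  rw [e2, mvfderiv_const, zero_apply] at h1
  linarith

/-- Differentiating G(Y, ξ) = 0 moves the derivative onto ξ. The expression becomes tensorial in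
`w`, which frees the second fundamental form from the particular extension in its definition. -/
lemma inner_tangent_cov_xi (h : IsUmbilicalPair j ι S U ξ n b ρ) (hp : p ∈ U)
    (v w : TangentSpace 𝓘(ℝ, F) p) :
    G.inner (ι p) (mfderiv 𝓘(ℝ, F) 𝓘(ℝ, E) ι p w) (covAlong (leviCivita G) ι (push E ι ξ) p v) =
      - (ρ * induced G ι p v w) := by
  have h1 := h.inner_cov_xi_of_field hp (Y := FiberBundle.extend F w)
    (FiberBundle.mdifferentiableAt_extend ..) v
  have h2 : G.inner (ι p) (covAlong (leviCivita G) ι (push E ι (FiberBundle.extend F w)) p v)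
    (push E ι ξ p) = _ := h.umbilical p hp v w
  rw [h2] at h1
  have e : push E ι (FiberBundle.extend F w) p = mfderiv 𝓘(ℝ, F) 𝓘(ℝ, E) ι p w := by
    simp [push]
  rw [e] at h1
  linarith

lemma inner_cov_xi (h : IsUmbilicalPair j ι S U ξ n b ρ) (hp : p ∈ U)
    (hY : MDiffAt (T% Y) p) (v : TangentSpace 𝓘(ℝ, F) p) :
    G.inner (ι p) (covAlong (leviCivita G) ι (push E ι Y) p v) (mfderiv 𝓘(ℝ, F) 𝓘(ℝ, E) ι p (ξ p)) =
      ρ * induced G ι p v (Y p) := by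
  have h1 := h.inner_cov_xi_of_field hp hY v
  have h2 := h.inner_tangent_cov_xi hp v (Y p)
  simp only [push] at h1 h2 ⊢
  rw [h1, h2, neg_neg]

/-- Constancy of b = G(Jξ, ξ) enters here: as `J` is parallel and self-adjoint, the derivative of
this function is 2 G(Jξ, ∇̄_v ξ), and `n` is proportional to Jξ. -/
lemma inner_n_cov_xi (h : IsUmbilicalPair j ι S U ξ n b ρ) (hp : p ∈ U)
    (v : TangentSpace 𝓘(ℝ, F) p) :
    G.inner (ι p) (n p) (covAlong (leviCivita G) ι (push E ι ξ) p v) = 0 := by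
  have h1 := (isLeviCivita_leviCivita G).covAlong_metric (h.mdifferentiableAt_J_xi hp)
    (h.mdifferentiableAt_push_xi hp) v
  have e : (fun q ↦ G.inner (ι q) (j.J (ι q) (push E ι ξ q)) (push E ι ξ q)) =ᶠ[𝓝 p]
      fun _ ↦ b := by
    filter_upwards [h.pairOn.isOpen.mem_nhds hp] with q hq
    refine (h.inner_J_tangent hq (ξ q)).trans ?_
    rw [(h.pairOn.pair q hq).pairing, mul_one]
  have e2 : d% (fun q ↦ G.inner (ι q) (j.J (ι q) (push E ι ξ q)) (push E ι ξ q)) p =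
    d% (fun _ : M ↦ b) p := e.mfderiv_eq
  rw [e2, mvfderiv_const, zero_apply, covAlong_J j h.isKahler (h.mdifferentiableAt_push_xi hp),
    j.inner_J, G.symm _ _ (j.J (ι p) (push E ι ξ p))] at h1
  rw [h.n_eq hp, map_smul, smul_apply, smul_eq_mul]
  have : G.inner (ι p) (j.J (ι p) (push E ι ξ p))
    (covAlong (leviCivita G) ι (push E ι ξ) p v) = 0 := by linarith
  rw [this, mul_zero]

/-- Both sides are tested against tangent vectors, by umbilicity, and against `n`, by
`inner_n_cov_xi`; the coefficient of ξ makes the pairing with `n` vanish. -/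
lemma cov_xi (h : IsUmbilicalPair j ι S U ξ n b ρ) (hp : p ∈ U)
    (v : TangentSpace 𝓘(ℝ, F) p) : covAlong (leviCivita G) ι (push E ι ξ) p v =
    (-ρ) • mfderiv 𝓘(ℝ, F) 𝓘(ℝ, E) ι p v +
      (ρ * G.inner (ι p) (n p) (mfderiv 𝓘(ℝ, F) 𝓘(ℝ, E) ι p v)) • push E ι ξ p := by
  have hn := h.pairOn.pair p hp
  refine hn.eq_of_inner h.hypersurface (fun w ↦ ?_) ?_
  · have h1 : G.inner (ι p) (push E ι ξ p) (mfderiv 𝓘(ℝ, F) 𝓘(ℝ, E) ι p w) = 0 :=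
      hn.mem_radical w
    rw [G.symm, h.inner_tangent_cov_xi hp, map_add, map_smul, map_smul, add_apply, smul_apply,
      smul_apply, h1, induced]
    simp
  · have h1 : G.inner (ι p) (n p) (push E ι ξ p) = 1 := hn.pairing
    rw [G.symm, h.inner_n_cov_xi hp, G.symm, map_add, map_smul, map_smul, h1]
    simp

lemma cov_cov_xi (h : IsUmbilicalPair j ι S U ξ n b ρ) (hp : p ∈ U)
    (hY : MDiffAt (T% Y) p) (v : TangentSpace 𝓘(ℝ, F) p) :
    covAlong (leviCivita G) ι (fun q ↦ covAlong (leviCivita G) ι (push E ι ξ) q (Y q)) p v =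
      (-ρ) • covAlong (leviCivita G) ι (push E ι Y) p v +
      ((ρ * (G.inner (ι p) (covAlong (leviCivita G) ι n p v) (push E ι Y p) +
        G.inner (ι p) (n p) (covAlong (leviCivita G) ι (push E ι Y) p v))) • push E ι ξ p +
      (ρ * G.inner (ι p) (n p) (push E ι Y p)) • covAlong (leviCivita G) ι (push E ι ξ) p v) := by
  have hY' := mdifferentiableAt_push (E := E) (h.hypersurface.contMDiff p) hY
  have hξ := h.mdifferentiableAt_push_xi hp
  have hη : MDiffAt (fun q ↦ G.inner (ι q) (n q) (push E ι Y q)) p := by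
    have hg := (G.contMDiff (ι p)).mdifferentiableAt (by simp)
    have : MDifferentiableAt 𝓘(ℝ, F) (𝓘(ℝ, E).prod 𝓘(ℝ))
      (fun m ↦ TotalSpace.mk' ℝ (E := Bundle.Trivial N ℝ) (ι m)
        (G.inner (ι m) (n m) (push E ι Y m))) p :=
      MDifferentiableAt.clm_bundle_apply₂ (F₁ := E) (F₂ := E)
        (hg.comp p (mdifferentiableAt_along_base hY')) (h.mdifferentiableAt_n hp) hY'
    exact ((mdifferentiableAt_totalSpace ..).1 this).2
  have hf : MDiffAt (fun q ↦ ρ * G.inner (ι q) (n q) (push E ι Y q)) p :=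
    mdifferentiableAt_const.mul hη
  have hc : MDiffAt (fun _ : M ↦ -ρ) p := mdifferentiableAt_const
  have e : ∀ᶠ q in 𝓝 p, covAlong (leviCivita G) ι (push E ι ξ) q (Y q) =
      ((fun _ : M ↦ -ρ) • push E ι Y +
        (fun q : M ↦ ρ * G.inner (ι q) (n q) (push E ι Y q)) • push E ι ξ) q := by
    filter_upwards [h.pairOn.isOpen.mem_nhds hp] with q hq using h.cov_xi hq (Y q)
  have hd : d% (fun q ↦ ρ * G.inner (ι q) (n q) (push E ι Y q)) p v =
      ρ * (G.inner (ι p) (covAlong (leviCivita G) ι n p v) (push E ι Y p) +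
        G.inner (ι p) (n p) (covAlong (leviCivita G) ι (push E ι Y) p v)) := by
    rw [← (isLeviCivita_leviCivita G).covAlong_metric (h.mdifferentiableAt_n hp) hY',
      mvfderiv_fun_mul mdifferentiableAt_const hη, mvfderiv_const]
    simp
  rw [covAlong_congr (MDiffAlong.add (MDiffAlong.smul hc hY') (MDiffAlong.smul hf hξ)) e,
    covAlong_add _ (MDiffAlong.smul hc hY') (MDiffAlong.smul hf hξ), covAlong_smul _ hc hY',
    covAlong_smul _ hf hξ, hd, mvfderiv_const, zero_apply, zero_smul, zero_add]

lemma inner_cov_n (h : IsUmbilicalPair j ι S U ξ n b ρ) (hp : p ∈ U)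
    (v w : TangentSpace 𝓘(ℝ, F) p) :
    G.inner (ι p) (covAlong (leviCivita G) ι n p v) (mfderiv 𝓘(ℝ, F) 𝓘(ℝ, E) ι p w) =
      -(b⁻¹ * ρ) * G.inner (ι p) (j.J (ι p) (mfderiv 𝓘(ℝ, F) 𝓘(ℝ, E) ι p v))
        (mfderiv 𝓘(ℝ, F) 𝓘(ℝ, E) ι p w) + ρ * G.inner (ι p) (n p) (mfderiv 𝓘(ℝ, F) 𝓘(ℝ, E) ι p v) *
        G.inner (ι p) (n p) (mfderiv 𝓘(ℝ, F) 𝓘(ℝ, E) ι p w) := by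
  have hb := h.b_ne_zero hp
  rw [h.cov_n hp, h.cov_xi hp]
  simp only [map_add, map_smul, add_apply, smul_apply, h.inner_J_tangent hp, smul_eq_mul]
  field_simp

/-- Derivative of `cov_xi` with ρ constant. The bracket terms cancel by vanishing torsion, and the
derivative of η contributes G(∇̄_X N, Y), which is symmetric in X and Y. -/
lemma curvature_xi (h : IsUmbilicalPair j ι S U ξ n b ρ) (hp : p ∈ U)
    (x y : TangentSpace 𝓘(ℝ, F) p) :
    curvatureForm (leviCivita G) (ι p) (mfderiv 𝓘(ℝ, F) 𝓘(ℝ, E) ι p x)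
      (mfderiv 𝓘(ℝ, F) 𝓘(ℝ, E) ι p y) (push E ι ξ p) =
    (ρ ^ 2 * G.inner (ι p) (n p) (mfderiv 𝓘(ℝ, F) 𝓘(ℝ, E) ι p x)) •
      mfderiv 𝓘(ℝ, F) 𝓘(ℝ, E) ι p y -
    (ρ ^ 2 * G.inner (ι p) (n p) (mfderiv 𝓘(ℝ, F) 𝓘(ℝ, E) ι p y)) •
      mfderiv 𝓘(ℝ, F) 𝓘(ℝ, E) ι p x := by
  set X : Π q : M, TangentSpace 𝓘(ℝ, F) q := FiberBundle.extend F x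
  set Y : Π q : M, TangentSpace 𝓘(ℝ, F) q := FiberBundle.extend F y
  have hX : CMDiffAt 1 (T% X) p := FiberBundle.contMDiffAt_extend 𝓘(ℝ, F) F x
  have hY : CMDiffAt 1 (T% Y) p := FiberBundle.contMDiffAt_extend 𝓘(ℝ, F) F y
  have hXd : MDiffAt (T% X) p := hX.mdifferentiableAt one_ne_zero
  have hYd : MDiffAt (T% Y) p := hY.mdifferentiableAt one_ne_zero
  have hι := h.hypersurface.contMDiff p
  have hL := isLeviCivita_leviCivita G
  have hW : CMDiffAt 2 (alongMk ι (push E ι ξ)) p :=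
    (contMDiffAt_push (n := ⊤) hι (h.contMDiffAt_xi hp)).of_le
      (WithTop.coe_le_coe.2 (le_top : (2 : ℕ∞) ≤ ⊤))
  have hR := hL.covAlong_curvature hι hW hX hY
  have eX : X p = x := by simp [X]
  have eY : Y p = y := by simp [Y]
  have ht := hL.covAlong_torsion hι hXd hYd
  have epX : push E ι X p = mfderiv 𝓘(ℝ, F) 𝓘(ℝ, E) ι p x := by rw [push, eX]
  have epY : push E ι Y p = mfderiv 𝓘(ℝ, F) 𝓘(ℝ, E) ι p y := by rw [push, eY]
  rw [h.cov_cov_xi hp hXd, h.cov_cov_xi hp hYd, h.cov_xi hp (VectorField.mlieBracket 𝓘(ℝ, F) X Y p),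
    ← ht, epX, epY, eX, eY, h.inner_cov_n hp, h.inner_cov_n hp, h.cov_xi hp, h.cov_xi hp] at hR
  rw [← hR]
  -- Symmetry of g̃ removes the coefficient of ξ that comes from `inner_cov_n`.
  have hs : G.inner (ι p) (j.J (ι p) (mfderiv 𝓘(ℝ, F) 𝓘(ℝ, E) ι p y))
      (mfderiv 𝓘(ℝ, F) 𝓘(ℝ, E) ι p x) = G.inner (ι p) (j.J (ι p) (mfderiv 𝓘(ℝ, F) 𝓘(ℝ, E) ι p x))
      (mfderiv 𝓘(ℝ, F) 𝓘(ℝ, E) ι p y) := by rw [j.inner_J, G.symm]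
  rw [hs]
  simp only [map_sub]
  module

end IsUmbilicalPair

/-! ### The ambient curvature and its two coefficient functions. -/

/-- The curvature tensor of a Kähler-Norden metric of constant totally real sectional curvatures. -/
def NordenStructure.HasCurvatureForm (j : NordenStructure G) (ν κ : N → ℝ) : Prop :=
  ∀ (x : N) (u v w : TangentSpace 𝓘(ℝ, E) x), curvatureForm (leviCivita G) x u v w =
    ν x • (G.inner x v w • u - G.inner x (j.J x v) w • j.J x u - G.inner x u w • v +
      G.inner x (j.J x u) w • j.J x v) +
    κ x • (G.inner x v w • j.J x u + G.inner x (j.J x v) w • u - G.inner x u w • j.J x v -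
      G.inner x (j.J x u) w • v)

lemma exists_notMem_span_pair {V : Type*} [AddCommGroup V] [Module ℝ V] [FiniteDimensional ℝ V]
    (h : 3 ≤ finrank ℝ V) (x y : V) : ∃ u, ∀ a b : ℝ, u ≠ a • x + b • y := by
  classical
  by_contra! hc
  have htop : Submodule.span ℝ {x, y} = ⊤ := by
    rw [eq_top_iff]
    intro u _
    obtain ⟨a, b, rfl⟩ := hc u
    exact Submodule.mem_span_pair.2 ⟨a, b, rfl⟩
  have h1 := finrank_span_finset_le_card (R := ℝ) ({x, y} : Finset V)
  have h2 : ({x, y} : Finset V).card ≤ 2 := Finset.card_le_two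
  have h3 : Set.finrank ℝ ({x, y} : Set V) = finrank ℝ V := by rw [Set.finrank, htop, finrank_top]
  rw [Finset.coe_insert, Finset.coe_singleton, h3] at h1
  omega

theorem NordenStructure.HasConstantTotallyRealCurvatures.hasCurvatureForm {j : NordenStructure G}
    {ν ν' : N → ℝ} (hν : j.HasConstantTotallyRealCurvatures ν ν') (hK : j.IsKahler)
    (hE : 4 ≤ finrank ℝ E) : j.HasCurvatureForm ν (-ν') := by
  intro x
  have : FiniteDimensional ℝ (TangentSpace 𝓘(ℝ, E) x) := inferInstanceAs (FiniteDimensional ℝ E)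
  have hL := isLeviCivita_leviCivita G
  have hR : IsKahlerCurvature (V := TangentSpace 𝓘(ℝ, E) x)
      (ContinuousLinearMap.coeLM ℝ ∘ₗ (G.inner x).toLinearMap) (j.J x).toLinearMap
      (curvatureTensor (leviCivita G) x) :=
    { symm := G.symm x
      nondegenerate := G.nondegenerate x
      sq := j.sq x
      anti_isometry := j.anti_isometry x
      skew := curvatureForm_skew x
      metric := hL.inner_curvatureForm_self x
      bianchi := hL.curvatureForm_bianchi x
      parallel := hL.curvatureForm_J j hK x }
  -- For an orthonormal pair π₁(u, v, v, u) = 1, so the quotients in the hypothesis are the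
  -- curvature values themselves; the sign convention of the algebraic theorem gives κ = -ν'.
  refine hR.eq_of_totallyReal (fun v ↦ exists_notMem_span_pair (show 3 ≤ finrank ℝ E by omega) _ _)
    (κ := -ν' x) fun u v hu hv huv hJu hJuv hJv ↦ ?_
  change G.inner x u u = 1 at hu
  change G.inner x v v = 1 at hv
  change G.inner x u v = 0 at huv
  change G.inner x (j.J x u) u = 0 at hJu
  change G.inner x (j.J x u) v = 0 at hJuv
  change G.inner x (j.J x v) v = 0 at hJv
  have hpi : piOne G x u v v u = 1 := by simp [piOne, hu, hv, huv]
  have hJvu : G.inner x (j.J x v) u = 0 := by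
    have := j.anti_isometry x u (j.J x v)
    rw [j.sq, map_neg, hJuv, G.symm] at this
    linarith
  have h := hν x u v (by simp [hpi]) (by
    intro y hy z hz
    obtain ⟨a, b, rfl⟩ := Submodule.mem_span_pair.1 hy
    obtain ⟨c, d, rfl⟩ := Submodule.mem_span_pair.1 hz
    simp [hJu, hJuv, hJv, hJvu])
  rw [hpi, div_one, div_one, riemann, riemann, hL.curvature_eq] at h
  exact ⟨h.1, h.2.trans (neg_neg _).symm⟩

/-! ### Passage to the associated metric. -/

section Associated

/-- The associated metric is a Norden metric for the same almost complex structure. -/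
def NordenStructure.associatedStructure (j : NordenStructure G) : NordenStructure j.associated where
  J := j.J
  sq := j.sq
  anti_isometry x v w := j.anti_isometry x (j.J x v) w
  contMDiff := j.contMDiff

lemma NordenStructure.IsKahler.associated {j : NordenStructure G} (hK : j.IsKahler) :
    j.associatedStructure.IsKahler := by
  intro x Y v hY
  have h1 := hK.isLeviCivita_associated
  have h2 := isLeviCivita_leviCivita j.associated
  have hJY : MDiffAt (T% (fun y ↦ j.J y (Y y))) x := mdifferentiableAt_J (ι := id) j hY
  exact (h2.cov_eq h1 hJY v).trans
    ((hK x Y v hY).trans (congrArg (j.J x) (h2.cov_eq h1 hY v).symm))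

/-- The complex bilinear form of the associated metric is iH, so the complex coefficient ν + iκ is
multiplied by -i, giving κ - iν. The connection, hence the curvature, does not change. -/
lemma NordenStructure.HasCurvatureForm.associated {j : NordenStructure G} {ν κ : N → ℝ}
    (h : j.HasCurvatureForm ν κ) (hK : j.IsKahler) :
    j.associatedStructure.HasCurvatureForm κ (-ν) := by
  intro x u v w
  rw [(isLeviCivita_leviCivita j.associated).curvatureForm_eq hK.isLeviCivita_associated, h]
  have e (a b : TangentSpace 𝓘(ℝ, E) x) : j.associated.inner x a b = G.inner x (j.J x a) b := rfl
  have e2 : j.associatedStructure.J = j.J := rfl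
  simp only [e, e2, j.sq, map_neg, neg_apply, Pi.neg_apply]
  module

end Associated

/-! ### The Gauss equation. -/

namespace IsUmbilicalPair

variable {j : NordenStructure G} {S : Π p : M, Submodule ℝ (TangentSpace 𝓘(ℝ, F) p)} {U : Set M}
    {ξ : Π p : M, TangentSpace 𝓘(ℝ, F) p} {n : Π p : M, TangentSpace 𝓘(ℝ, E) (ι p)} {b ρ : ℝ}
    {Y Z : Π p : M, TangentSpace 𝓘(ℝ, F) p} {ν κ : N → ℝ}

/-- Both expressions for R̄(x, ξ)ξ are multiples of u - aξ and of its image under `J`. Since `J` has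
no real eigenvector, the two coefficients κb + ρ² and νb must vanish. -/
lemma curvature_coefficients (h : IsUmbilicalPair j ι S U ξ n b ρ) (hp : p ∈ U)
    (hR : j.HasCurvatureForm ν κ) (hF : 3 ≤ finrank ℝ F) :
    ν (ι p) = 0 ∧ κ (ι p) = - (ρ ^ 2 * b⁻¹) := by
  have hb := h.b_ne_zero hp
  have hn := h.pairOn.pair p hp
  obtain ⟨x, hx⟩ : ∃ x : TangentSpace 𝓘(ℝ, F) p, ∀ a b : ℝ, x ≠ a • ξ p + b • 0 :=
    exists_notMem_span_pair (V := F) hF (ξ p) 0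
  set a := G.inner (ι p) (n p) (mfderiv 𝓘(ℝ, F) 𝓘(ℝ, E) ι p x)
  set u := mfderiv 𝓘(ℝ, F) 𝓘(ℝ, E) ι p x
  set Ξ := mfderiv 𝓘(ℝ, F) 𝓘(ℝ, E) ι p (ξ p)
  have hu : u - a • Ξ ≠ 0 := by
    intro h0
    refine hx a 0 (h.hypersurface.injective p ?_)
    rw [smul_zero, add_zero, map_smul]
    exact sub_eq_zero.1 h0
  have h1 := h.curvature_xi hp x (ξ p)
  have e1 : G.inner (ι p) Ξ Ξ = 0 := hn.inner_tangent _
  have e2 : G.inner (ι p) u Ξ = 0 := hn.inner_tangent _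
  have e3 : G.inner (ι p) (j.J (ι p) Ξ) Ξ = b :=
    (h.inner_J_tangent hp (ξ p)).trans (by rw [hn.pairing, mul_one])
  have e4 : G.inner (ι p) (j.J (ι p) u) Ξ = b * a := by
    rw [j.inner_J, G.symm]
    exact h.inner_J_tangent hp x
  have e5 : push E ι ξ p = Ξ := rfl
  rw [hR, e5, e1, e2, e3, e4, hn.pairing] at h1
  set k := κ (ι p) * b + ρ ^ 2
  have h2 : k • (u - a • Ξ) - (ν (ι p) * b) • j.J (ι p) (u - a • Ξ) = 0 := by
    rw [map_sub, map_smul]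
    rw [← sub_eq_zero] at h1
    rw [← h1]
    simp only [k]
    module
  have h3 : k • j.J (ι p) (u - a • Ξ) + (ν (ι p) * b) • (u - a • Ξ) = 0 := by
    have := congrArg (j.J (ι p)) h2
    rw [map_sub, map_smul, map_smul, j.sq, map_zero] at this
    rw [← this]
    module
  -- Multiplication of `h2` by the complex conjugate of its coefficient k - iνb.
  have h4 : (k ^ 2 + (ν (ι p) * b) ^ 2) • (u - a • Ξ) = 0 := by
    have : (k ^ 2 + (ν (ι p) * b) ^ 2) • (u - a • Ξ) =
        k • (k • (u - a • Ξ) - (ν (ι p) * b) • j.J (ι p) (u - a • Ξ)) +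
        (ν (ι p) * b) • (k • j.J (ι p) (u - a • Ξ) + (ν (ι p) * b) • (u - a • Ξ)) := by module
    rw [this, h2, h3, smul_zero, smul_zero, add_zero]
  have h5 := (smul_eq_zero.1 h4).resolve_right hu
  have hk : k = 0 := by nlinarith [sq_nonneg k, sq_nonneg (ν (ι p) * b)]
  have hνb : ν (ι p) * b = 0 := by nlinarith [sq_nonneg k, sq_nonneg (ν (ι p) * b)]
  refine ⟨(mul_eq_zero.1 hνb).resolve_right hb, ?_⟩
  field_simp
  simp only [k] at hk
  linarith

lemma inducedConnection_spec (h : IsUmbilicalPair j ι S U ξ n b ρ) (hp : p ∈ U)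
    (Y : Π p : M, TangentSpace 𝓘(ℝ, F) p) (v : TangentSpace 𝓘(ℝ, F) p) :
    covAlong (leviCivita G) ι (push E ι Y) p v =
      mfderiv 𝓘(ℝ, F) 𝓘(ℝ, E) ι p (inducedConnection G ι S Y p v) +
      G.inner (ι p) (covAlong (leviCivita G) ι (push E ι Y) p v)
        (mfderiv 𝓘(ℝ, F) 𝓘(ℝ, E) ι p (ξ p)) • n p :=
  (h.pairOn.pair p hp).inducedConnection_spec h.hypersurface h.screen Y v

lemma gauss_formula (h : IsUmbilicalPair j ι S U ξ n b ρ) (hp : p ∈ U)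
    (hY : MDiffAt (T% Y) p) (v : TangentSpace 𝓘(ℝ, F) p) :
    mfderiv 𝓘(ℝ, F) 𝓘(ℝ, E) ι p (inducedConnection G ι S Y p v) =
      covAlong (leviCivita G) ι (push E ι Y) p v + (-(ρ * induced G ι p v (Y p))) • n p := by
  have := h.inducedConnection_spec hp Y v
  rw [h.inner_cov_xi hp hY] at this
  rw [this, neg_smul, add_neg_cancel_right]

lemma cov_n_eq (h : IsUmbilicalPair j ι S U ξ n b ρ) (hp : p ∈ U) (v : TangentSpace 𝓘(ℝ, F) p) :
    covAlong (leviCivita G) ι n p v =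
      (-(ρ * b⁻¹)) • j.J (ι p) (mfderiv 𝓘(ℝ, F) 𝓘(ℝ, E) ι p v) +
      (ρ * G.inner (ι p) (n p) (mfderiv 𝓘(ℝ, F) 𝓘(ℝ, E) ι p v)) • n p := by
  have e : j.J (ι p) (push E ι ξ p) = b • n p := h.J_radical p hp
  have hb := h.b_ne_zero hp
  rw [h.cov_n hp, h.cov_xi hp, map_add, map_smul, map_smul, e, smul_add, smul_smul, smul_smul,
    smul_smul]
  congr 2
  · ring
  · field_simp

/-- The multiple of `n`, which contains the derivatives of B(Y, Z), is left unspecified because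
`eq_of_tangent` discards it. -/
lemma exists_gauss_second (h : IsUmbilicalPair j ι S U ξ n b ρ) (hp : p ∈ U)
    (hY : CMDiffAt 1 (T% Y) p) (hZ : CMDiffAt 2 (T% Z) p) (v : TangentSpace 𝓘(ℝ, F) p) :
    ∃ c : ℝ, mfderiv 𝓘(ℝ, F) 𝓘(ℝ, E) ι p
      (inducedConnection G ι S (fun q ↦ inducedConnection G ι S Z q (Y q)) p v) =
      covAlong (leviCivita G) ι (fun q ↦ covAlong (leviCivita G) ι (push E ι Z) q (Y q)) p v -
      (ρ * induced G ι p (Y p) (Z p)) • covAlong (leviCivita G) ι n p v + c • n p := by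
  have hL := isLeviCivita_leviCivita G
  have hι := h.hypersurface.contMDiff p
  have hZp : CMDiffAt 2 (alongMk ι (push E ι Z)) p := contMDiffAt_push (n := 2) hι hZ
  have hYp : CMDiffAt 1 (alongMk ι (push E ι Y)) p := contMDiffAt_push (n := 1) hι hY
  have hD : MDiffAt (alongMk ι (fun q ↦ covAlong (leviCivita G) ι (push E ι Z) q (Y q))) p :=
    (hL.contMDiffAt_covAlong (n := 1) (m := 2) (by norm_num) hι hZp hY).mdifferentiableAt one_ne_zero
  have hf : MDiffAt (fun q ↦ -(ρ * induced G ι q (Y q) (Z q))) p := by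
    have : MDiffAt (fun q ↦ induced G ι q (Y q) (Z q)) p :=
      (contMDiffAt_inner (n := 1) hYp (hZp.of_le (by norm_num))).mdifferentiableAt one_ne_zero
    exact (mdifferentiableAt_const.mul this).neg
  have hn := h.mdifferentiableAt_n hp
  set V : Π q : M, TangentSpace 𝓘(ℝ, F) q := fun q ↦ inducedConnection G ι S Z q (Y q)
  have hZev : ∀ᶠ q in 𝓝 p, MDiffAt (T% Z) q :=
    ContMDiffAt.eventually_mdifferentiableAt_along (ι := (id : M → M)) (n := 2) (by norm_num) hZ
  have e : ∀ᶠ q in 𝓝 p, push E ι V q =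
      ((fun q ↦ covAlong (leviCivita G) ι (push E ι Z) q (Y q)) +
        (fun q ↦ -(ρ * induced G ι q (Y q) (Z q))) • n) q := by
    filter_upwards [h.pairOn.isOpen.mem_nhds hp, hZev] with q hq hq'
    exact h.gauss_formula hq hq' (Y q)
  have h1 := covAlong_congr (cov := leviCivita G) (MDiffAlong.add hD (MDiffAlong.smul hf hn)) e v
  rw [covAlong_add _ hD (MDiffAlong.smul hf hn), covAlong_smul _ hf hn] at h1
  have h2 := h.inducedConnection_spec hp V v
  set c' := G.inner (ι p) (covAlong (leviCivita G) ι (push E ι V) p v)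
    (mfderiv 𝓘(ℝ, F) 𝓘(ℝ, E) ι p (ξ p))
  rw [h1] at h2
  refine ⟨d% (fun q ↦ -(ρ * induced G ι q (Y q) (Z q))) p v - c', ?_⟩
  rw [eq_sub_of_add_eq h2.symm]
  module

/-- The term -ρ G(y,z) ∇̄_x N contributes (ρ²/b) G(y,z) Jx, which cancels κ G(y,z) Jx in the ambient
curvature since κ = -ρ²/b; likewise with x and y exchanged. Only the g̃-terms remain, and they are
tangent. -/
theorem curvature_inducedConnection (h : IsUmbilicalPair j ι S U ξ n b ρ) (hp : p ∈ U)
    (hR : j.HasCurvatureForm ν κ) (hF : 3 ≤ finrank ℝ F) (x y z : TangentSpace 𝓘(ℝ, F) p) :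
    curvature (inducedConnection G ι S) p x y z = (-(ρ ^ 2 * b⁻¹)) •
      (induced j.associated ι p y z • x - induced j.associated ι p x z • y) := by
  have hn := h.pairOn.pair p hp
  obtain ⟨hν, hκ⟩ := h.curvature_coefficients hp hR hF
  set X : Π q : M, TangentSpace 𝓘(ℝ, F) q := FiberBundle.extend F x with hXdef
  set Y : Π q : M, TangentSpace 𝓘(ℝ, F) q := FiberBundle.extend F y with hYdef
  set Z : Π q : M, TangentSpace 𝓘(ℝ, F) q := FiberBundle.extend F z with hZdef
  have hX : CMDiffAt 1 (T% X) p := FiberBundle.contMDiffAt_extend 𝓘(ℝ, F) F x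
  have hY : CMDiffAt 1 (T% Y) p := FiberBundle.contMDiffAt_extend 𝓘(ℝ, F) F y
  have hZ : CMDiffAt 2 (T% Z) p := FiberBundle.contMDiffAt_extend 𝓘(ℝ, F) F z
  have eX : X p = x := by simp [X]
  have eY : Y p = y := by simp [Y]
  have eZ : Z p = z := by simp [Z]
  have hι := h.hypersurface.contMDiff p
  have hc := (isLeviCivita_leviCivita G).covAlong_curvature hι (contMDiffAt_push (n := 2) hι hZ)
    hX hY
  obtain ⟨c₁, h1⟩ := h.exists_gauss_second hp hY hZ (X p)
  obtain ⟨c₂, h2⟩ := h.exists_gauss_second hp hX hZ (Y p)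
  have h3 := h.gauss_formula hp (hZ.mdifferentiableAt two_ne_zero)
    (VectorField.mlieBracket 𝓘(ℝ, F) X Y p)
  rw [hR, hν, hκ, zero_smul, zero_add] at hc
  simp only [push] at hc
  have hcurv : mfderiv 𝓘(ℝ, F) 𝓘(ℝ, E) ι p (curvature (inducedConnection G ι S) p x y z) =
      mfderiv 𝓘(ℝ, F) 𝓘(ℝ, E) ι p
        (inducedConnection G ι S (fun q ↦ inducedConnection G ι S Z q (Y q)) p (X p)) -
      mfderiv 𝓘(ℝ, F) 𝓘(ℝ, E) ι p
        (inducedConnection G ι S (fun q ↦ inducedConnection G ι S Z q (X q)) p (Y p)) -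
      mfderiv 𝓘(ℝ, F) 𝓘(ℝ, E) ι p
        (inducedConnection G ι S Z p (VectorField.mlieBracket 𝓘(ℝ, F) X Y p)) := by
    rw [← map_sub, ← map_sub]
    rfl
  rw [h1, h2, h3, h.cov_n_eq hp, h.cov_n_eq hp] at hcurv
  simp only [eX, eY, eZ] at hc hcurv
  have hc' := eq_add_of_sub_eq (eq_add_of_sub_eq hc)
  refine hn.eq_of_tangent h.hypersurface (c := - (ρ * induced G ι p y z) *
    (ρ * G.inner (ι p) (n p) (mfderiv 𝓘(ℝ, F) 𝓘(ℝ, E) ι p x)) + (ρ * induced G ι p x z) *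
    (ρ * G.inner (ι p) (n p) (mfderiv 𝓘(ℝ, F) 𝓘(ℝ, E) ι p y)) + c₁ - c₂ +
    ρ * induced G ι p (VectorField.mlieBracket 𝓘(ℝ, F) X Y p) z) ?_
  have e (v w : TangentSpace 𝓘(ℝ, F) p) : induced j.associated ι p v w = G.inner (ι p)
    (j.J (ι p) (mfderiv 𝓘(ℝ, F) 𝓘(ℝ, E) ι p v)) (mfderiv 𝓘(ℝ, F) 𝓘(ℝ, E) ι p w) := rfl
  have e' : covAlong (leviCivita G) ι (fun q ↦ covAlong (leviCivita G) ι (push E ι Z) q (Y q)) p x =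
    _ := hc'
  have e'' : covAlong (leviCivita G) ι (push E ι Z) p (VectorField.mlieBracket 𝓘(ℝ, F) X Y p) =
    covAlong (leviCivita G) ι (fun q ↦ mfderiv 𝓘(ℝ, F) 𝓘(ℝ, E) ι q (Z q)) p
      (VectorField.mlieBracket 𝓘(ℝ, F) X Y p) := rfl
  have e₃ : covAlong (leviCivita G) ι (fun q ↦ covAlong (leviCivita G) ι (push E ι Z) q (X q)) p y =
    covAlong (leviCivita G) ι (fun q ↦ covAlong (leviCivita G) ι (fun q ↦
      mfderiv 𝓘(ℝ, F) 𝓘(ℝ, E) ι q (Z q)) q (X q)) p y := rfl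
  rw [hcurv, e', e'', e₃, map_smul, map_sub, map_smul, map_smul, e, e]
  simp only [induced]
  module

end IsUmbilicalPair

/-! ### Consequences of constant curvature with respect to a symmetric form. -/

section Intrinsic

lemma induced_symm (v w : TangentSpace 𝓘(ℝ, F) p) : induced G ι p v w = induced G ι p w v :=
  G.symm _ _ _

lemma induced_sub_left (v v' w : TangentSpace 𝓘(ℝ, F) p) :
    induced G ι p (v - v') w = induced G ι p v w - induced G ι p v' w := by simp [induced]

lemma induced_smul_left (c : ℝ) (v w : TangentSpace 𝓘(ℝ, F) p) :
    induced G ι p (c • v) w = c * induced G ι p v w := by simp [induced]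

variable {D : (Π p : M, TangentSpace 𝓘(ℝ, F) p) → Π p : M,
      TangentSpace 𝓘(ℝ, F) p → TangentSpace 𝓘(ℝ, F) p} {c : ℝ}

/-- R(x,y) is skew for the form, so as a derivation it annihilates the form and hence R, which is
built from it. -/
lemma isSemiSymmetric_of_curvature (hR : ∀ (p : M) (x y z : TangentSpace 𝓘(ℝ, F) p),
      curvature D p x y z = c • (induced G ι p y z • x - induced G ι p x z • y)) :
    IsSemiSymmetric D := by
  intro p x y u v w
  have hr (v a b : TangentSpace 𝓘(ℝ, F) p) : induced G ι p v (a - b) =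
      induced G ι p v a - induced G ι p v b := by simp [induced]
  have hs (r : ℝ) (v a : TangentSpace 𝓘(ℝ, F) p) : induced G ι p v (r • a) =
      r * induced G ι p v a := by simp [induced]
  simp only [hR, induced_sub_left, induced_smul_left, hr, hs]
  rw [induced_symm y u, induced_symm y v, induced_symm x u, induced_symm x v]
  module

/-- The trace runs over the second argument: its first term contributes the form once, the second
the trace of the identity, that is, dim M times. -/
lemma ricci_eq_of_curvature (hR : ∀ (p : M) (x y z : TangentSpace 𝓘(ℝ, F) p),
      curvature D p x y z = c • (induced G ι p y z • x - induced G ι p x z • y)) (p : M)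
    (u v : TangentSpace 𝓘(ℝ, F) p) :
    ricci D p u v = c * (1 - finrank ℝ F) * induced G ι p u v := by
  let e : Basis (Fin (finrank ℝ F)) ℝ (TangentSpace 𝓘(ℝ, F) p) := finBasis ℝ F
  have h1 : ricci D p u v = ∑ i, e.repr (curvature D p u (e i) v) i := rfl
  have h2 : ∑ i, e.repr u i * induced G ι p (e i) v = induced G ι p u v := by
    have := congrArg (fun w ↦ induced G ι p w v) (e.sum_repr u)
    simp only [induced, map_sum, map_smul, sum_apply, smul_apply, smul_eq_mul] at this
    exact this
  simp only [h1, hR, map_smul, map_sub, Finsupp.smul_apply, Finsupp.sub_apply, e.repr_self,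
    Finsupp.single_eq_same, smul_eq_mul, mul_one]
  rw [← Finset.mul_sum, Finset.sum_sub_distrib, Finset.sum_const, Finset.card_univ, Fintype.card_fin,
    nsmul_eq_mul, ← h2]
  simp only [mul_comm (induced G ι p (e _) v), h2]
  ring

lemma isRicciSemiSymmetric_of_curvature (hR : ∀ (p : M) (x y z : TangentSpace 𝓘(ℝ, F) p),
      curvature D p x y z = c • (induced G ι p y z • x - induced G ι p x z • y)) :
    IsRicciSemiSymmetric D := by
  intro p x y u v
  have h1 := ricci_eq_of_curvature hR p (curvature D p x y u) v
  have h2 := ricci_eq_of_curvature hR p u (curvature D p x y v)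
  rw [induced_symm] at h2
  rw [h1, h2, hR, hR]
  simp only [induced_sub_left, induced_smul_left]
  rw [induced_symm y u, induced_symm x u]
  ring

end Intrinsic

/-! ### Parallelism of the associated form on M. -/

namespace IsUmbilicalPair

variable {j : NordenStructure G} {S : Π p : M, Submodule ℝ (TangentSpace 𝓘(ℝ, F) p)} {U : Set M}
    {ξ : Π p : M, TangentSpace 𝓘(ℝ, F) p} {n : Π p : M, TangentSpace 𝓘(ℝ, E) (ι p)} {b ρ : ℝ}
    {X Y Z : Π p : M, TangentSpace 𝓘(ℝ, F) p}

/-- The ambient g̃ is parallel, and the transversal parts drop out because Jn is a multiple of ξ,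
which is G-orthogonal to M. For G itself this would fail: there the transversal parts contribute B.
-/
lemma mvfderiv_induced_associated (h : IsUmbilicalPair j ι S U ξ n b ρ) (hp : p ∈ U)
    (hY : MDiffAt (T% Y) p) (hZ : MDiffAt (T% Z) p) (v : TangentSpace 𝓘(ℝ, F) p) :
    d% (fun q ↦ induced j.associated ι q (Y q) (Z q)) p v =
      induced j.associated ι p (inducedConnection G ι S Y p v) (Z p) +
      induced j.associated ι p (Y p) (inducedConnection G ι S Z p v) := by
  have hι := h.hypersurface.contMDiff p
  have hY' := mdifferentiableAt_push (E := E) hι hY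
  have hZ' := mdifferentiableAt_push (E := E) hι hZ
  have h1 := (isLeviCivita_leviCivita G).covAlong_metric (mdifferentiableAt_J j hY') hZ' v
  rw [covAlong_J j h.isKahler hY', h.inducedConnection_spec hp Y, h.inducedConnection_spec hp Z,
    map_add, map_smul, map_add, map_add, map_smul, map_smul, add_apply, smul_apply, h.J_n hp,
    j.inner_J _ (push E ι Y p) (n p), h.J_n hp, map_neg, map_neg, map_smul, map_smul, neg_apply,
    smul_apply] at h1
  have hn := h.pairOn.pair p hp
  have e1 : G.inner (ι p) (push E ι ξ p) (push E ι Z p) = 0 := hn.mem_radical _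
  have e2 : G.inner (ι p) (push E ι Y p) (push E ι ξ p) = 0 := hn.inner_tangent _
  rw [e1, e2] at h1
  simp only [smul_zero, neg_zero, add_zero] at h1
  exact h1

/-- Leibniz rule in the shape of the curvature formula. The induced connection is defined by choice,
so the rule is obtained from the ambient one and compared modulo `n`. -/
lemma inducedConnection_smul_sub_smul (h : IsUmbilicalPair j ι S U ξ n b ρ) (hp : p ∈ U)
    (hX : MDiffAt (T% X) p) (hY : MDiffAt (T% Y) p) {f₁ f₂ : M → ℝ} (hf₁ : MDiffAt f₁ p)
    (hf₂ : MDiffAt f₂ p) (c : ℝ) (v : TangentSpace 𝓘(ℝ, F) p) :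
    inducedConnection G ι S (fun q ↦ c • (f₁ q • X q - f₂ q • Y q)) p v =
      c • (d% f₁ p v • X p + f₁ p • inducedConnection G ι S X p v -
        (d% f₂ p v • Y p + f₂ p • inducedConnection G ι S Y p v)) := by
  have hι := h.hypersurface.contMDiff p
  have hX' := mdifferentiableAt_push (E := E) hι hX
  have hY' := mdifferentiableAt_push (E := E) hι hY
  have hc₁ : MDiffAt (fun _ : M ↦ c) p := mdifferentiableAt_const
  have hc₂ : MDiffAt (fun _ : M ↦ -c) p := mdifferentiableAt_const
  have e : push E ι (fun q ↦ c • (f₁ q • X q - f₂ q • Y q)) =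
      (fun _ : M ↦ c) • (f₁ • push E ι X) + (fun _ : M ↦ -c) • (f₂ • push E ι Y) := by
    ext q
    simp only [push, map_smul, map_sub, Pi.add_apply, Pi.smul_apply']
    module
  have h1 := h.inducedConnection_spec hp (fun q ↦ c • (f₁ q • X q - f₂ q • Y q)) v
  set k := G.inner (ι p) (covAlong (leviCivita G) ι
    (push E ι fun q ↦ c • (f₁ q • X q - f₂ q • Y q)) p v) (mfderiv 𝓘(ℝ, F) 𝓘(ℝ, E) ι p (ξ p))
  have hfX := MDiffAlong.smul hf₁ hX'
  have hfY := MDiffAlong.smul hf₂ hY'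
  rw [e, covAlong_add _ (MDiffAlong.smul hc₁ hfX) (MDiffAlong.smul hc₂ hfY),
    covAlong_smul _ hc₁ hfX, covAlong_smul _ hc₂ hfY, covAlong_smul _ hf₁ hX',
    covAlong_smul _ hf₂ hY', mvfderiv_const, mvfderiv_const, h.inducedConnection_spec hp X,
    h.inducedConnection_spec hp Y] at h1
  set k₁ := G.inner (ι p) (covAlong (leviCivita G) ι (push E ι X) p v)
    (mfderiv 𝓘(ℝ, F) 𝓘(ℝ, E) ι p (ξ p))
  set k₂ := G.inner (ι p) (covAlong (leviCivita G) ι (push E ι Y) p v)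
    (mfderiv 𝓘(ℝ, F) 𝓘(ℝ, E) ι p (ξ p))
  refine (h.pairOn.pair p hp).eq_of_tangent h.hypersurface (c := c * (f₁ p * k₁ - f₂ p * k₂) - k) ?_
  rw [eq_sub_of_add_eq h1.symm]
  simp only [push, map_smul, map_sub, map_add, zero_apply]
  module

end IsUmbilicalPair

/-! ### The four properties for a general Kähler-Norden pair (G, J). -/

section Conclusion

variable {j : NordenStructure G} {S : Π p : M, Submodule ℝ (TangentSpace 𝓘(ℝ, F) p)} {b ρ : ℝ}
  {ν κ : N → ℝ}

lemma HasConstantFunctions.exists_isUmbilicalPair (hC : HasConstantFunctions G ι j.J S b ρ)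
    (hK : j.IsKahler) (hRT : IsRadicalTransversal G ι j.J S) (p : M) :
    ∃ U ξ n, p ∈ U ∧ IsUmbilicalPair j ι S U ξ n b ρ := by
  obtain ⟨U, ξ, n, hp, hn, hJ, hU⟩ := hC p
  exact ⟨U, ξ, n, hp, hK, hRT.hypersurface, hRT.screen, hn, hJ, hU⟩

theorem HasConstantFunctions.curvature_inducedConnection
    (hC : HasConstantFunctions G ι j.J S b ρ) (hK : j.IsKahler)
    (hRT : IsRadicalTransversal G ι j.J S) (hR : j.HasCurvatureForm ν κ) (hF : 3 ≤ finrank ℝ F)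
    (p : M) (x y z : TangentSpace 𝓘(ℝ, F) p) :
    curvature (inducedConnection G ι S) p x y z = (-(ρ ^ 2 * b⁻¹)) •
      (induced j.associated ι p y z • x - induced j.associated ι p x z • y) := by
  obtain ⟨U, ξ, n, hp, h⟩ := hC.exists_isUmbilicalPair hK hRT p
  exact h.curvature_inducedConnection hp hR hF x y z

theorem HasConstantFunctions.isLocallySymmetric
    (hC : HasConstantFunctions G ι j.J S b ρ) (hK : j.IsKahler)
    (hRT : IsRadicalTransversal G ι j.J S) (hR : j.HasCurvatureForm ν κ) (hF : 3 ≤ finrank ℝ F) :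
    IsLocallySymmetric (inducedConnection G ι S) := by
  intro p X Y Z u hX hY hZ
  obtain ⟨U, ξ, n, hp, h⟩ := hC.exists_isUmbilicalPair hK hRT p
  have hXd : MDiffAt (T% X) p := hX.mdifferentiableAt (by simp)
  have hYd : MDiffAt (T% Y) p := hY.mdifferentiableAt (by simp)
  have hZd : MDiffAt (T% Z) p := hZ.mdifferentiableAt (by simp)
  have hι := h.hypersurface.contMDiff p
  have hB (Y : Π p : M, TangentSpace 𝓘(ℝ, F) p) (hY : CMDiffAt ∞ (T% Y) p) :
      MDiffAt (fun q ↦ induced j.associated ι q (Y q) (Z q)) p :=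
    (contMDiffAt_inner (n := ⊤) (contMDiffAt_push (n := ⊤) hι hY)
      (contMDiffAt_push (n := ⊤) hι hZ)).mdifferentiableAt (by simp)
  have hc := hC.curvature_inducedConnection hK hRT hR hF
  simp only [hc]
  rw [h.inducedConnection_smul_sub_smul hp hXd hYd (hB Y hY) (hB X hX),
    h.mvfderiv_induced_associated hp hYd hZd, h.mvfderiv_induced_associated hp hXd hZd]
  module

theorem HasConstantFunctions.symmetries
    (hC : HasConstantFunctions G ι j.J S b ρ) (hK : j.IsKahler)
    (hRT : IsRadicalTransversal G ι j.J S) (hR : j.HasCurvatureForm ν κ) (hF : 3 ≤ finrank ℝ F) :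
    IsLocallySymmetric (inducedConnection G ι S) ∧ IsSemiSymmetric (inducedConnection G ι S) ∧
      IsRicciSemiSymmetric (inducedConnection G ι S) ∧ ∀ p x y,
        ricci (inducedConnection G ι S) p x y =
          -(ρ ^ 2 * b⁻¹) * (1 - finrank ℝ F) * induced j.associated ι p x y := by
  have hc := hC.curvature_inducedConnection hK hRT hR hF
  exact ⟨hC.isLocallySymmetric hK hRT hR hF, isSemiSymmetric_of_curvature hc,
    isRicciSemiSymmetric_of_curvature hc, ricci_eq_of_curvature hc⟩

end Conclusion

end LeviCivita

end KahlerNorden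
end

theorem proposition5p1
    {E : Type*} [NormedAddCommGroup E] [NormedSpace ℝ E] [FiniteDimensional ℝ E]
    {N : Type*} [TopologicalSpace N] [ChartedSpace E N] [IsManifold 𝓘(ℝ, E) ∞ N]
    {F : Type*} [NormedAddCommGroup F] [NormedSpace ℝ F] [FiniteDimensional ℝ F]
    {M : Type*} [TopologicalSpace M] [ChartedSpace F M] [IsManifold 𝓘(ℝ, F) ∞ M]
    (n : ℕ) (hn : 2 ≤ n) (hdim : Module.finrank ℝ E = 2 * n)
    (g : KahlerNorden.SemiRiemannianMetric E N) (j : KahlerNorden.NordenStructure g)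
    (hK : j.IsKahler) (ν ν' : N → ℝ) (hν : j.HasConstantTotallyRealCurvatures ν ν')
    (ι : M → N) (S : Π p : M, Submodule ℝ (TangentSpace 𝓘(ℝ, F) p)) (b ρ : ℝ) :
    (KahlerNorden.IsRadicalTransversal g ι j.J S →
      KahlerNorden.IsTotallyUmbilical g ι S →
      KahlerNorden.HasConstantFunctions g ι j.J S b ρ →
      KahlerNorden.IsLocallySymmetric (KahlerNorden.inducedConnection g ι S) ∧
      KahlerNorden.IsSemiSymmetric (KahlerNorden.inducedConnection g ι S) ∧
      KahlerNorden.IsRicciSemiSymmetric (KahlerNorden.inducedConnection g ι S) ∧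
      KahlerNorden.IsAlmostEinstein ι j (KahlerNorden.inducedConnection g ι S)) ∧
    (KahlerNorden.IsRadicalTransversal j.associated ι j.J S →
      KahlerNorden.IsTotallyUmbilical j.associated ι S →
      KahlerNorden.HasConstantFunctions j.associated ι j.J S b ρ →
      KahlerNorden.IsLocallySymmetric (KahlerNorden.inducedConnection j.associated ι S) ∧
      KahlerNorden.IsSemiSymmetric (KahlerNorden.inducedConnection j.associated ι S) ∧
      KahlerNorden.IsRicciSemiSymmetric (KahlerNorden.inducedConnection j.associated ι S) ∧
      KahlerNorden.IsAlmostEinstein ι j (KahlerNorden.inducedConnection j.associated ι S)) := by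
  have hE : 4 ≤ finrank ℝ E := by omega
  have hR := hν.hasCurvatureForm hK hE
  refine ⟨fun hRT _ hC ↦ ?_, fun hRT _ hC ↦ ?_⟩
  · have hF : 3 ≤ finrank ℝ F := by have := hRT.hypersurface.codim; omega
    obtain ⟨h1, h2, h3, h4⟩ := hC.symmetries hK hRT hR hF
    -- Ric is a multiple of g̃ alone, so `k = 0`.
    exact ⟨h1, h2, h3, 0, _, fun p x y ↦ by rw [h4, zero_mul, zero_add]⟩
  · have hF : 3 ≤ finrank ℝ F := by have := hRT.hypersurface.codim; omega
    obtain ⟨h1, h2, h3, h4⟩ := KahlerNorden.HasConstantFunctions.symmetries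
      (j := j.associatedStructure) hC hK.associated hRT (hR.associated hK) hF
    -- The metric associated with g̃ is -g because J² = -1; this reverses the sign of the
    -- coefficient and leaves a multiple of g alone.
    refine ⟨h1, h2, h3, ρ ^ 2 * b⁻¹ * (1 - finrank ℝ F), 0, fun p x y ↦ ?_⟩
    have e : KahlerNorden.induced j.associatedStructure.associated ι p x y =
        - KahlerNorden.induced g ι p x y := by
      change g.inner (ι p) (j.J (ι p) (j.J (ι p) _)) _ = _
      rw [j.sq, map_neg]
      rfl
    rw [h4, e]
    ring
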